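/- **Setting.** Let $M$ be a smooth finite-dimensional Hausdorff paracompact manifold, $S^1=\{z\in\mathbb C:|z|=1\}$ with angular coordinate $\theta$ and base point $1$, $n\ge 0$, $V=\mathbb C^n$, $G=GL_n(\mathbb C)$. Let $L\mathbb C=C^\infty(S^1,\mathbb C)$ and $LV=C^\infty(S^1,V)$ with their Fréchet topologies, $\partial=d/d\theta$, and let $\Omega G$ be the group of smooth loops $\gamma:S^1\to G$ with $\gamma(1)=1$, acting pointwise on $LV$. Smooth maps between Fréchet spaces are those that have continuous Gateaux derivatives of all orders. * An *$\Omega$ vector bundle* $\mathsf E\to M$ (of rank $n$) is a Fréchet vector bundle with fibre $LV$ and smooth transition functions with values in $\Omega G$; its fibres are $L\mathbb C$-modules. A *based frame* at $x$ is an isomorphism $p:LV\to\mathsf E_x$ which in the given local trivialisations is (the action of) an element of $\Omega G$. Morphisms are smooth isomorphisms over $\mathrm{id}_M$ that map based frames to based frames; these form the groupoid $\Omega\mathrm{Vect}(M)$. A *Higgs field* on $\mathsf E$ is a smooth fibrewise additive map $\phi:\mathsf E\to\mathsf E$ over $\mathrm{id}_M$ with $\phi(fv)=f\phi(v)+(\partial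 f)v$ for $f\in L\mathbb C$. A *module connection* is an additive map $\Delta:\Gamma(\mathsf E)\to\Omega^1(M)\otimes\Gamma(\mathsf E)$ with $\Delta(fs)=f\Delta(s)+df\otimes s$ for all smooth $f:M\to L\mathbb C$; it is *based* if its connection forms in local based frames vanish at the base point of $S^1$. $\Omega\mathrm{Vect}^c(M)$ is the groupoid of triples $(\mathsf E,\Delta,\phi)$ with $\Delta$ a based module connection and $\phi$ a Higgs field, the morphisms being those of $\Omega\mathrm{Vect}(M)$ that preserve $\Delta$ and $\phi$. * $\mathrm{FrVect}(M)$ is the groupoid of smooth complex vector bundles $E\to M\times S^1$ of rank $n$ with a smooth framing $s_0:M\times V\to E|_{M\times\{1\}}$, and framing-preserving isomorphisms over the identity. A connection $\nabla$ on $E$ is *framed* if $s_0^{-1}\circ\iota^*\nabla=d\circ s_0^{-1}$, where $\iota:M\times\{1\}\to M\times S^1$. $\mathrm{FrVect}^c(M)$ is the groupoid of pairs $(E,\nabla)$ with $\nabla$ framed, and connection-preserving morphisms. * The *caloron transform* of $\mathsf E$, with based frame bundle $\mathcal F(\mathsf E)$, is $\mathcal V(\mathsf E)=\big((\mathcal F(\mathsf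 E)\times S^1\times G)/\Omega G\big)\times_G V$, where $(p,z,g)\gamma=(p\gamma,z,\gamma(z)^{-1}g)$, framed over $M\times\{1\}$ by $v\mapsto[[p,1,1],v]$. There is a fibrewise evaluation map $\mathrm{ev}_z:\mathsf E_x\to\mathcal V(\mathsf E)_{(x,z)}$, $\mathrm{ev}_z(p(u))=[[p,z,1],u(z)]$. The *inverse transform* of $E$ is $\mathcal V^{-1}(E)=Q\times_{\Omega G}LV$, where $Q_x$ is the set of smooth loops $z\mapsto q(z)$ of frames of $E$ along $\{x\}\times S^1$ with $q(1)=s_0(x)$; with $\mathrm{ev}_z[q,v]=q(z)v(z)$ its fibre at $x$ is identified with the space of smooth sections of $E$ along $\{x\}\times S^1$. In both cases smooth sections $s$ of the bundle over $M\times S^1$ correspond bijectively to smooth sections $\check s$ of the $\Omega$ vector bundle by $\mathrm{ev}_z(\check s(x))=s(x,z)$; write $\mu(s)=\check s$. * A *Hermitian structure* on $\mathsf E$ is a smooth fibrewise form $\langle\!\langle\cdot,\cdot\rangle\!\rangle:\mathsf E_x\times\mathsf E_x\to L\mathbb C$, $L\mathbb C$-linear in the first variable, with $\langle\!\langle w,v\rangle\!\rangle=\overline{\langle\!\langle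 v,w\rangle\!\rangle}$, with $\langle\!\langle v,v\rangle\!\rangle(z)>0$ whenever $\mathrm{ev}_z(v)\ne0$, and such that $\langle\!\langle p(e_i),p(e_j)\rangle\!\rangle(1)=\delta_{ij}$ for every based frame $p$ and the standard basis $e_1,\dots,e_n$ of $V$. A Hermitian structure on $E\in\mathrm{FrVect}(M)$ is a Hermitian metric for which the framing is orthonormal. $\Omega\mathrm{Vect}^c_H(M)$ is the groupoid of $(\mathsf E,\Delta,\phi)\in\Omega\mathrm{Vect}^c(M)$ with a Hermitian structure such that $d\langle\!\langle v,w\rangle\!\rangle=\langle\!\langle\Delta v,w\rangle\!\rangle+\langle\!\langle v,\Delta w\rangle\!\rangle$ and $\partial\langle\!\langle v,w\rangle\!\rangle=\langle\!\langle\phi v,w\rangle\!\rangle+\langle\!\langle v,\phi w\rangle\!\rangle$; $\mathrm{FrVect}^c_H(M)$ is the groupoid of $(E,\nabla)\in\mathrm{FrVect}^c(M)$ with a Hermitian structure $\langle\cdot,\cdot\rangle$ preserved by $\nabla$. Morphisms preserve the Hermitian structures. **Theorem.** The caloron transforms, with the induced action on morphisms (characterised by naturality of the evaluation maps), form an equivalence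 of groupoids $\mathcal V:\Omega\mathrm{Vect}(M)\rightleftarrows\mathrm{FrVect}(M):\mathcal V^{-1}$, which extends to an equivalence of groupoids $$\mathcal V:\Omega\mathrm{Vect}^c(M)\rightleftarrows\mathrm{FrVect}^c(M):\mathcal V^{-1},$$ where $\mathcal V(\mathsf E,\Delta,\phi)=(\mathcal V(\mathsf E),\nabla)$ with $$\nabla=\Delta+d\theta\otimes\phi,\qquad\text{i.e. } \nabla_{(X,\xi)}s\,(x,z)=\mathrm{ev}_z\big((\Delta_X\check s)(x)\big)+d\theta(\xi)\,\mathrm{ev}_z\big(\phi(\check s(x))\big),$$ and $\mathcal V^{-1}(E,\nabla)=(\mathcal V^{-1}(E),\Delta,\phi)$ with $$\mathrm{ev}_z\big((\Delta_X\check s)(x)\big)=\big(\nabla_{(X,0)}s\big)(x,z),\qquad \mathrm{ev}_z\big(\phi(\check s(x))\big)=\big(\nabla_{(0,\partial/\partial\theta)}s\big)(x,z).$$ The natural isomorphisms $\mathsf E\cong\mathcal V^{-1}(\mathcal V(\mathsf E))$ and $\mathcal V(\mathcal V^{-1}(E))\cong E$ of these equivalences are those compatible with the evaluation maps. Moreover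 this equivalence lifts to an equivalence of groupoids $$\mathcal V:\Omega\mathrm{Vect}^c_H(M)\rightleftarrows\mathrm{FrVect}^c_H(M):\mathcal V^{-1}$$ with the same formulas, in which the Hermitian structures are related by $$\langle \mathrm{ev}_z v,\mathrm{ev}_z w\rangle=\langle\!\langle v,w\rangle\!\rangle(z).$$ -/

import Mathlib

open scoped Manifold ContDiff Topology
open Set Filter

namespace Caloron

section Frechet
universe u v w
variable {X : Type u} {Y : Type v} {Z : Type w}
  [AddCommGroup X] [Module ℝ X] [TopologicalSpace X]
  [AddCommGroup Y] [Module ℝ Y] [TopologicalSpace Y]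
  [AddCommGroup Z] [Module ℝ Z] [TopologicalSpace Z]

/-- The difference quotient `(f (x + t h) - f x) / t`. -/
noncomputable def gateauxQuot (f : X → Y) (x h : X) (t : ℝ) : Y :=
  t⁻¹ • (f (x + t • h) - f x)

/-- The Gateaux derivative `Df(x){h}` (meaningful when the limit exists). -/
noncomputable def gateauxDeriv (f : X → Y) (x h : X) : Y :=
  haveI : Nonempty Y := ⟨0⟩
  limUnder (𝓝[≠] (0 : ℝ)) (gateauxQuot f x h)

end Frechet

/-- `f` is of class `C^k` on the open set `U`, in the sense of Gateaux derivatives. -/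
def GatC.{u, v} {Y : Type v} [AddCommGroup Y] [Module ℝ Y] [TopologicalSpace Y] :
    ∀ (_ : ℕ) {X : Type u} [AddCommGroup X] [Module ℝ X] [TopologicalSpace X]
      (_ : X → Y) (_ : Set X), Prop
  | 0, _, _, _, _, f, U => ContinuousOn f U
  | k + 1, X, _, _, _, f, U => ContinuousOn f U ∧
      (∀ x ∈ U, ∀ h : X, Tendsto (gateauxQuot f x h) (𝓝[≠] (0 : ℝ)) (𝓝 (gateauxDeriv f x h))) ∧
      GatC k (fun p : X × X => gateauxDeriv f p.1 p.2) (U ×ˢ univ)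

section Frechet
universe u v w
variable {X : Type u} {Y : Type v} {Z : Type w}
  [AddCommGroup X] [Module ℝ X] [TopologicalSpace X]
  [AddCommGroup Y] [Module ℝ Y] [TopologicalSpace Y]
  [AddCommGroup Z] [Module ℝ Z] [TopologicalSpace Z]

/-- Smooth (`C^∞`) maps between locally convex spaces, on an open set. -/
def FSmoothOn (f : X → Y) (U : Set X) : Prop := ∀ k, GatC k f U

lemma GatC.continuousOn {k : ℕ} {f : X → Y} {U : Set X} (h : GatC k f U) : ContinuousOn f U := by
  cases k with
  | zero => exact h
  | succ k => exact h.1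

lemma gateauxDeriv_eq [T2Space Y] {f : X → Y} {x h : X} {y : Y}
    (H : Tendsto (gateauxQuot f x h) (𝓝[≠] (0 : ℝ)) (𝓝 y)) : gateauxDeriv f x h = y := by
  have : Nonempty Y := ⟨0⟩
  exact H.limUnder_eq

lemma GatC.of_succ {k : ℕ} : ∀ {X : Type u} [AddCommGroup X] [Module ℝ X] [TopologicalSpace X]
    {f : X → Y} {U : Set X}, GatC (k + 1) f U → GatC k f U := by
  induction k with
  | zero => intro X _ _ _ f U h; exact h.1
  | succ k ih => intro X _ _ _ f U h; exact ⟨h.1, h.2.1, ih h.2.2⟩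

lemma GatC.mono {k : ℕ} : ∀ {X : Type u} [AddCommGroup X] [Module ℝ X] [TopologicalSpace X]
    {f : X → Y} {U V : Set X}, GatC k f U → V ⊆ U → GatC k f V := by
  induction k with
  | zero => intro X _ _ _ f U V h hV; exact ContinuousOn.mono h hV
  | succ k ih =>
    intro X _ _ _ f U V h hV
    exact ⟨h.1.mono hV, fun x hx => h.2.1 x (hV hx), ih h.2.2 (prod_mono hV subset_rfl)⟩

lemma eventually_line [IsTopologicalAddGroup X] [ContinuousSMul ℝ X] {U : Set X} (hU : IsOpen U)
    {x : X} (hx : x ∈ U) (h : X) : ∀ᶠ t : ℝ in 𝓝 0, x + t • h ∈ U := by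
  have : Tendsto (fun t : ℝ => x + t • h) (𝓝 0) (𝓝 (x + (0 : ℝ) • h)) :=
    (Continuous.tendsto (by fun_prop) 0)
  rw [zero_smul, add_zero] at this
  exact this (hU.mem_nhds hx)

lemma gateauxQuot_congr [IsTopologicalAddGroup X] [ContinuousSMul ℝ X] {f g : X → Y} {U : Set X}
    (hU : IsOpen U) (hfg : EqOn f g U) {x : X} (hx : x ∈ U) (h : X) :
    gateauxQuot f x h =ᶠ[𝓝[≠] (0 : ℝ)] gateauxQuot g x h := by
  filter_upwards [(eventually_line hU hx h).filter_mono nhdsWithin_le_nhds] with t ht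
  simp only [gateauxQuot, hfg ht, hfg hx]

lemma gateauxDeriv_congr [IsTopologicalAddGroup X] [ContinuousSMul ℝ X] {f g : X → Y} {U : Set X}
    (hU : IsOpen U) (hfg : EqOn f g U) {x : X} (hx : x ∈ U) (h : X) :
    gateauxDeriv f x h = gateauxDeriv g x h := by
  unfold gateauxDeriv limUnder
  rw [Filter.map_congr (gateauxQuot_congr hU hfg hx h)]

lemma GatC.congr {k : ℕ} : ∀ {X : Type u} [AddCommGroup X] [Module ℝ X] [TopologicalSpace X]
    [IsTopologicalAddGroup X] [ContinuousSMul ℝ X]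
    {f g : X → Y} {U : Set X}, IsOpen U → GatC k f U → EqOn f g U → GatC k g U := by
  induction k with
  | zero => intro X _ _ _ _ _ f g U _ h hfg; exact ContinuousOn.congr h hfg.symm
  | succ k ih =>
    intro X _ _ _ _ _ f g U hU h hfg
    refine ⟨h.1.congr hfg.symm, fun x hx v => ?_, ih (hU.prod isOpen_univ) h.2.2 ?_⟩
    · rw [← gateauxDeriv_congr hU hfg hx v]
      exact (h.2.1 x hx v).congr' (gateauxQuot_congr hU hfg hx v)
    · intro p hp
      exact gateauxDeriv_congr hU hfg hp.1 p.2

lemma GatC.of_local {k : ℕ} : ∀ {X : Type u} [AddCommGroup X] [Module ℝ X] [TopologicalSpace X]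
    {f : X → Y} {U : Set X},
    (∀ x ∈ U, ∃ W, IsOpen W ∧ x ∈ W ∧ GatC k f (U ∩ W)) → GatC k f U := by
  induction k with
  | zero =>
    intro X _ _ _ f U h x hx
    obtain ⟨W, hW, hxW, hf⟩ := h x hx
    have := ContinuousOn.continuousWithinAt hf ⟨hx, hxW⟩
    exact (continuousWithinAt_inter (hW.mem_nhds hxW)).1 this
  | succ k ih =>
    intro X _ _ _ f U h
    refine ⟨fun x hx => ?_, fun x hx v => ?_, ih fun p hp => ?_⟩
    · obtain ⟨W, hW, hxW, hf⟩ := h x hx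
      exact (continuousWithinAt_inter (hW.mem_nhds hxW)).1 (hf.1.continuousWithinAt ⟨hx, hxW⟩)
    · obtain ⟨W, hW, hxW, hf⟩ := h x hx
      exact hf.2.1 x ⟨hx, hxW⟩ v
    · obtain ⟨W, hW, hxW, hf⟩ := h p.1 hp.1
      refine ⟨W ×ˢ univ, hW.prod isOpen_univ, ⟨hxW, mem_univ _⟩, ?_⟩
      have := hf.2.2
      rwa [prod_inter_prod, univ_inter]

lemma GatC.clm {k : ℕ} [T2Space Y] :
    ∀ {X : Type u} [AddCommGroup X] [Module ℝ X] [TopologicalSpace X]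
    (L : X →L[ℝ] Y) (U : Set X), GatC k L U := by
  induction k with
  | zero => intro X _ _ _ L U; exact L.continuous.continuousOn
  | succ k ih =>
    intro X _ _ _ L U
    have key : ∀ x h : X, Tendsto (gateauxQuot L x h) (𝓝[≠] (0 : ℝ)) (𝓝 (L h)) := by
      intro x h
      refine tendsto_const_nhds.congr' ?_
      filter_upwards [self_mem_nhdsWithin] with t ht
      simp only [gateauxQuot, map_add, map_smul, add_sub_cancel_left]
      rw [smul_smul, inv_mul_cancel₀ ht, one_smul]
    have e : (fun p : X × X => gateauxDeriv (L : X → Y) p.1 p.2)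
        = (L.comp (ContinuousLinearMap.snd ℝ X X) : X × X → Y) := by
      funext p; exact gateauxDeriv_eq (key p.1 p.2)
    refine ⟨L.continuous.continuousOn, fun x _ h => ?_, ?_⟩
    · rw [gateauxDeriv_eq (key x h)]; exact key x h
    · rw [e]; exact ih _ _

lemma GatC.prodMk {k : ℕ} [T2Space Y] [T2Space Z] :
    ∀ {X : Type u} [AddCommGroup X] [Module ℝ X] [TopologicalSpace X]
    [IsTopologicalAddGroup X] [ContinuousSMul ℝ X]
    {f : X → Y} {g : X → Z} {U : Set X}, IsOpen U →
    GatC k f U → GatC k g U → GatC k (fun x => (f x, g x)) U := by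
  induction k with
  | zero => intro X _ _ _ _ _ f g U _ hf hg; exact ContinuousOn.prodMk hf hg
  | succ k ih =>
    intro X _ _ _ _ _ f g U hU hf hg
    have key : ∀ x ∈ U, ∀ h, Tendsto (gateauxQuot (fun x => (f x, g x)) x h) (𝓝[≠] (0 : ℝ))
        (𝓝 (gateauxDeriv f x h, gateauxDeriv g x h)) := fun x hx h =>
      (hf.2.1 x hx h).prodMk_nhds (hg.2.1 x hx h)
    refine ⟨hf.1.prodMk hg.1, fun x hx h => ?_, ?_⟩
    · rw [gateauxDeriv_eq (key x hx h)]; exact key x hx h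
    · refine (ih (hU.prod isOpen_univ) hf.2.2 hg.2.2).congr (hU.prod isOpen_univ) ?_
      intro p hp
      exact (gateauxDeriv_eq (key p.1 hp.1 p.2)).symm

/-- Mean value inequality along a segment, in a locally convex space. -/
lemma gateaux_mean_value [IsTopologicalAddGroup Z] [ContinuousSMul ℝ Z]
    {g : Y → Z} {D : Y → Z} {y k : Y} {t : ℝ}
    (ht : t ≠ 0) {N : Set Z} (hN : IsOpen N) (hc : Convex ℝ N)
    (hD : ∀ s ∈ uIcc 0 t, Tendsto (gateauxQuot g (y + s • k) k) (𝓝[≠] (0 : ℝ))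
      (𝓝 (D (y + s • k)))) (hmem : ∀ s ∈ uIcc 0 t, D (y + s • k) ∈ N) :
    gateauxQuot g y k t ∈ N := by
  by_contra hq
  obtain ⟨l, hl⟩ := geometric_hahn_banach_open_point hc hN hq
  set φ : ℝ → ℝ := fun s => l (g (y + s • k)) with hφ
  have hder : ∀ s ∈ uIcc 0 t, HasDerivAt φ (l (D (y + s • k))) s := by
    intro s hs
    rw [hasDerivAt_iff_tendsto_slope_zero]
    have := (l.continuous.tendsto _).comp (hD s hs)
    refine this.congr fun r => ?_
    simp only [gateauxQuot, Function.comp, map_smul, map_sub, hφ, add_smul, add_assoc]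
  have hmv : ∃ s ∈ uIcc 0 t, φ t - φ 0 = l (D (y + s • k)) * t := by
    rcases lt_or_gt_of_ne ht with h | h
    · obtain ⟨s, hs, e⟩ := exists_hasDerivAt_eq_slope φ (fun s => l (D (y + s • k))) h
        (fun s hs => (hder s (by rw [uIcc_of_ge h.le]; exact hs)).continuousAt.continuousWithinAt)
        (fun s hs => hder s (by rw [uIcc_of_ge h.le]; exact Ioo_subset_Icc_self hs))
      refine ⟨s, by rw [uIcc_of_ge h.le]; exact Ioo_subset_Icc_self hs, ?_⟩
      rw [e]; field_simp; ring
    · obtain ⟨s, hs, e⟩ := exists_hasDerivAt_eq_slope φ (fun s => l (D (y + s • k))) h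
        (fun s hs => (hder s (by rw [uIcc_of_le h.le]; exact hs)).continuousAt.continuousWithinAt)
        (fun s hs => hder s (by rw [uIcc_of_le h.le]; exact Ioo_subset_Icc_self hs))
      refine ⟨s, by rw [uIcc_of_le h.le]; exact Ioo_subset_Icc_self hs, ?_⟩
      rw [e]; field_simp; simp
  obtain ⟨s, hs, e⟩ := hmv
  have h1 := hl _ (hmem s hs)
  have h2 : l (gateauxQuot g y k t) = l (D (y + s • k)) := by
    have : l (gateauxQuot g y k t) = t⁻¹ * (φ t - φ 0) := by
      simp [gateauxQuot, hφ]
    rw [this, e]; field_simp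
  exact absurd h1 (by rw [h2]; exact lt_irrefl _)

lemma gateaux_comp [IsTopologicalAddGroup X] [ContinuousSMul ℝ X]
    [IsTopologicalAddGroup Y] [ContinuousSMul ℝ Y]
    [IsTopologicalAddGroup Z] [ContinuousSMul ℝ Z] [LocallyConvexSpace ℝ Z]
    {f : X → Y} {g : Y → Z} {W : Set Y} (hW : IsOpen W) {x h : X} {y' : Y} (hx : f x ∈ W)
    (hf : Tendsto (gateauxQuot f x h) (𝓝[≠] (0 : ℝ)) (𝓝 y'))
    (hg : ∀ y ∈ W, ∀ k, Tendsto (gateauxQuot g y k) (𝓝[≠] (0 : ℝ)) (𝓝 (gateauxDeriv g y k)))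
    (hgc : ContinuousOn (fun p : Y × Y => gateauxDeriv g p.1 p.2) (W ×ˢ univ)) :
    Tendsto (gateauxQuot (g ∘ f) x h) (𝓝[≠] (0 : ℝ)) (𝓝 (gateauxDeriv g (f x) y')) := by
  set y := f x with hy
  have hbasis := LocallyConvexSpace.convex_open_basis_zero ℝ Z
  have hb2 : (𝓝 (gateauxDeriv g y y')).HasBasis
      (fun s : Set Z => (0 : Z) ∈ s ∧ IsOpen s ∧ Convex ℝ s)
      (fun s => (fun z => gateauxDeriv g y y' + z) '' s) := by
    have := hbasis.map (fun z => gateauxDeriv g y y' + z)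
    rwa [map_add_left_nhds_zero] at this
  rw [hb2.tendsto_right_iff]
  rintro N₀ ⟨h0, hNo, hNc⟩
  set N := (fun z => gateauxDeriv g y y' + z) '' N₀ with hNdef
  have hN : IsOpen N := (Homeomorph.addLeft (gateauxDeriv g y y')).isOpenMap _ hNo
  have hc : Convex ℝ N := hNc.translate _
  have hmem : gateauxDeriv g y y' ∈ N := ⟨0, h0, add_zero _⟩
  -- the set of good `(s, k)`
  have hopen : IsOpen ((W ×ˢ univ) ∩ (fun p : Y × Y => gateauxDeriv g p.1 p.2) ⁻¹' N) :=
    hgc.isOpen_inter_preimage (hW.prod isOpen_univ) hN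
  have hcont : Continuous fun q : ℝ × Y => (y + q.1 • q.2, q.2) := by fun_prop
  have hgood : ∀ᶠ q : ℝ × Y in 𝓝 (0, y'), y + q.1 • q.2 ∈ W ∧
      gateauxDeriv g (y + q.1 • q.2) q.2 ∈ N := by
    have := hcont.tendsto (0, y')
    simp only [zero_smul, add_zero] at this
    have h2 := this (hopen.mem_nhds ⟨⟨hx, mem_univ _⟩, hmem⟩)
    filter_upwards [h2] with q hq
    exact ⟨hq.1.1, hq.2⟩
  rw [nhds_prod_eq, eventually_prod_iff] at hgood
  obtain ⟨pa, hpa, pb, hpb, hab⟩ := hgood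
  obtain ⟨δ, hδ, hball⟩ := Metric.eventually_nhds_iff.1 hpa
  have e1 : ∀ᶠ t : ℝ in 𝓝[≠] 0, |t| < δ := by
    refine Filter.Eventually.filter_mono nhdsWithin_le_nhds ?_
    filter_upwards [Metric.ball_mem_nhds (0 : ℝ) hδ] with t ht
    simpa using ht
  filter_upwards [e1, hf hpb, self_mem_nhdsWithin] with t ht hk ht0
  have ht0' : t ≠ 0 := ht0
  set k := gateauxQuot f x h t with hkdef
  have hfx : f (x + t • h) = y + t • k := by
    simp only [hkdef, gateauxQuot]
    rw [smul_smul, mul_inv_cancel₀ ht0', one_smul]; simp [hy]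
  have hs : ∀ s ∈ uIcc 0 t, pa s := by
    intro s hs
    apply hball
    rw [Real.dist_eq, sub_zero]
    refine lt_of_le_of_lt ?_ ht
    have := abs_sub_left_of_mem_uIcc hs
    simpa using this
  have := gateaux_mean_value (g := g) (D := fun w => gateauxDeriv g w k) (y := y) (k := k) ht0' hN hc
    (fun s h' => hg _ (hab (hs s h') hk).1 k) (fun s h' => (hab (hs s h') hk).2)
  have e : gateauxQuot (g ∘ f) x h t = gateauxQuot g y k t := by
    simp only [gateauxQuot, Function.comp, hfx, ← hy]
  rw [e]; exact this

lemma GatC.comp_clm {k : ℕ} : ∀ {X X' : Type u}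
    [AddCommGroup X] [Module ℝ X] [TopologicalSpace X]
    [AddCommGroup X'] [Module ℝ X'] [TopologicalSpace X'] [IsTopologicalAddGroup X']
    [ContinuousSMul ℝ X'] {f : X → Y} {U : Set X} (L : X' →L[ℝ] X), IsOpen U →
    GatC k f U → GatC k (fun x => f (L x)) (L ⁻¹' U) := by
  induction k with
  | zero =>
    intro X X' _ _ _ _ _ _ _ _ f U L _ hf
    exact ContinuousOn.comp hf L.continuous.continuousOn fun x hx => hx
  | succ k ih =>
    intro X X' _ _ _ _ _ _ _ _ f U L hU hf
    have q : ∀ x h, gateauxQuot (fun x => f (L x)) x h = gateauxQuot f (L x) (L h) := by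
      intro x h; funext t; simp only [gateauxQuot, map_add, map_smul]
    have e : ∀ x h, gateauxDeriv (fun x => f (L x)) x h = gateauxDeriv f (L x) (L h) := by
      intro x h; simp only [gateauxDeriv, q]
    refine ⟨hf.1.comp L.continuous.continuousOn fun x hx => hx, fun x hx h => ?_, ?_⟩
    · rw [q, e]; exact hf.2.1 _ hx _
    · have := ih (L.prodMap L) (hU.prod (isOpen_univ (X := X))) hf.2.2
      simp only [e]
      exact this.mono fun p hp => ⟨hp.1, mem_univ _⟩

lemma GatC.comp {k : ℕ} : ∀ {X : Type u} {Y : Type v}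
    [AddCommGroup X] [Module ℝ X] [TopologicalSpace X] [IsTopologicalAddGroup X]
    [ContinuousSMul ℝ X] [T2Space X] [LocallyConvexSpace ℝ X]
    [AddCommGroup Y] [Module ℝ Y] [TopologicalSpace Y] [IsTopologicalAddGroup Y]
    [ContinuousSMul ℝ Y] [T2Space Y] [LocallyConvexSpace ℝ Y]
    [IsTopologicalAddGroup Z] [ContinuousSMul ℝ Z] [T2Space Z] [LocallyConvexSpace ℝ Z]
    {f : X → Y} {g : Y → Z} {U : Set X} {W : Set Y}, IsOpen U → IsOpen W →
    GatC k g W → GatC k f U → MapsTo f U W → GatC k (g ∘ f) U := by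
  induction k with
  | zero => intros; exact ContinuousOn.comp ‹_› ‹_› ‹_›
  | succ k ih =>
    intro X Y _ _ _ _ _ _ _ _ _ _ _ _ _ _ _ _ _ _ f g U W hU hW hg hf hm
    have key : ∀ x ∈ U, ∀ h, Tendsto (gateauxQuot (g ∘ f) x h) (𝓝[≠] (0 : ℝ))
        (𝓝 (gateauxDeriv g (f x) (gateauxDeriv f x h))) := fun x hx h =>
      gateaux_comp hW (hm hx) (hf.2.1 x hx h) hg.2.1 hg.2.2.continuousOn
    refine ⟨hg.1.comp hf.1 hm, fun x hx h => ?_, ?_⟩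
    · rw [gateauxDeriv_eq (key x hx h)]; exact key x hx h
    · have hU' : IsOpen (U ×ˢ (univ : Set X)) := hU.prod isOpen_univ
      have h1 : GatC k (f ∘ Prod.fst) (U ×ˢ (univ : Set X)) :=
        (hf.of_succ.comp_clm (ContinuousLinearMap.fst ℝ X X) hU).mono fun p hp => hp.1
      have h2 := h1.prodMk hU' hf.2.2
      have h3 := ih hU' (hW.prod (isOpen_univ (X := Y))) hg.2.2 h2 fun p hp =>
        ⟨hm hp.1, mem_univ _⟩
      refine h3.congr hU' ?_
      intro p hp
      exact (gateauxDeriv_eq (key p.1 hp.1 p.2)).symm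

end Frechet
end Caloron

namespace Caloron

/-! ### The ring of smooth loops in `ℂ` -/

/-- Smooth functions `S¹ → ℂ`, as a subalgebra of all functions. -/
def smoothLoops : Subalgebra ℂ (Circle → ℂ) where
  carrier := {f | ContMDiff (𝓡 1) 𝓘(ℝ, ℂ) ∞ f}
  mul_mem' {f g} hf hg := by
    have : ContDiff ℝ ∞ fun p : ℂ × ℂ => p.1 * p.2 := contDiff_fst.mul contDiff_snd
    exact this.contMDiff.comp (hf.prodMk_space hg)
  add_mem' {f g} hf hg := by
    have : ContDiff ℝ ∞ fun p : ℂ × ℂ => p.1 + p.2 := contDiff_fst.add contDiff_snd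
    exact this.contMDiff.comp (hf.prodMk_space hg)
  algebraMap_mem' c := contMDiff_const

/-- `LC` is the ring of smooth loops `S¹ → ℂ`.  It is a type of its own, so that it carries the
Fréchet topology defined below and not the topology of pointwise convergence. -/
def LC : Type := smoothLoops

noncomputable instance : CommRing LC := inferInstanceAs (CommRing smoothLoops)
noncomputable instance : Algebra ℂ LC := inferInstanceAs (Algebra ℂ smoothLoops)
noncomputable instance : Algebra ℝ LC := Algebra.compHom LC (algebraMap ℝ ℂ)

instance : CoeFun LC fun _ => Circle → ℂ := ⟨fun f => f.1⟩

namespace LC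

lemma smooth (f : LC) : ContMDiff (𝓡 1) 𝓘(ℝ, ℂ) ∞ f := f.2

/-- The loop given by a smooth function. -/
def mk (f : Circle → ℂ) (hf : ContMDiff (𝓡 1) 𝓘(ℝ, ℂ) ∞ f) : LC := ⟨f, hf⟩

@[ext] lemma ext {f g : LC} (h : ∀ z, f z = g z) : f = g := Subtype.ext (funext h)

/-- Evaluation at a point of the circle. -/
noncomputable def eval (z : Circle) : LC →+* ℂ := (Pi.evalRingHom _ z).comp smoothLoops.val.toRingHom

@[simp] lemma add_apply (f g : LC) (z : Circle) : (f + g) z = f z + g z := rfl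
@[simp] lemma mul_apply (f g : LC) (z : Circle) : (f * g) z = f z * g z := rfl
@[simp] lemma smul_apply (c : ℂ) (f : LC) (z : Circle) : (c • f) z = c * f z := rfl
@[simp] lemma real_smul_apply (c : ℝ) (f : LC) (z : Circle) : (c • f) z = c * f z := rfl
@[simp] lemma mk_apply (f : Circle → ℂ) (hf) (z : Circle) : mk f hf z = f z := rfl
@[simp] lemma eval_apply (f : LC) (z : Circle) : eval z f = f z := rfl

lemma contDiff_lift (f : LC) (z : Circle) : ContDiff ℝ ∞ fun t : ℝ => f (z * Circle.exp t) := by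
  have h : ContMDiff 𝓘(ℝ, ℝ) (𝓡 1) ∞ fun t : ℝ => z * Circle.exp t :=
    contMDiff_const.mul contMDiff_circleExp
  exact (f.smooth.comp h).contDiff

/-- The derivative `∂f = df/dθ` as a function. -/
noncomputable def derivFun (f : LC) (z : Circle) : ℂ := deriv (fun t : ℝ => f (z * Circle.exp t)) 0

lemma derivFun_smooth (f : LC) : ContMDiff (𝓡 1) 𝓘(ℝ, ℂ) ∞ (derivFun f) := by
  intro z
  have h : ContMDiff ((𝓡 1).prod 𝓘(ℝ, ℝ)) (𝓡 1) ∞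
      fun p : Circle × ℝ => p.1 * Circle.exp p.2 :=
    contMDiff_fst.mul (contMDiff_circleExp.comp contMDiff_snd)
  have h1 := ContMDiffAt.mfderiv_apply (n := ∞) (m := ∞) (x₀ := z) (N' := Circle)
    (fun (z : Circle) (t : ℝ) => f (z * Circle.exp t)) (fun _ => (0 : ℝ)) id (fun _ => (1 : ℝ))
    ((f.smooth.comp h).contMDiffAt) contMDiffAt_const contMDiffAt_id contMDiffAt_const (by simp)
  refine h1.congr_of_eventuallyEq (Filter.Eventually.of_forall fun w => ?_)
  have e := congrFun (inTangentCoordinates_model_space (I := 𝓘(ℝ, ℝ)) (I' := 𝓘(ℝ, ℂ))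
    (fun _ : Circle => (0 : ℝ)) (fun w : Circle => f (w * Circle.exp 0))
    (fun w : Circle => fderiv ℝ (fun t : ℝ => f (w * Circle.exp t)) 0) z) w
  simp only [mfderiv_eq_fderiv, id]
  refine Eq.trans ?_ (congrArg (fun L : ℝ →L[ℝ] ℂ => L 1) e.symm)
  exact fderiv_apply_one_eq_deriv.symm

/-- The derivation `∂ = d/dθ` of the ring of smooth loops. -/
noncomputable def del : LC →ₗ[ℝ] LC where
  toFun f := mk (derivFun f) (derivFun_smooth f)
  map_add' f g := by
    ext z
    have hf := ((contDiff_lift f z).differentiable (by simp)) 0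
    have hg := ((contDiff_lift g z).differentiable (by simp)) 0
    exact deriv_fun_add hf hg
  map_smul' c f := by
    ext z
    have hf := ((contDiff_lift f z).differentiable (by simp)) 0
    exact deriv_const_mul (c : ℂ) hf

/-- The complex conjugate of a loop. -/
noncomputable def conj (f : LC) : LC :=
  mk (fun z => (starRingEnd ℂ) (f z)) (by
    have : ContDiff ℝ ∞ fun w : ℂ => (starRingEnd ℂ) w := Complex.conjCLE.contDiff
    exact this.contMDiff.comp f.smooth)

/-- The `k`-th derivative as a continuous function on the circle. -/
noncomputable def derivCont (k : ℕ) : LC →ₗ[ℝ] C(Circle, ℂ) where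
  toFun f := ⟨(del ^ k) f, ((del ^ k) f).smooth.continuous⟩
  map_add' f g := by ext z; simp
  map_smul' c f := by ext z; simp

/-- The Fréchet topology: uniform convergence of all derivatives. -/
noncomputable instance : TopologicalSpace LC := ⨅ k, TopologicalSpace.induced (derivCont k) inferInstance

instance : IsTopologicalAddGroup LC :=
  topologicalAddGroup_iInf fun k => topologicalAddGroup_induced (derivCont k)

instance : ContinuousSMul ℝ LC := continuousSMul_iInf fun k => continuousSMul_induced (derivCont k)

instance : LocallyConvexSpace ℝ LC :=
  LocallyConvexSpace.iInf fun k => LocallyConvexSpace.induced (derivCont k)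

instance : T2Space LC := by
  have h : Continuous (derivCont 0) :=
    continuous_iff_le_induced.2 (iInf_le (fun k => TopologicalSpace.induced (derivCont k) _) 0)
  refine T2Space.of_injective_continuous (f := derivCont 0) (fun f g e => ?_) h
  ext z
  exact congrArg (fun c : C(Circle, ℂ) => c z) e

end LC
end Caloron

namespace Caloron

/-! ### Loop spaces -/

/-- The smooth loops in `ℂⁿ`. -/
abbrev LV (n : ℕ) : Type := Fin n → LC

/-- The loop group of `GL_n(ℂ)`: a smooth loop in `GL_n(ℂ)` is an invertible matrix over the ring
of smooth loops. The subgroup consists of the loops based at the identity. -/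
noncomputable def OmegaGL (n : ℕ) : Subgroup (Matrix.GeneralLinearGroup (Fin n) LC) :=
  (Matrix.GeneralLinearGroup.map (n := Fin n) (LC.eval 1)).ker

/-- The pointwise action of a loop of matrices on a loop of vectors. -/
noncomputable def act {n : ℕ} (γ : Matrix.GeneralLinearGroup (Fin n) LC) (v : LV n) : LV n :=
  Matrix.mulVec (γ : Matrix (Fin n) (Fin n) LC) v

/-- The constant loop. -/
noncomputable def constLoop {n : ℕ} (v : Fin n → ℂ) : LV n := fun i => algebraMap ℂ LC (v i)

lemma act_one {n : ℕ} (v : LV n) : act 1 v = v := by simp [act]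

lemma act_mul {n : ℕ} (γ δ : Matrix.GeneralLinearGroup (Fin n) LC) (v : LV n) :
    act (γ * δ) v = act γ (act δ v) := by simp [act]

/-! ### Local trivialisations of families of modules -/

section Triv
universe u v w
variable {B : Type v} {R : Type w} [CommRing R] {F : Type w} [AddCommGroup F] [Module R F]

/-- A local trivialisation, over `base`, of a family of `R`-modules, with typical fibre `F`. -/
structure LocalTriv (R : Type w) [CommRing R] (F : Type w) [AddCommGroup F] [Module R F]
    (fib : B → Type u) [∀ b, AddCommGroup (fib b)] [∀ b, Module R (fib b)] where
  base : Set B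
  triv : ∀ b ∈ base, fib b ≃ₗ[R] F

variable {fib fib' fib'' : B → Type u}
  [∀ b, AddCommGroup (fib b)] [∀ b, Module R (fib b)]
  [∀ b, AddCommGroup (fib' b)] [∀ b, Module R (fib' b)]
  [∀ b, AddCommGroup (fib'' b)] [∀ b, Module R (fib'' b)]

open scoped Classical in
/-- The coordinates of a vector; zero outside of the domain. -/
noncomputable def LocalTriv.coord (ψ : LocalTriv R F fib) (b : B) : fib b →ₗ[R] F :=
  if h : b ∈ ψ.base then (ψ.triv b h).toLinearMap else 0

open scoped Classical in
/-- The vector with given coordinates; zero outside of the domain. -/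
noncomputable def LocalTriv.frame (ψ : LocalTriv R F fib) (b : B) : F →ₗ[R] fib b :=
  if h : b ∈ ψ.base then (ψ.triv b h).symm.toLinearMap else 0

lemma LocalTriv.coord_frame (ψ : LocalTriv R F fib) {b : B} (h : b ∈ ψ.base) (v : F) :
    ψ.coord b (ψ.frame b v) = v := by simp [coord, frame, h]

lemma LocalTriv.frame_coord (ψ : LocalTriv R F fib) {b : B} (h : b ∈ ψ.base) (v : fib b) :
    ψ.frame b (ψ.coord b v) = v := by simp [coord, frame, h]

/-- A fibrewise map read in trivialisations. -/
noncomputable def readMap (ψ : LocalTriv R F fib) (ψ' : LocalTriv R F fib')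
    (f : ∀ b, fib b → fib' b) (b : B) (v : F) : F := ψ'.coord b (f b (ψ.frame b v))

lemma readMap_comp (ψ : LocalTriv R F fib) (ψ' : LocalTriv R F fib') (ψ'' : LocalTriv R F fib'')
    (f : ∀ b, fib b → fib' b) (g : ∀ b, fib' b → fib'' b) {b : B} (h : b ∈ ψ'.base) (v : F) :
    readMap ψ ψ'' (fun b v => g b (f b v)) b v
      = readMap ψ' ψ'' g b (readMap ψ ψ' f b v) := by
  simp [readMap, ψ'.frame_coord h]

end Triv

/-! ### Smooth maps from a manifold to locally convex spaces -/

/-- The model space of a `d`-dimensional manifold. -/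
abbrev Eu (d : ℕ) : Type := EuclideanSpace ℝ (Fin d)

section SmoothM
universe v w
variable (d : ℕ) {M : Type v} [TopologicalSpace M] [ChartedSpace (Eu d) M]
  {X Y Z : Type w} [AddCommGroup X] [Module ℝ X] [TopologicalSpace X]
  [AddCommGroup Y] [Module ℝ Y] [TopologicalSpace Y]
  [AddCommGroup Z] [Module ℝ Z] [TopologicalSpace Z]

/-- Smoothness on the open set `U` of a map from a manifold to a locally convex space. -/
def FSmoothM (U : Set M) (f : M → Y) : Prop :=
  ∀ e ∈ atlas (Eu d) M, FSmoothOn (f ∘ e.symm) (e.target ∩ e.symm ⁻¹' U)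

/-- Smoothness of the map `(x, v) ↦ f x v` on `U × X`. -/
def FSmoothMF (U : Set M) (f : M → X → Y) : Prop :=
  ∀ e ∈ atlas (Eu d) M, FSmoothOn (fun p : Eu d × X => f (e.symm p.1) p.2)
    ((e.target ∩ e.symm ⁻¹' U) ×ˢ univ)

variable {d}

lemma FSmoothMF.congr [IsTopologicalAddGroup X] [ContinuousSMul ℝ X] {U : Set M} (hU : IsOpen U)
    {f g : M → X → Y} (hf : FSmoothMF d U f) (h : ∀ x ∈ U, ∀ v, f x v = g x v) :
    FSmoothMF d U g := fun e he k =>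
  (hf e he k).congr ((e.isOpen_inter_preimage_symm hU).prod isOpen_univ)
    fun p hp => h _ hp.1.2 _

lemma FSmoothMF.of_local {U : Set M} {f : M → X → Y}
    (h : ∀ x ∈ U, ∃ W, IsOpen W ∧ x ∈ W ∧ FSmoothMF d (U ∩ W) f) : FSmoothMF d U f := by
  intro e he k
  refine GatC.of_local fun p hp => ?_
  obtain ⟨W, hW, hxW, hf⟩ := h _ hp.1.2
  refine ⟨(e.target ∩ e.symm ⁻¹' W) ×ˢ univ,
    (e.isOpen_inter_preimage_symm hW).prod isOpen_univ, ⟨⟨hp.1.1, hxW⟩, mem_univ _⟩, ?_⟩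
  refine (hf e he k).mono ?_
  rintro q ⟨⟨⟨h1, h2⟩, -⟩, ⟨⟨-, h3⟩, -⟩⟩
  exact ⟨⟨h1, h2, h3⟩, mem_univ _⟩

lemma FSmoothMF.mono {U V : Set M} {f : M → X → Y} (hf : FSmoothMF d U f) (h : V ⊆ U) :
    FSmoothMF d V f := fun e he k => (hf e he k).mono <| by
  rintro q ⟨⟨h1, h2⟩, -⟩
  exact ⟨⟨h1, h h2⟩, mem_univ _⟩

lemma FSmoothMF.comp [IsTopologicalAddGroup X] [ContinuousSMul ℝ X] [T2Space X]
    [LocallyConvexSpace ℝ X] [IsTopologicalAddGroup Y] [ContinuousSMul ℝ Y] [T2Space Y]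
    [LocallyConvexSpace ℝ Y] [IsTopologicalAddGroup Z] [ContinuousSMul ℝ Z] [T2Space Z]
    [LocallyConvexSpace ℝ Z] {U : Set M} (hU : IsOpen U) {f : M → X → Y} {g : M → Y → Z}
    (hg : FSmoothMF d U g) (hf : FSmoothMF d U f) : FSmoothMF d U fun x v => g x (f x v) := by
  intro e he k
  have hU' := e.isOpen_inter_preimage_symm hU
  exact GatC.comp (hU'.prod isOpen_univ) (hU'.prod isOpen_univ) (hg e he k)
    ((GatC.clm (ContinuousLinearMap.fst ℝ (Eu d) X) _).prodMk (hU'.prod isOpen_univ) (hf e he k))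
    fun p hp => ⟨hp.1, mem_univ _⟩

lemma FSmoothM.comp_map [IsTopologicalAddGroup Y] [ContinuousSMul ℝ Y] [T2Space Y]
    [LocallyConvexSpace ℝ Y] [IsTopologicalAddGroup Z] [ContinuousSMul ℝ Z] [T2Space Z]
    [LocallyConvexSpace ℝ Z] {U : Set M} (hU : IsOpen U) {f : M → Y} {g : M → Y → Z}
    (hg : FSmoothMF d U g) (hf : FSmoothM d U f) : FSmoothM d U fun x => g x (f x) := by
  intro e he k
  have hU' := e.isOpen_inter_preimage_symm hU
  have h1 : GatC k (fun p : Eu d => (p, f (e.symm p))) (e.target ∩ e.symm ⁻¹' U) :=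
    (GatC.clm (ContinuousLinearMap.id ℝ (Eu d)) _).prodMk hU' (hf e he k)
  exact (GatC.comp hU' (hU'.prod isOpen_univ) (hg e he k) h1 fun p hp => ⟨hp, mem_univ _⟩ :)

lemma FSmoothM.congr {U : Set M} (hU : IsOpen U)
    {f g : M → Y} (hf : FSmoothM d U f) (h : ∀ x ∈ U, f x = g x) :
    FSmoothM d U g := fun e he k =>
  (hf e he k).congr (e.isOpen_inter_preimage_symm hU) fun _ hp => h _ hp.2

lemma FSmoothM.mono {U V : Set M} {f : M → Y} (hf : FSmoothM d U f) (h : V ⊆ U) :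
    FSmoothM d V f := fun e he k => (hf e he k).mono fun _ hp => ⟨hp.1, h hp.2⟩

lemma FSmoothM.of_local {U : Set M} {f : M → Y}
    (h : ∀ x ∈ U, ∃ W, IsOpen W ∧ x ∈ W ∧ FSmoothM d (U ∩ W) f) : FSmoothM d U f := by
  intro e he k
  refine GatC.of_local fun p hp => ?_
  obtain ⟨W, hW, hxW, hf⟩ := h _ hp.2
  refine ⟨e.target ∩ e.symm ⁻¹' W, e.isOpen_inter_preimage_symm hW, ⟨hp.1, hxW⟩, ?_⟩
  refine (hf e he k).mono ?_
  rintro q ⟨⟨h1, h2⟩, ⟨-, h3⟩⟩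
  exact ⟨h1, h2, h3⟩

end SmoothM
end Caloron

namespace Caloron

/-! ### `Ω` vector bundles -/

section
universe u v

/-- An `Ω` vector bundle of rank `n` over the `d`-dimensional manifold `M`: the typical fibre is the
Fréchet space `LV` of smooth loops in `V = ℂⁿ`, and the transition functions are smooth and given
by pointwise multiplication by based loops in `GL_n(ℂ)`. -/
structure OVect (d n : ℕ) (M : Type v) [TopologicalSpace M] [ChartedSpace (Eu d) M] where
  fib : M → Type u
  [acg : ∀ x, AddCommGroup (fib x)]
  [mod : ∀ x, Module LC (fib x)]
  /-- the based local trivialisations -/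
  atlas : Set (LocalTriv LC (LV n) fib)
  isOpen : ∀ ψ ∈ atlas, IsOpen ψ.base
  cover : ∀ x, ∃ ψ ∈ atlas, x ∈ ψ.base
  trans_smooth : ∀ ψ ∈ atlas, ∀ ψ' ∈ atlas,
    FSmoothMF d (ψ.base ∩ ψ'.base) (readMap ψ ψ' fun _ v => v)
  trans_based : ∀ ψ ∈ atlas, ∀ ψ' ∈ atlas, ∀ x ∈ ψ.base ∩ ψ'.base,
    ∃ γ ∈ OmegaGL n, ∀ v, readMap ψ ψ' (fun _ v => v) x v = act γ v

attribute [instance] OVect.acg OVect.mod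

variable {d n : ℕ} {M : Type v} [TopologicalSpace M] [ChartedSpace (Eu d) M]

namespace OVect

/-- Smoothness on the open set `U` of a section. -/
def IsSmoothSecOn (E : OVect.{u} d n M) (U : Set M) (s : ∀ x, E.fib x) : Prop :=
  ∀ ψ ∈ E.atlas, FSmoothM d (U ∩ ψ.base) fun x => ψ.coord x (s x)

/-- Global smooth sections. -/
def Sec (E : OVect.{u} d n M) : Type (max u v) := {s : ∀ x, E.fib x // E.IsSmoothSecOn univ s}

instance (E : OVect.{u} d n M) : CoeFun E.Sec fun _ => ∀ x, E.fib x := ⟨fun s => s.1⟩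

/-- The based frames of the fibre over `x`, i.e. the fibre over `x` of the frame bundle, which is an
`ΩGL_n(ℂ)`-bundle. -/
def IsFrame (E : OVect.{u} d n M) (x : M) (p : LV n ≃ₗ[LC] E.fib x) : Prop :=
  ∀ ψ ∈ E.atlas, x ∈ ψ.base → ∃ γ ∈ OmegaGL n, ∀ v, ψ.coord x (p v) = act γ v

/-- The value at `z ∈ S¹` of the vector `v` of the fibre over `x` is zero. -/
def Vanishes (E : OVect.{u} d n M) (x : M) (z : Circle) (v : E.fib x) : Prop :=
  ∀ ψ ∈ E.atlas, x ∈ ψ.base → ∀ i, (ψ.coord x v i) z = 0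

/-- Isomorphisms of `Ω` vector bundles over the identity of `M`. -/
structure Hom (E E' : OVect.{u} d n M) where
  toEquiv : ∀ x, E.fib x ≃ₗ[LC] E'.fib x
  smooth : ∀ ψ ∈ E.atlas, ∀ ψ' ∈ E'.atlas,
    FSmoothMF d (ψ.base ∩ ψ'.base) (readMap ψ ψ' fun x v => toEquiv x v)
  smooth_symm : ∀ ψ ∈ E.atlas, ∀ ψ' ∈ E'.atlas,
    FSmoothMF d (ψ'.base ∩ ψ.base) (readMap ψ' ψ fun x v => (toEquiv x).symm v)
  based : ∀ ψ ∈ E.atlas, ∀ ψ' ∈ E'.atlas, ∀ x ∈ ψ.base ∩ ψ'.base,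
    ∃ γ ∈ OmegaGL n, ∀ v, readMap ψ ψ' (fun x v => toEquiv x v) x v = act γ v

lemma smooth_comp_aux {E E' E'' : OVect.{u} d n M} {f : ∀ x, E.fib x → E'.fib x}
    {g : ∀ x, E'.fib x → E''.fib x} {ψ : LocalTriv LC (LV n) E.fib}
    {ψ'' : LocalTriv LC (LV n) E''.fib} (hψ : IsOpen ψ.base) (hψ'' : IsOpen ψ''.base)
    (hf : ∀ ψ' ∈ E'.atlas, FSmoothMF d (ψ.base ∩ ψ'.base) (readMap ψ ψ' f))
    (hg : ∀ ψ' ∈ E'.atlas, FSmoothMF d (ψ'.base ∩ ψ''.base) (readMap ψ' ψ'' g)) :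
    FSmoothMF d (ψ.base ∩ ψ''.base) (readMap ψ ψ'' fun x v => g x (f x v)) := by
  refine FSmoothMF.of_local fun x hx => ?_
  obtain ⟨ψ', h', hx'⟩ := E'.cover x
  have o := E'.isOpen ψ' h'
  refine ⟨ψ'.base, o, hx', ?_⟩
  have o' := (hψ.inter hψ'').inter o
  refine FSmoothMF.congr o' (FSmoothMF.comp o' ((hg ψ' h').mono fun y hy => ⟨hy.2, hy.1.2⟩)
    ((hf ψ' h').mono fun y hy => ⟨hy.1.1, hy.2⟩)) fun y hy v => ?_
  exact (readMap_comp ψ ψ' ψ'' f g hy.2 v).symm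

namespace Hom

@[ext] lemma ext {E E' : OVect.{u} d n M} {f g : Hom E E'}
    (h : ∀ x v, f.toEquiv x v = g.toEquiv x v) : f = g := by
  obtain ⟨f, _, _, _⟩ := f
  obtain ⟨g, _, _, _⟩ := g
  have : f = g := funext fun x => LinearEquiv.ext (h x)
  subst this; rfl

/-- The identity. -/
noncomputable def id (E : OVect.{u} d n M) : Hom E E where
  toEquiv x := LinearEquiv.refl LC _
  smooth := E.trans_smooth
  smooth_symm := fun ψ h ψ' h' => E.trans_smooth ψ' h' ψ h
  based := E.trans_based

/-- Composition. -/
noncomputable def comp {E E' E'' : OVect.{u} d n M} (f : Hom E E') (g : Hom E' E'') : Hom E E'' where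
  toEquiv x := (f.toEquiv x).trans (g.toEquiv x)
  smooth ψ h ψ'' h'' := smooth_comp_aux (E' := E') (E.isOpen ψ h) (E''.isOpen ψ'' h'')
    (fun ψ' h' => f.smooth ψ h ψ' h') fun ψ' h' => g.smooth ψ' h' ψ'' h''
  smooth_symm ψ h ψ'' h'' := smooth_comp_aux (E' := E') (E''.isOpen ψ'' h'') (E.isOpen ψ h)
    (fun ψ' h' => g.smooth_symm ψ' h' ψ'' h'') fun ψ' h' => f.smooth_symm ψ h ψ' h'
  based ψ h ψ'' h'' x hx := by
    obtain ⟨ψ', h', hx'⟩ := E'.cover x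
    obtain ⟨γ, hγ, e⟩ := f.based ψ h ψ' h' x ⟨hx.1, hx'⟩
    obtain ⟨δ, hδ, e'⟩ := g.based ψ' h' ψ'' h'' x ⟨hx', hx.2⟩
    refine ⟨δ * γ, mul_mem hδ hγ, fun v => ?_⟩
    rw [act_mul, ← e, ← e']
    exact readMap_comp ψ ψ' ψ'' (fun x v => f.toEquiv x v) (fun x v => g.toEquiv x v) hx' v

/-- The inverse. -/
noncomputable def inv {E E' : OVect.{u} d n M} (f : Hom E E') : Hom E' E where
  toEquiv x := (f.toEquiv x).symm
  smooth ψ h ψ' h' := f.smooth_symm ψ' h' ψ h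
  smooth_symm ψ h ψ' h' := f.smooth ψ' h' ψ h
  based ψ' h' ψ h x hx := by
    obtain ⟨γ, hγ, e⟩ := f.based ψ h ψ' h' x ⟨hx.2, hx.1⟩
    refine ⟨γ⁻¹, inv_mem hγ, fun v => ?_⟩
    have := e (readMap ψ' ψ (fun x v => (f.toEquiv x).symm v) x v)
    rw [← readMap_comp ψ' ψ ψ' (fun x v => (f.toEquiv x).symm v) (fun x v => f.toEquiv x v) hx.2]
      at this
    simp only [readMap, LinearEquiv.apply_symm_apply, ψ'.coord_frame hx.1] at this
    have h2 := congrArg (act γ⁻¹) this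
    rw [← act_mul, inv_mul_cancel, act_one] at h2
    exact h2.symm

/-- The induced map on sections. -/
noncomputable def mapSec {E E' : OVect.{u} d n M} (f : Hom E E') (s : E.Sec) : E'.Sec :=
  ⟨fun x => f.toEquiv x (s x), fun ψ' h' => by
    refine FSmoothM.of_local fun x hx => ?_
    obtain ⟨ψ, h, hx'⟩ := E.cover x
    have o := E.isOpen ψ h
    refine ⟨ψ.base, o, hx', ?_⟩
    have o' : IsOpen ((univ ∩ ψ'.base) ∩ ψ.base) :=
      (isOpen_univ.inter (E'.isOpen ψ' h')).inter o
    refine FSmoothM.congr o' (FSmoothM.comp_map o'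
      ((f.smooth ψ h ψ' h').mono fun y hy => ⟨hy.2, hy.1.2⟩)
      ((s.2 ψ h).mono fun y hy => ⟨mem_univ _, hy.2⟩)) fun y hy => ?_
    simp only [readMap, ψ.frame_coord hy.2]⟩

end Hom
end OVect

/-! ### Module connections and Higgs fields -/

/-- Smooth vector fields on `M`. -/
def IsSmoothField (d : ℕ) {M : Type v} [TopologicalSpace M] [ChartedSpace (Eu d) M]
    [IsManifold (𝓡 d) ∞ M] (X : ∀ x : M, TangentSpace (𝓡 d) x) : Prop :=
  ContMDiff (𝓡 d) (𝓡 d).tangent ∞ fun x => (⟨x, X x⟩ : TangentBundle (𝓡 d) M)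

/-- The differential `df(X)` of a smooth map from a manifold to the ring of loops. -/
noncomputable def dLoop (d : ℕ) {M : Type v} [TopologicalSpace M] [ChartedSpace (Eu d) M]
    (f : M → LC) (x : M) (X : TangentSpace (𝓡 d) x) : LC :=
  gateauxDeriv (f ∘ (chartAt (Eu d) x).symm) (chartAt (Eu d) x x) (X : Eu d)

variable [IsManifold (𝓡 d) ∞ M]

/-- A based module connection on an `Ω` vector bundle. -/
structure ModConn (E : OVect.{u} d n M) where
  /-- `Δ_X s` at the point `x`, for `X ∈ T_x M` -/
  toFun : E.Sec → ∀ x, TangentSpace (𝓡 d) x → E.fib x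
  add_vec : ∀ s x X Y, toFun s x (X + Y) = toFun s x X + toFun s x Y
  smul_vec : ∀ s x (c : ℝ) X, toFun s x (c • X) = algebraMap ℝ LC c • toFun s x X
  smooth : ∀ s X, IsSmoothField d X → E.IsSmoothSecOn univ fun x => toFun s x (X x)
  add : ∀ s t r : E.Sec, (∀ x, r x = s x + t x) →
    ∀ x X, toFun r x X = toFun s x X + toFun t x X
  leibniz : ∀ f : M → LC, FSmoothM d univ f → ∀ s t : E.Sec, (∀ x, t x = f x • s x) →
    ∀ x X, toFun t x X = f x • toFun s x X + dLoop d f x X • s x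
  /-- in a based local frame `e_1, …, e_n` the connection form `A`, given by
  `Δ_X e_i = ∑ j, A_i^j(X) e_j`, vanishes at the base point of the circle -/
  based : ∀ ψ ∈ E.atlas, ∀ x ∈ ψ.base, ∀ (i : Fin n) (s : E.Sec),
    (∀ᶠ y in 𝓝 x, ψ.coord y (s y) = Pi.single i 1) →
    ∀ X j, (ψ.coord x (toFun s x X) j) 1 = 0

/-- A Higgs field on an `Ω` vector bundle. -/
structure Higgs (E : OVect.{u} d n M) where
  toFun : ∀ x, E.fib x → E.fib x
  add : ∀ x v w, toFun x (v + w) = toFun x v + toFun x w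
  leibniz : ∀ x (f : LC) v, toFun x (f • v) = f • toFun x v + LC.del f • v
  smooth : ∀ ψ ∈ E.atlas, ∀ ψ' ∈ E.atlas, FSmoothMF d (ψ.base ∩ ψ'.base) (readMap ψ ψ' toFun)

end
end Caloron

namespace Caloron

/-! ### Framed vector bundles over `M × S¹` -/

section
universe u v

/-- The model with corners of `M × S¹`. -/
noncomputable abbrev MI (d : ℕ) := (𝓡 d).prod (𝓡 1)

/-- The tangent vector `(X, ξ)` of `M × S¹`. -/
def pairVec {d : ℕ} {M : Type v} [TopologicalSpace M] [ChartedSpace (Eu d) M] {x : M} {z : Circle}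
    (X : TangentSpace (𝓡 d) x) (ξ : TangentSpace (𝓡 1) z) : TangentSpace (MI d) (x, z) := (X, ξ)

/-- The tangent vector `∂/∂θ` of the circle at `z`. -/
noncomputable def angVec (z : Circle) : TangentSpace (𝓡 1) z :=
  (mfderiv 𝓘(ℝ, ℝ) (𝓡 1) (fun t : ℝ => z * Circle.exp t) 0 : ℝ →L[ℝ] Eu 1) (1 : ℝ)

/-- The differential `df(X)` of a function on a manifold with values in a vector space `F`. -/
noncomputable def dFun {E H F : Type} {N : Type v} [NormedAddCommGroup E] [NormedSpace ℝ E]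
    [TopologicalSpace H] (I : ModelWithCorners ℝ E H) [TopologicalSpace N] [ChartedSpace H N]
    [NormedAddCommGroup F] [NormedSpace ℝ F] (f : N → F) (p : N) (X : TangentSpace I p) : F :=
  mfderiv I 𝓘(ℝ, F) f p X

/-- The `1`-form `dθ` on the circle, i.e. the imaginary part of `dz / z`. -/
noncomputable def angForm (z : Circle) (ξ : TangentSpace (𝓡 1) z) : ℝ :=
  (dFun (𝓡 1) (fun w : Circle => (w : ℂ)) z ξ / (z : ℂ)).im

/-- A complex vector bundle of rank `n` over `M × S¹`, framed over `M × {1}`. -/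
structure FrVect (d n : ℕ) (M : Type v) [TopologicalSpace M] [ChartedSpace (Eu d) M] where
  fib : M × Circle → Type u
  [acg : ∀ p, AddCommGroup (fib p)]
  [mod : ∀ p, Module ℂ (fib p)]
  /-- the local trivialisations -/
  atlas : Set (LocalTriv ℂ (Fin n → ℂ) fib)
  isOpen : ∀ ψ ∈ atlas, IsOpen ψ.base
  cover : ∀ p, ∃ ψ ∈ atlas, p ∈ ψ.base
  trans_smooth : ∀ ψ ∈ atlas, ∀ ψ' ∈ atlas,
    ContMDiffOn ((MI d).prod 𝓘(ℝ, Fin n → ℂ)) 𝓘(ℝ, Fin n → ℂ) ∞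
      (fun q : (M × Circle) × (Fin n → ℂ) => readMap ψ ψ' (fun _ v => v) q.1 q.2)
      ((ψ.base ∩ ψ'.base) ×ˢ univ)
  framing : ∀ x, (Fin n → ℂ) ≃ₗ[ℂ] fib (x, 1)
  framing_smooth : ∀ ψ ∈ atlas, ∀ v, ContMDiffOn (𝓡 d) 𝓘(ℝ, Fin n → ℂ) ∞
    (fun x => ψ.coord (x, 1) (framing x v)) {x | (x, 1) ∈ ψ.base}

attribute [instance] FrVect.acg FrVect.mod

variable {d n : ℕ} {M : Type v} [TopologicalSpace M] [ChartedSpace (Eu d) M]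

namespace FrVect

/-- Smoothness on the open set `U` of a section. -/
def IsSmoothSecOn (E : FrVect.{u} d n M) (U : Set (M × Circle)) (s : ∀ p, E.fib p) : Prop :=
  ∀ ψ ∈ E.atlas, ContMDiffOn (MI d) 𝓘(ℝ, Fin n → ℂ) ∞ (fun p => ψ.coord p (s p)) (U ∩ ψ.base)

/-- Global smooth sections. -/
def Sec (E : FrVect.{u} d n M) : Type (max u v) := {s : ∀ p, E.fib p // E.IsSmoothSecOn univ s}

instance (E : FrVect.{u} d n M) : CoeFun E.Sec fun _ => ∀ p, E.fib p := ⟨fun s => s.1⟩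

/-- Smooth sections of the restriction of `E` to the circle `{x} × S¹`. -/
def IsSmoothLoop (E : FrVect.{u} d n M) (x : M) (σ : ∀ z : Circle, E.fib (x, z)) : Prop :=
  ∀ ψ ∈ E.atlas, ContMDiffOn (𝓡 1) 𝓘(ℝ, Fin n → ℂ) ∞ (fun z => ψ.coord (x, z) (σ z))
    {z | (x, z) ∈ ψ.base}

/-- The smooth loops of frames of `E` over `{x} × S¹` that agree with the framing at `(x, 1)`. -/
def IsLoopFrame (E : FrVect.{u} d n M) (x : M)
    (q : ∀ z : Circle, (Fin n → ℂ) ≃ₗ[ℂ] E.fib (x, z)) : Prop :=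
  (∀ v, E.IsSmoothLoop x fun z => q z v) ∧ q 1 = E.framing x

/-- Isomorphisms of framed vector bundles over the identity of `M × S¹`. -/
structure Hom (E E' : FrVect.{u} d n M) where
  toEquiv : ∀ p, E.fib p ≃ₗ[ℂ] E'.fib p
  smooth : ∀ ψ ∈ E.atlas, ∀ ψ' ∈ E'.atlas,
    ContMDiffOn ((MI d).prod 𝓘(ℝ, Fin n → ℂ)) 𝓘(ℝ, Fin n → ℂ) ∞
      (fun q : (M × Circle) × (Fin n → ℂ) => readMap ψ ψ' (fun p v => toEquiv p v) q.1 q.2)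
      ((ψ.base ∩ ψ'.base) ×ˢ univ)
  smooth_symm : ∀ ψ ∈ E.atlas, ∀ ψ' ∈ E'.atlas,
    ContMDiffOn ((MI d).prod 𝓘(ℝ, Fin n → ℂ)) 𝓘(ℝ, Fin n → ℂ) ∞
      (fun q : (M × Circle) × (Fin n → ℂ) =>
        readMap ψ' ψ (fun p v => (toEquiv p).symm v) q.1 q.2) ((ψ'.base ∩ ψ.base) ×ˢ univ)
  framed : ∀ x v, toEquiv (x, 1) (E.framing x v) = E'.framing x v

lemma smooth_comp_aux {E E' E'' : FrVect.{u} d n M} {f : ∀ x, E.fib x → E'.fib x}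
    {g : ∀ x, E'.fib x → E''.fib x} {ψ : LocalTriv ℂ (Fin n → ℂ) E.fib}
    {ψ'' : LocalTriv ℂ (Fin n → ℂ) E''.fib}
    (hf : ∀ ψ' ∈ E'.atlas, ContMDiffOn ((MI d).prod 𝓘(ℝ, Fin n → ℂ)) 𝓘(ℝ, Fin n → ℂ) ∞
      (fun q : (M × Circle) × (Fin n → ℂ) => readMap ψ ψ' f q.1 q.2)
      ((ψ.base ∩ ψ'.base) ×ˢ univ))
    (hg : ∀ ψ' ∈ E'.atlas, ContMDiffOn ((MI d).prod 𝓘(ℝ, Fin n → ℂ)) 𝓘(ℝ, Fin n → ℂ) ∞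
      (fun q : (M × Circle) × (Fin n → ℂ) => readMap ψ' ψ'' g q.1 q.2)
      ((ψ'.base ∩ ψ''.base) ×ˢ univ)) :
    ContMDiffOn ((MI d).prod 𝓘(ℝ, Fin n → ℂ)) 𝓘(ℝ, Fin n → ℂ) ∞
      (fun q : (M × Circle) × (Fin n → ℂ) => readMap ψ ψ'' (fun x v => g x (f x v)) q.1 q.2)
      ((ψ.base ∩ ψ''.base) ×ˢ univ) := by
  refine contMDiffOn_of_locally_contMDiffOn fun q hq => ?_
  obtain ⟨ψ', h', hx'⟩ := E'.cover q.1
  refine ⟨ψ'.base ×ˢ univ, (E'.isOpen ψ' h').prod isOpen_univ, ⟨hx', mem_univ _⟩, ?_⟩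
  have h1 : ContMDiffOn ((MI d).prod 𝓘(ℝ, Fin n → ℂ)) ((MI d).prod 𝓘(ℝ, Fin n → ℂ)) ∞
      (fun q : (M × Circle) × (Fin n → ℂ) => (q.1, readMap ψ ψ' f q.1 q.2))
      ((ψ.base ∩ ψ'.base) ×ˢ univ) := contMDiffOn_fst.prodMk (hf ψ' h')
  refine (((hg ψ' h').comp (h1.mono (t := ((ψ.base ∩ ψ''.base) ∩ ψ'.base) ×ˢ univ)
    fun r hr => ⟨⟨hr.1.1.1, hr.1.2⟩, mem_univ _⟩)
    fun r hr => ⟨⟨hr.1.2, hr.1.1.2⟩, mem_univ _⟩).congr fun r hr => ?_).mono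
    fun r hr => ⟨⟨hr.1.1, hr.2.1⟩, mem_univ _⟩
  exact readMap_comp ψ ψ' ψ'' f g hr.1.2 r.2

namespace Hom

@[ext] lemma ext {E E' : FrVect.{u} d n M} {f g : Hom E E'}
    (h : ∀ x v, f.toEquiv x v = g.toEquiv x v) : f = g := by
  obtain ⟨f, _, _, _⟩ := f
  obtain ⟨g, _, _, _⟩ := g
  have : f = g := funext fun x => LinearEquiv.ext (h x)
  subst this; rfl

/-- The identity. -/
noncomputable def id (E : FrVect.{u} d n M) : Hom E E where
  toEquiv _ := LinearEquiv.refl ℂ _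
  smooth := E.trans_smooth
  smooth_symm := fun ψ h ψ' h' => E.trans_smooth ψ' h' ψ h
  framed _ _ := rfl

/-- Composition. -/
noncomputable def comp {E E' E'' : FrVect.{u} d n M} (f : Hom E E') (g : Hom E' E'') :
    Hom E E'' where
  toEquiv p := (f.toEquiv p).trans (g.toEquiv p)
  smooth ψ h ψ'' h'' := smooth_comp_aux (E' := E')
    (fun ψ' h' => f.smooth ψ h ψ' h') fun ψ' h' => g.smooth ψ' h' ψ'' h''
  smooth_symm ψ h ψ'' h'' := smooth_comp_aux (E' := E')
    (fun ψ' h' => g.smooth_symm ψ' h' ψ'' h'') fun ψ' h' => f.smooth_symm ψ h ψ' h'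
  framed x v := by simp [f.framed, g.framed]

/-- The inverse. -/
noncomputable def inv {E E' : FrVect.{u} d n M} (f : Hom E E') : Hom E' E where
  toEquiv p := (f.toEquiv p).symm
  smooth ψ h ψ' h' := f.smooth_symm ψ' h' ψ h
  smooth_symm ψ h ψ' h' := f.smooth ψ' h' ψ h
  framed x v := by rw [LinearEquiv.symm_apply_eq, f.framed]

/-- The induced map on sections. -/
noncomputable def mapSec {E E' : FrVect.{u} d n M} (f : Hom E E') (s : E.Sec) : E'.Sec :=
  ⟨fun p => f.toEquiv p (s p), fun ψ' h' => by
    refine contMDiffOn_of_locally_contMDiffOn fun p hp => ?_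
    obtain ⟨ψ, h, hx'⟩ := E.cover p
    refine ⟨ψ.base, E.isOpen ψ h, hx', ?_⟩
    have h1 : ContMDiffOn (MI d) ((MI d).prod 𝓘(ℝ, Fin n → ℂ)) ∞
        (fun p : M × Circle => (p, ψ.coord p (s p))) (univ ∩ ψ.base) :=
      contMDiffOn_id.prodMk (s.2 ψ h)
    refine ((f.smooth ψ h ψ' h').comp (h1.mono (t := (univ ∩ ψ'.base) ∩ ψ.base)
      fun r hr => ⟨mem_univ _, hr.2⟩) fun r hr => ⟨⟨hr.2, hr.1.2⟩, mem_univ _⟩).congr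
      fun r hr => ?_
    simp only [readMap, Function.comp, ψ.frame_coord hr.2]⟩

end Hom
end FrVect

variable [IsManifold (𝓡 d) ∞ M]

/-- A framed connection on a framed vector bundle over `M × S¹`. -/
structure FrConn (E : FrVect.{u} d n M) where
  /-- `∇_X s` at the point `p`, for `X ∈ T_p (M × S¹)` -/
  toFun : E.Sec → ∀ p, TangentSpace (MI d) p → E.fib p
  add_vec : ∀ s p X Y, toFun s p (X + Y) = toFun s p X + toFun s p Y
  smul_vec : ∀ s p (c : ℝ) X, toFun s p (c • X) = (c : ℂ) • toFun s p X
  smooth : ∀ (s : E.Sec) (X : ∀ p : M × Circle, TangentSpace (MI d) p),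
    ContMDiff (MI d) (MI d).tangent ∞ (fun p => (⟨p, X p⟩ : TangentBundle (MI d) (M × Circle))) →
    E.IsSmoothSecOn univ fun p => toFun s p (X p)
  add : ∀ s t r : E.Sec, (∀ p, r p = s p + t p) →
    ∀ p X, toFun r p X = toFun s p X + toFun t p X
  leibniz : ∀ f : M × Circle → ℂ, ContMDiff (MI d) 𝓘(ℝ, ℂ) ∞ f →
    ∀ s t : E.Sec, (∀ p, t p = f p • s p) →
    ∀ p X, toFun t p X = f p • toFun s p X + dFun (MI d) f p X • s p
  /-- along `M × {1}` the connection is the trivial one defined by the framing -/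
  framed : ∀ (s : E.Sec) x (X : TangentSpace (𝓡 d) x),
    (E.framing x).symm (toFun s (x, 1) (pairVec X (0 : TangentSpace (𝓡 1) (1 : Circle))))
      = dFun (𝓡 d) (fun y => (E.framing y).symm (s (y, 1))) x X

end
end Caloron

namespace Caloron

open CategoryTheory

/-! ### The groupoids -/

section
universe u v
variable (d n : ℕ) (M : Type v) [TopologicalSpace M] [ChartedSpace (Eu d) M]

noncomputable instance : Groupoid (OVect.{u} d n M) where
  Hom := OVect.Hom
  id := OVect.Hom.id
  comp f g := f.comp g
  inv f := f.inv
  id_comp f := OVect.Hom.ext fun _ _ => rfl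
  comp_id f := OVect.Hom.ext fun _ _ => rfl
  assoc f g h := OVect.Hom.ext fun _ _ => rfl
  inv_comp f := OVect.Hom.ext fun x v => (f.toEquiv x).apply_symm_apply v
  comp_inv f := OVect.Hom.ext fun x v => (f.toEquiv x).symm_apply_apply v

noncomputable instance : Groupoid (FrVect.{u} d n M) where
  Hom := FrVect.Hom
  id := FrVect.Hom.id
  comp f g := f.comp g
  inv f := f.inv
  id_comp f := FrVect.Hom.ext fun _ _ => rfl
  comp_id f := FrVect.Hom.ext fun _ _ => rfl
  assoc f g h := FrVect.Hom.ext fun _ _ => rfl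
  inv_comp f := FrVect.Hom.ext fun x v => (f.toEquiv x).apply_symm_apply v
  comp_inv f := FrVect.Hom.ext fun x v => (f.toEquiv x).symm_apply_apply v

variable {d n M} in
/-- The map of fibres given by a morphism. -/
noncomputable def OVect.fibMap {E E' : OVect.{u} d n M} (f : E ⟶ E') (x : M) :
    E.fib x ≃ₗ[LC] E'.fib x := OVect.Hom.toEquiv f x

variable {d n M} in
/-- The map of fibres given by a morphism. -/
noncomputable def FrVect.fibMap {E E' : FrVect.{u} d n M} (f : E ⟶ E') (p : M × Circle) :
    E.fib p ≃ₗ[ℂ] E'.fib p := FrVect.Hom.toEquiv f p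

variable [IsManifold (𝓡 d) ∞ M]

/-- `Ω` vector bundles with a based module connection and a Higgs field. -/
structure OVectC where
  bdl : OVect.{u} d n M
  conn : ModConn bdl
  higgs : Higgs bdl

/-- Framed vector bundles over `M × S¹` with a framed connection. -/
structure FrVectC where
  bdl : FrVect.{u} d n M
  conn : FrConn bdl

variable {d n M}

/-- Isomorphisms preserving the connection and the Higgs field. -/
@[ext] structure OVectC.Hom (A B : OVectC.{u} d n M) where
  iso : OVect.Hom A.bdl B.bdl
  conn_map : ∀ s x X, iso.toEquiv x (A.conn.toFun s x X) = B.conn.toFun (iso.mapSec s) x X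
  higgs_map : ∀ x v, iso.toEquiv x (A.higgs.toFun x v) = B.higgs.toFun x (iso.toEquiv x v)

/-- Isomorphisms preserving the connection. -/
@[ext] structure FrVectC.Hom (A B : FrVectC.{u} d n M) where
  iso : FrVect.Hom A.bdl B.bdl
  conn_map : ∀ s p X, iso.toEquiv p (A.conn.toFun s p X) = B.conn.toFun (iso.mapSec s) p X

noncomputable instance : Groupoid (OVectC.{u} d n M) where
  Hom := OVectC.Hom
  id A := ⟨OVect.Hom.id A.bdl, fun _ _ _ => rfl, fun _ _ => rfl⟩
  comp f g := ⟨f.iso.comp g.iso,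
    fun s x X => (congrArg (g.iso.toEquiv x) (f.conn_map s x X)).trans (g.conn_map _ x X),
    fun x v => (congrArg (g.iso.toEquiv x) (f.higgs_map x v)).trans (g.higgs_map x _)⟩
  inv {A B} f := ⟨f.iso.inv, fun s x X => by
      have h := f.conn_map (f.iso.inv.mapSec s) x X
      have e : f.iso.mapSec (f.iso.inv.mapSec s) = s :=
        Subtype.ext (funext fun y => (f.iso.toEquiv y).apply_symm_apply _)
      rw [e] at h
      exact (LinearEquiv.symm_apply_eq _).2 h.symm,
    fun x v => by
      have h := f.higgs_map x ((f.iso.toEquiv x).symm v)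
      rw [LinearEquiv.apply_symm_apply] at h
      exact (LinearEquiv.symm_apply_eq _).2 h.symm⟩
  id_comp f := OVectC.Hom.ext (OVect.Hom.ext fun _ _ => rfl)
  comp_id f := OVectC.Hom.ext (OVect.Hom.ext fun _ _ => rfl)
  assoc f g h := OVectC.Hom.ext (OVect.Hom.ext fun _ _ => rfl)
  inv_comp f := OVectC.Hom.ext (OVect.Hom.ext fun x v => (f.iso.toEquiv x).apply_symm_apply v)
  comp_inv f := OVectC.Hom.ext (OVect.Hom.ext fun x v => (f.iso.toEquiv x).symm_apply_apply v)

noncomputable instance : Groupoid (FrVectC.{u} d n M) where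
  Hom := FrVectC.Hom
  id A := ⟨FrVect.Hom.id A.bdl, fun _ _ _ => rfl⟩
  comp f g := ⟨f.iso.comp g.iso,
    fun s x X => (congrArg (g.iso.toEquiv x) (f.conn_map s x X)).trans (g.conn_map _ x X)⟩
  inv {A B} f := ⟨f.iso.inv, fun s x X => by
      have h := f.conn_map (f.iso.inv.mapSec s) x X
      have e : f.iso.mapSec (f.iso.inv.mapSec s) = s :=
        Subtype.ext (funext fun y => (f.iso.toEquiv y).apply_symm_apply _)
      rw [e] at h
      exact (LinearEquiv.symm_apply_eq _).2 h.symm⟩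
  id_comp f := FrVectC.Hom.ext (FrVect.Hom.ext fun _ _ => rfl)
  comp_id f := FrVectC.Hom.ext (FrVect.Hom.ext fun _ _ => rfl)
  assoc f g h := FrVectC.Hom.ext (FrVect.Hom.ext fun _ _ => rfl)
  inv_comp f := FrVectC.Hom.ext (FrVect.Hom.ext fun x v => (f.iso.toEquiv x).apply_symm_apply v)
  comp_inv f := FrVectC.Hom.ext (FrVect.Hom.ext fun x v => (f.iso.toEquiv x).symm_apply_apply v)

/-! ### Hermitian structures -/

/-- A Hermitian structure on an `Ω` vector bundle: a smooth `LC`-valued Hermitian form, positive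
at every point of the circle, for which the based frames are orthonormal at the base point. -/
structure HermO (E : OVect.{u} d n M) where
  form : ∀ x, E.fib x → E.fib x → LC
  add_left : ∀ x v v' w, form x (v + v') w = form x v w + form x v' w
  smul_left : ∀ x (f : LC) v w, form x (f • v) w = f * form x v w
  conj_symm : ∀ x v w, form x w v = LC.conj (form x v w)
  pos : ∀ x v z, ¬ E.Vanishes x z v → 0 < (form x v v z).re
  smooth : ∀ (U : Set M) (s t : ∀ x, E.fib x), IsOpen U → E.IsSmoothSecOn U s →
    E.IsSmoothSecOn U t → FSmoothM d U fun x => form x (s x) (t x)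
  based : ∀ x p, E.IsFrame x p → ∀ i j,
    form x (p (Pi.single i 1)) (p (Pi.single j 1)) 1 = if i = j then 1 else 0

/-- A Hermitian structure on a framed vector bundle, for which the framing is orthonormal. -/
structure HermFr (E : FrVect.{u} d n M) where
  form : ∀ p, E.fib p → E.fib p → ℂ
  add_left : ∀ p v v' w, form p (v + v') w = form p v w + form p v' w
  smul_left : ∀ p (c : ℂ) v w, form p (c • v) w = c * form p v w
  conj_symm : ∀ p v w, form p w v = (starRingEnd ℂ) (form p v w)
  pos : ∀ p v, v ≠ 0 → 0 < (form p v v).re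
  smooth : ∀ (U : Set (M × Circle)) (s t : ∀ p, E.fib p), IsOpen U → E.IsSmoothSecOn U s →
    E.IsSmoothSecOn U t → ContMDiffOn (MI d) 𝓘(ℝ, ℂ) ∞ (fun p => form p (s p) (t p)) U
  framed : ∀ x i j, form (x, 1) (E.framing x (Pi.single i 1)) (E.framing x (Pi.single j 1))
    = if i = j then 1 else 0

variable (d n M)

/-- Hermitian `Ω` vector bundles with a based module connection and a Higgs field, both compatible
with the Hermitian structure. -/
structure OVectHC where
  base : OVectC.{u} d n M
  herm : HermO base.bdl
  conn_compat : ∀ (s t : base.bdl.Sec) x X, dLoop d (fun y => herm.form y (s y) (t y)) x X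
    = herm.form x (base.conn.toFun s x X) (t x) + herm.form x (s x) (base.conn.toFun t x X)
  higgs_compat : ∀ x v w, LC.del (herm.form x v w)
    = herm.form x (base.higgs.toFun x v) w + herm.form x v (base.higgs.toFun x w)

/-- Framed Hermitian vector bundles over `M × S¹` with a framed connection compatible with the
Hermitian structure. -/
structure FrVectHC where
  base : FrVectC.{u} d n M
  herm : HermFr base.bdl
  conn_compat : ∀ (s t : base.bdl.Sec) p X, dFun (MI d) (fun q => herm.form q (s q) (t q)) p X
    = herm.form p (base.conn.toFun s p X) (t p) + herm.form p (s p) (base.conn.toFun t p X)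

variable {d n M}

/-- Isometric isomorphisms preserving the connection and the Higgs field. -/
@[ext] structure OVectHC.Hom (A B : OVectHC.{u} d n M) where
  iso : A.base ⟶ B.base
  herm_map : ∀ x v w, B.herm.form x (iso.iso.toEquiv x v) (iso.iso.toEquiv x w) = A.herm.form x v w

/-- Isometric isomorphisms preserving the connection. -/
@[ext] structure FrVectHC.Hom (A B : FrVectHC.{u} d n M) where
  iso : A.base ⟶ B.base
  herm_map : ∀ p v w, B.herm.form p (iso.iso.toEquiv p v) (iso.iso.toEquiv p w) = A.herm.form p v w

noncomputable instance : Groupoid (OVectHC.{u} d n M) where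
  Hom := OVectHC.Hom
  id A := ⟨𝟙 A.base, fun _ _ _ => rfl⟩
  comp f g := ⟨f.iso ≫ g.iso, fun x v w => (g.herm_map x _ _).trans (f.herm_map x v w)⟩
  inv f := ⟨Groupoid.inv f.iso, fun x v w => by
    rw [← f.herm_map]
    exact congrArg₂ _ ((f.iso.iso.toEquiv x).apply_symm_apply v)
      ((f.iso.iso.toEquiv x).apply_symm_apply w)⟩
  id_comp f := OVectHC.Hom.ext (Category.id_comp f.iso)
  comp_id f := OVectHC.Hom.ext (Category.comp_id f.iso)
  assoc f g h := OVectHC.Hom.ext (Category.assoc f.iso g.iso h.iso)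
  inv_comp f := OVectHC.Hom.ext (Groupoid.inv_comp f.iso)
  comp_inv f := OVectHC.Hom.ext (Groupoid.comp_inv f.iso)

noncomputable instance : Groupoid (FrVectHC.{u} d n M) where
  Hom := FrVectHC.Hom
  id A := ⟨𝟙 A.base, fun _ _ _ => rfl⟩
  comp f g := ⟨f.iso ≫ g.iso, fun x v w => (g.herm_map x _ _).trans (f.herm_map x v w)⟩
  inv f := ⟨Groupoid.inv f.iso, fun x v w => by
    rw [← f.herm_map]
    exact congrArg₂ _ ((f.iso.iso.toEquiv x).apply_symm_apply v)
      ((f.iso.iso.toEquiv x).apply_symm_apply w)⟩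
  id_comp f := FrVectHC.Hom.ext (Category.id_comp f.iso)
  comp_id f := FrVectHC.Hom.ext (Category.comp_id f.iso)
  assoc f g h := FrVectHC.Hom.ext (Category.assoc f.iso g.iso h.iso)
  inv_comp f := FrVectHC.Hom.ext (Groupoid.inv_comp f.iso)
  comp_inv f := FrVectHC.Hom.ext (Groupoid.comp_inv f.iso)

/-- Forgetting the module connection and the Higgs field. -/
noncomputable def forgetConnO : OVectC.{u} d n M ⥤ OVect.{u} d n M where
  obj A := A.bdl
  map f := f.iso

/-- Forgetting the connection. -/
noncomputable def forgetConnFr : FrVectC.{u} d n M ⥤ FrVect.{u} d n M where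
  obj A := A.bdl
  map f := f.iso

/-- Forgetting the Hermitian structure. -/
noncomputable def forgetHermO : OVectHC.{u} d n M ⥤ OVectC.{u} d n M where
  obj A := A.base
  map f := f.iso

/-- Forgetting the Hermitian structure. -/
noncomputable def forgetHermFr : FrVectHC.{u} d n M ⥤ FrVectC.{u} d n M where
  obj A := A.base
  map f := f.iso

/-! ### The caloron correspondence -/

/-- The relation between an `Ω` vector bundle `𝖤` over `M` and a framed vector bundle `E` over
`M × S¹` that are caloron transforms of each other: `ev x z : 𝖤_x → E_(x,z)` is evaluation of loops
at `z`. It identifies `𝖤_x` with the smooth sections of `E` along `{x} × S¹`, smooth sections of `𝖤`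
with smooth sections of `E`, and based frames with loops of frames starting at the framing. -/
structure CaloronPairing (A : OVect.{u} d n M) (E : FrVect.{u} d n M) where
  ev : ∀ x z, A.fib x → E.fib (x, z)
  map_add : ∀ x z v w, ev x z (v + w) = ev x z v + ev x z w
  map_smul : ∀ x z (f : LC) v, ev x z (f • v) = f z • ev x z v
  ev_eq_zero : ∀ x z v, ev x z v = 0 ↔ A.Vanishes x z v
  surjective : ∀ x z, Function.Surjective (ev x z)
  loops : ∀ x (σ : ∀ z, E.fib (x, z)), E.IsSmoothLoop x σ ↔ ∃ v, ∀ z, ev x z v = σ z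
  sections : ∀ (U : Set M) (s : ∀ x, A.fib x), IsOpen U →
    (A.IsSmoothSecOn U s ↔ E.IsSmoothSecOn (U ×ˢ univ) fun p => ev p.1 p.2 (s p.1))
  framing : ∀ x p, A.IsFrame x p → ∀ v, ev x 1 (p (constLoop v)) = E.framing x v

namespace CaloronPairing
variable {A : OVect.{u} d n M} {E : FrVect.{u} d n M} (P : CaloronPairing A E)

/-- The sections `s` of `E` and `t` of `𝖤` correspond to each other: `t(x)(z) = s(x, z)`. -/
def Corr (s : E.Sec) (t : A.Sec) : Prop := ∀ x z, P.ev x z (t x) = s (x, z)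

/-- `E` is the bundle associated to the caloron transform of the frame bundle `F` of `𝖤`: its fibre
over `(x, z)` is the quotient of `F_x × GL_n(ℂ) × V`, where `GL_n(ℂ)` is the fibre over `(x, z)` of
`F × S¹ × GL_n(ℂ)`, by the relations `(p, z, g) ∼ (p γ, z, γ(z)⁻¹ g)` for `γ ∈ ΩGL_n(ℂ)` and
`([p, z, g k], k⁻¹ v) ∼ ([p, z, g], v)` for `k ∈ GL_n(ℂ)`. -/
def IsAssociated : Prop := ∀ x z,
  (∀ w, ∃ p, A.IsFrame x p ∧ ∃ (g : Matrix.GeneralLinearGroup (Fin n) ℂ) (v : Fin n → ℂ),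
    P.ev x z (p (constLoop (g.1.mulVec v))) = w) ∧
  ∀ p p', A.IsFrame x p → A.IsFrame x p' →
    ∀ (g g' : Matrix.GeneralLinearGroup (Fin n) ℂ) (v v' : Fin n → ℂ),
    P.ev x z (p (constLoop (g.1.mulVec v))) = P.ev x z (p' (constLoop (g'.1.mulVec v'))) ↔
      ∃ γ ∈ OmegaGL n, ∃ k : Matrix.GeneralLinearGroup (Fin n) ℂ, (∀ u, p' u = p (act γ u)) ∧
        g' = (Matrix.GeneralLinearGroup.map (LC.eval z) γ)⁻¹ * g * k ∧ v' = (k⁻¹).1.mulVec v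

/-- `𝖤` is the bundle with fibre `LV` associated to the inverse caloron transform of the frame
bundle of `E`: its fibre over `x` is the quotient of the set of pairs `(q, v)`, where `q` is a loop
of frames over `{x} × S¹` starting at the framing and `v ∈ LV`, by the relations
`(q γ, γ⁻¹ v) ∼ (q, v)` for `γ ∈ ΩGL_n(ℂ)`. The class of `(q, v)` corresponds to the loop
`z ↦ q(z) v(z)`. -/
def IsLoopAssociated : Prop := ∀ x,
  (∀ u, ∃ q, E.IsLoopFrame x q ∧ ∃ v : LV n, ∀ z, P.ev x z u = q z fun i => v i z) ∧
  (∀ q, E.IsLoopFrame x q → ∀ v : LV n, ∃ u, ∀ z, P.ev x z u = q z fun i => v i z) ∧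
  ∀ q q', E.IsLoopFrame x q → E.IsLoopFrame x q' → ∀ v v' : LV n,
    (∀ z, q z (fun i => v i z) = q' z fun i => v' i z) ↔
      ∃ γ ∈ OmegaGL n, (∀ z w, q' z w =
          q z ((Matrix.GeneralLinearGroup.map (n := Fin n) (LC.eval z) γ).1.mulVec w)) ∧
        v' = act γ⁻¹ v

end CaloronPairing

end

section
universe u v w w' y y'

/-- The caloron correspondence for categories of `Ω` vector bundles and of framed vector bundles,
possibly with additional structure forgotten by the functors `U` and `U'`. -/
structure CaloronCorrespondence {d n : ℕ} {M : Type v} [TopologicalSpace M]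
    [ChartedSpace (Eu d) M] {C : Type w} [Category.{w'} C] {D : Type y} [Category.{y'} D]
    (U : C ⥤ OVect.{u} d n M) (U' : D ⥤ FrVect.{u} d n M) where
  /-- the functors `𝒱` (`equiv.functor`) and `𝒱⁻¹` (`equiv.inverse`), with the natural isomorphisms
  `𝖤 ≅ 𝒱⁻¹(𝒱(𝖤))` and `𝒱(𝒱⁻¹(E)) ≅ E` -/
  equiv : C ≌ D
  /-- the caloron transform `𝒱` of bundles -/
  pairV : ∀ A : C, CaloronPairing (U.obj A) (U'.obj (equiv.functor.obj A))
  assocV : ∀ A : C, (pairV A).IsAssociated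
  /-- the inverse caloron transform `𝒱⁻¹` of bundles -/
  pairW : ∀ B : D, CaloronPairing (U.obj (equiv.inverse.obj B)) (U'.obj B)
  assocW : ∀ B : D, (pairW B).IsLoopAssociated
  mapV : ∀ (A A' : C) (f : A ⟶ A') x z v,
    FrVect.fibMap (U'.map (equiv.functor.map f)) (x, z) ((pairV A).ev x z v)
      = (pairV A').ev x z (OVect.fibMap (U.map f) x v)
  mapW : ∀ (B B' : D) (f : B ⟶ B') x z v,
    FrVect.fibMap (U'.map f) (x, z) ((pairW B).ev x z v)
      = (pairW B').ev x z (OVect.fibMap (U.map (equiv.inverse.map f)) x v)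
  /-- `𝖤 ≅ 𝒱⁻¹(𝒱(𝖤))` is given by regarding both sides as spaces of sections of `𝒱(𝖤)` -/
  unit_ev : ∀ (A : C) x z v,
    (pairW (equiv.functor.obj A)).ev x z (OVect.fibMap (U.map (equiv.unit.app A)) x v)
      = (pairV A).ev x z v
  /-- `𝒱(𝒱⁻¹(E)) ≅ E` is induced by evaluation of loops -/
  counit_ev : ∀ (B : D) x z v,
    FrVect.fibMap (U'.map (equiv.counit.app B)) (x, z) ((pairV (equiv.inverse.obj B)).ev x z v)
      = (pairW B).ev x z v

/-- The geometric caloron correspondence: a caloron correspondence for categories of `Ω` vector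
bundles with a based module connection and a Higgs field, and of framed vector bundles with a framed
connection (possibly with additional structure), in which connections and Higgs fields are
transformed by the formulas below. -/
structure GeometricCaloronCorrespondence {d n : ℕ} {M : Type v} [TopologicalSpace M]
    [ChartedSpace (Eu d) M] [IsManifold (𝓡 d) ∞ M] {C : Type w} [Category.{w'} C] {D : Type y}
    [Category.{y'} D] (U : C ⥤ OVectC.{u} d n M) (U' : D ⥤ FrVectC.{u} d n M) extends
    CaloronCorrespondence (U ⋙ forgetConnO) (U' ⋙ forgetConnFr) where
  /-- the formula `∇ = Δ + dθ ⊗ φ` for the connection of `𝒱(𝖤)` -/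
  connV : ∀ (A : C) s t, (pairV A).Corr s t →
    ∀ x z (X : TangentSpace (𝓡 d) x) (ξ : TangentSpace (𝓡 1) z),
    (U'.obj (equiv.functor.obj A)).conn.toFun s (x, z) (pairVec X ξ)
      = (pairV A).ev x z ((U.obj A).conn.toFun t x X)
        + (angForm z ξ : ℂ) • (pairV A).ev x z ((U.obj A).higgs.toFun x (t x))
  /-- the module connection of `𝒱⁻¹(E)` is `∇` along `M` -/
  connW : ∀ (B : D) s t, (pairW B).Corr s t → ∀ x z (X : TangentSpace (𝓡 d) x),
    (pairW B).ev x z ((U.obj (equiv.inverse.obj B)).conn.toFun t x X)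
      = (U'.obj B).conn.toFun s (x, z) (pairVec X (0 : TangentSpace (𝓡 1) z))
  /-- the Higgs field of `𝒱⁻¹(E)` is `∇` along `∂/∂θ` -/
  higgsW : ∀ (B : D) s t, (pairW B).Corr s t → ∀ x z,
    (pairW B).ev x z ((U.obj (equiv.inverse.obj B)).higgs.toFun x (t x))
      = (U'.obj B).conn.toFun s (x, z) (pairVec (0 : TangentSpace (𝓡 d) x) (angVec z))

end
end Caloron

open CategoryTheory

universe u v

/-!
An `Ω` vector bundle `𝖤` over `M` and a framed bundle `E` over `M × S¹` carry the same information
because of the exponential law: a function on `M` with values in the smooth loops is smooth if and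
only if the corresponding function on `M × S¹` is smooth (`fsmoothM_iff`, from
`fsmoothOn_iff_jointlySmooth`). One direction holds as evaluation of loops is smooth and Gateaux
`C^k` maps of finite-dimensional spaces are `C^k`. In the other direction the Gateaux derivatives
are the pointwise ones, the convergence of the difference quotients in each seminorm following from
the mean value inequality and from the fact that `∂` commutes with directional derivatives.

Most of the argument takes place relative to an arbitrary evaluation pairing `P : CaloronPairing 𝖤 E`
and does not refer to a construction of one bundle from the other. Evaluation separates vectors of
`𝖤` (`ev_ext`), is surjective on the fibres of `E`, and identifies smooth sections
(`toSec`, `ofSec`). Hence a pairing makes `𝖤` and `E` associated bundles of the frame bundles of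
each other (`isAssociated`, `isLoopAssociated`), morphisms of `Ω` vector bundles and of framed bundles
determine each other (`homFr`, `homO`), and so do the geometric structures: from `Δ` and `φ` one
obtains `∇ = Δ + dθ ⊗ φ` (`frConn`), and from `∇` its parts along `M` and along the circle (`modConn`,
`higgs`), and similarly for Hermitian structures (`hermFr`, `hermO`). The Leibniz rules match since
the differential on `M × S¹` is the sum of the differential along `M` and of `dθ ⊗ ∂`
(`dFun_prod`). That the derivative along the circle only depends on the value of the section of `𝖤`
at a point, and that `∇` is framed if and only if `Δ` is based, follows by expanding sections in a
local based frame (`covDeriv_expand`); such expansions are legitimate as covariant derivatives are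
local (`IsCovDeriv.congr`).

The pairings needed are constructed in `OVect.caloronPairing` and `FrVect.invCaloronPairing`. The
fibre of `𝒱(𝖤)` at `(x, z)` is the quotient of `𝖤_x` by the vectors that vanish at `z`, and the fibre
of `𝒱⁻¹(E)` at `x` is the space of smooth sections along `{x} × S¹`. The local triviality of the
latter requires a smooth family of frames along the circles near a given one, extending the framing
(`FrVect.exists_loopFrames`). It comes from general position: in the space of complex matrices the
singular ones have real codimension two, so a generic combination of local frames, cut off by bump
functions on the circle, is nowhere singular along a circle (`exists_nonsingular`).

The functors, the unit and the counit are those induced by identities and by the pairings; all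
identities between morphisms, and the compatibility of the unit and the counit with connections and
Hermitian structures, are checked after evaluation.
-/

/-! ### Calculus of Gateaux smooth maps -/

namespace Caloron

section GateauxCalculus
universe w

lemma GatC.add {Z : Type w} [AddCommGroup Z] [Module ℝ Z] [TopologicalSpace Z]
    [IsTopologicalAddGroup Z] [ContinuousSMul ℝ Z] [T2Space Z] [LocallyConvexSpace ℝ Z]
    {X : Type u} [AddCommGroup X] [Module ℝ X] [TopologicalSpace X] [IsTopologicalAddGroup X]
    [ContinuousSMul ℝ X] [T2Space X] [LocallyConvexSpace ℝ X] {k : ℕ} {f g : X → Z} {U : Set X}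
    (hU : IsOpen U) (hf : GatC k f U) (hg : GatC k g U) : GatC k (fun x => f x + g x) U :=
  GatC.comp hU isOpen_univ
    (GatC.clm (ContinuousLinearMap.fst ℝ Z Z + ContinuousLinearMap.snd ℝ Z Z) univ)
    (hf.prodMk hU hg) fun _ _ => mem_univ _

lemma GatC.clm_comp {Z : Type w} [AddCommGroup Z] [Module ℝ Z] [TopologicalSpace Z]
    [IsTopologicalAddGroup Z] [ContinuousSMul ℝ Z] [T2Space Z] [LocallyConvexSpace ℝ Z]
    {Y : Type v} [AddCommGroup Y] [Module ℝ Y] [TopologicalSpace Y] [IsTopologicalAddGroup Y]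
    [ContinuousSMul ℝ Y] [T2Space Y] [LocallyConvexSpace ℝ Y]
    {X : Type u} [AddCommGroup X] [Module ℝ X] [TopologicalSpace X] [IsTopologicalAddGroup X]
    [ContinuousSMul ℝ X] [T2Space X] [LocallyConvexSpace ℝ X] {k : ℕ} {f : X → Y} {U : Set X}
    (hU : IsOpen U) (L : Y →L[ℝ] Z) (hf : GatC k f U) : GatC k (fun x => L (f x)) U :=
  GatC.comp hU isOpen_univ (GatC.clm L univ) hf fun _ _ => mem_univ _

lemma GatC.const {Z : Type w} [AddCommGroup Z] [Module ℝ Z] [TopologicalSpace Z] [T2Space Z]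
    {k : ℕ} : ∀ {X : Type u} [AddCommGroup X] [Module ℝ X] [TopologicalSpace X] (c : Z) (U : Set X),
    GatC k (fun _ : X => c) U := by
  induction k with
  | zero => intro X _ _ _ c U; exact continuousOn_const
  | succ k ih =>
    intro X _ _ _ c U
    have key : ∀ x h : X, Tendsto (gateauxQuot (fun _ : X => c) x h) (𝓝[≠] (0 : ℝ)) (𝓝 0) := by
      intro x h
      have e : gateauxQuot (fun _ : X => c) x h = fun _ => 0 := by
        funext t; simp [gateauxQuot]
      rw [e]
      exact tendsto_const_nhds
    refine ⟨continuousOn_const, fun x _ h => ?_, ?_⟩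
    · rw [gateauxDeriv_eq (key x h)]; exact key x h
    · have e : (fun p : X × X => gateauxDeriv (fun _ : X => c) p.1 p.2) = fun _ => (0 : Z) := by
        funext p; exact gateauxDeriv_eq (key p.1 p.2)
      rw [e]; exact ih _ _

lemma GatC.pi {ι : Type} {Z : Type w} [AddCommGroup Z] [Module ℝ Z]
    [TopologicalSpace Z] [T2Space Z] {k : ℕ} :
    ∀ {X : Type u} [AddCommGroup X] [Module ℝ X] [TopologicalSpace X] [IsTopologicalAddGroup X]
    [ContinuousSMul ℝ X] {f : X → ι → Z} {U : Set X}, IsOpen U →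
    (∀ i, GatC k (fun x => f x i) U) → GatC k f U := by
  induction k with
  | zero => intro X _ _ _ _ _ f U _ h; exact continuousOn_pi.2 h
  | succ k ih =>
    intro X _ _ _ _ _ f U hU h
    have key : ∀ x ∈ U, ∀ v, Tendsto (gateauxQuot f x v) (𝓝[≠] (0 : ℝ))
        (𝓝 fun i => gateauxDeriv (fun x => f x i) x v) := fun x hx v =>
      tendsto_pi_nhds.2 fun i => (h i).2.1 x hx v
    refine ⟨continuousOn_pi.2 fun i => (h i).1, fun x hx v => ?_, ?_⟩
    · rw [gateauxDeriv_eq (key x hx v)]; exact key x hx v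
    · refine (ih (hU.prod isOpen_univ) fun i => (h i).2.2).congr (hU.prod isOpen_univ) ?_
      intro p hp
      exact (gateauxDeriv_eq (key p.1 hp.1 p.2)).symm

/-- Continuous bilinear maps are smooth. The two arguments are allowed to be continuous linear
functions of one variable, which is the form that survives differentiation. -/
lemma GatC.bilin {X : Type u} {Y : Type v} {Z : Type w}
    [AddCommGroup X] [Module ℝ X] [TopologicalSpace X]
    [AddCommGroup Y] [Module ℝ Y] [TopologicalSpace Y]
    [AddCommGroup Z] [Module ℝ Z] [TopologicalSpace Z]
    [IsTopologicalAddGroup Z] [ContinuousSMul ℝ Z] [T2Space Z] [LocallyConvexSpace ℝ Z]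
    (b : X →ₗ[ℝ] Y →ₗ[ℝ] Z) (hb : Continuous fun p : X × Y => b p.1 p.2) {k : ℕ} :
    ∀ {W : Type u} [AddCommGroup W] [Module ℝ W] [TopologicalSpace W] [IsTopologicalAddGroup W]
    [ContinuousSMul ℝ W] [T2Space W] [LocallyConvexSpace ℝ W] (L : W →L[ℝ] X) (L' : W →L[ℝ] Y),
    GatC k (fun w => b (L w) (L' w)) univ := by
  induction k with
  | zero =>
    intro W _ _ _ _ _ _ _ L L'
    exact (hb.comp (L.continuous.prodMk L'.continuous)).continuousOn
  | succ k ih =>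
    intro W _ _ _ _ _ _ _ L L'
    have key : ∀ x h : W, Tendsto (gateauxQuot (fun w => b (L w) (L' w)) x h) (𝓝[≠] (0 : ℝ))
        (𝓝 (b (L h) (L' x) + b (L x) (L' h))) := by
      intro x h
      have h1 : Tendsto (fun t : ℝ => b (L h) (L' x) + b (L x) (L' h) + t • b (L h) (L' h))
          (𝓝[≠] (0 : ℝ)) (𝓝 (b (L h) (L' x) + b (L x) (L' h) + (0 : ℝ) • b (L h) (L' h))) :=
        (Continuous.tendsto (by fun_prop) 0).mono_left nhdsWithin_le_nhds
      rw [zero_smul, add_zero] at h1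
      refine h1.congr' ?_
      filter_upwards [self_mem_nhdsWithin] with t ht
      have ht : t ≠ 0 := ht
      simp only [gateauxQuot, map_add, map_smul, LinearMap.add_apply, LinearMap.smul_apply]
      rw [eq_inv_smul_iff₀ ht]
      simp only [smul_add]
      abel
    refine ⟨(hb.comp (L.continuous.prodMk L'.continuous)).continuousOn, fun x _ h => ?_, ?_⟩
    · rw [gateauxDeriv_eq (key x h)]; exact key x h
    · have e : (fun p : W × W => gateauxDeriv (fun w => b (L w) (L' w)) p.1 p.2)
          = fun p : W × W => b ((L.comp (ContinuousLinearMap.snd ℝ W W)) p)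
              ((L'.comp (ContinuousLinearMap.fst ℝ W W)) p)
            + b ((L.comp (ContinuousLinearMap.fst ℝ W W)) p)
              ((L'.comp (ContinuousLinearMap.snd ℝ W W)) p) := by
        funext p; exact gateauxDeriv_eq (key p.1 p.2)
      rw [e, univ_prod_univ]
      exact (ih _ _).add isOpen_univ (ih _ _)

/-- A continuous bilinear operation applied to two maps of class `C^k`. -/
lemma GatC.bilin_comp {X : Type u} {Y : Type u} {Z : Type w}
    [AddCommGroup X] [Module ℝ X] [TopologicalSpace X] [IsTopologicalAddGroup X]
    [ContinuousSMul ℝ X] [T2Space X] [LocallyConvexSpace ℝ X]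
    [AddCommGroup Y] [Module ℝ Y] [TopologicalSpace Y] [IsTopologicalAddGroup Y]
    [ContinuousSMul ℝ Y] [T2Space Y] [LocallyConvexSpace ℝ Y]
    [AddCommGroup Z] [Module ℝ Z] [TopologicalSpace Z]
    [IsTopologicalAddGroup Z] [ContinuousSMul ℝ Z] [T2Space Z] [LocallyConvexSpace ℝ Z]
    (b : X →ₗ[ℝ] Y →ₗ[ℝ] Z) (hb : Continuous fun p : X × Y => b p.1 p.2) {k : ℕ}
    {W : Type v} [AddCommGroup W] [Module ℝ W] [TopologicalSpace W] [IsTopologicalAddGroup W]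
    [ContinuousSMul ℝ W] [T2Space W] [LocallyConvexSpace ℝ W] {f : W → X} {g : W → Y} {U : Set W}
    (hU : IsOpen U) (hf : GatC k f U) (hg : GatC k g U) : GatC k (fun w => b (f w) (g w)) U :=
  GatC.comp hU isOpen_univ
    (GatC.bilin b hb (ContinuousLinearMap.fst ℝ X Y) (ContinuousLinearMap.snd ℝ X Y))
    (hf.prodMk hU hg) fun _ _ => mem_univ _

end GateauxCalculus

/-! ### The Fréchet algebra of smooth loops -/

namespace LC

lemma continuous_derivCont (k : ℕ) : Continuous (derivCont k) :=
  continuous_iff_le_induced.2 (iInf_le (fun k => TopologicalSpace.induced (derivCont k) _) k)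

lemma continuous_iff {X : Type*} [TopologicalSpace X] {f : X → LC} :
    Continuous f ↔ ∀ k, Continuous fun x => derivCont k (f x) := by
  simp only [continuous_iInf_rng, continuous_induced_rng]; rfl

lemma tendsto_iff {X : Type*} {f : X → LC} {l : Filter X} {a : LC} :
    Tendsto f l (𝓝 a) ↔ ∀ k, Tendsto (fun x => derivCont k (f x)) l (𝓝 (derivCont k a)) := by
  simp only [nhds_iInf, nhds_induced, tendsto_iInf, tendsto_comap_iff]; rfl

lemma continuousOn_iff {X : Type*} [TopologicalSpace X] {f : X → LC} {s : Set X} :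
    ContinuousOn f s ↔ ∀ k, ContinuousOn (fun x => derivCont k (f x)) s := by
  simp only [ContinuousOn, ContinuousWithinAt, tendsto_iff]
  exact ⟨fun h k x hx => h x hx k, fun h x hx k => h k x hx⟩

lemma derivCont_succ (k : ℕ) (f : LC) : derivCont (k + 1) f = derivCont k (del f) := by
  ext z
  change ((del ^ (k + 1)) f) z = ((del ^ k) (del f)) z
  rw [pow_succ]; rfl

lemma continuous_del : Continuous del :=
  continuous_iff.2 fun k => by
    simp only [← derivCont_succ]
    exact continuous_derivCont (k + 1)

/-- The derivation `∂` as a continuous linear map. -/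
noncomputable def delL : LC →L[ℝ] LC := ⟨del, continuous_del⟩

/-- Evaluation of loops is jointly continuous. -/
lemma continuous_eval₂ : Continuous fun p : LC × Circle => p.1 p.2 := by
  have h : Continuous fun p : LC × Circle => (derivCont 0 p.1) p.2 :=
    ContinuousEval.continuous_eval.comp
      (((continuous_derivCont 0).comp continuous_fst).prodMk continuous_snd)
  exact h

lemma hasDerivAt_exp (f : LC) (a : ℝ) :
    HasDerivAt (fun t : ℝ => f (Circle.exp t)) (del f (Circle.exp a)) a := by
  have h := ((contDiff_lift f (Circle.exp a)).differentiable (by simp) 0).hasDerivAt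
  have h2 : HasDerivAt (fun t : ℝ => t - a) 1 a := (hasDerivAt_id a).sub_const a
  have h3 := HasDerivAt.scomp_of_eq a h h2 (sub_self a).symm
  rw [one_smul] at h3
  refine h3.congr_of_eventuallyEq (Eventually.of_forall fun t => ?_)
  simp only [Function.comp, ← Circle.exp_add]
  rw [add_sub_cancel]

lemma del_mul (f g : LC) : del (f * g) = del f * g + f * del g := by
  ext z
  obtain ⟨a, rfl⟩ : ∃ a, Circle.exp a = z := ⟨_, Circle.exp_arg z⟩
  exact (hasDerivAt_exp (f * g) a).unique ((hasDerivAt_exp f a).mul (hasDerivAt_exp g a))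

instance : ContinuousMul LC where
  continuous_mul := by
    refine continuous_iff.2 fun k => ?_
    -- Induction on the number of derivatives; the arguments are generalised to continuous maps, as
    -- the product rule produces derivatives of the factors.
    have main : ∀ k, ∀ f g : LC × LC → LC, Continuous f → Continuous g →
        Continuous fun p => derivCont k (f p * g p) := by
      intro k
      induction k with
      | zero =>
        intro f g hf hg
        have e : ∀ p, derivCont 0 (f p * g p) = derivCont 0 (f p) * derivCont 0 (g p) := by
          intro p; ext z; rfl
        simp only [e]
        exact ((continuous_derivCont 0).comp hf).mul ((continuous_derivCont 0).comp hg)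
      | succ k ih =>
        intro f g hf hg
        simp only [derivCont_succ, del_mul, map_add]
        exact (ih _ _ (continuous_del.comp hf) hg).add (ih _ _ hf (continuous_del.comp hg))
    exact main k _ _ continuous_fst continuous_snd

/-- Multiplication of loops as an `ℝ`-bilinear map. -/
noncomputable def mulL : LC →ₗ[ℝ] LC →ₗ[ℝ] LC := LinearMap.mul ℝ LC

end LC

section
variable {X : Type u} [AddCommGroup X] [Module ℝ X] [TopologicalSpace X] [IsTopologicalAddGroup X]
  [ContinuousSMul ℝ X] [T2Space X] [LocallyConvexSpace ℝ X]

lemma GatC.mulLC {k : ℕ} {f g : X → LC} {U : Set X} (hU : IsOpen U) (hf : GatC k f U)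
    (hg : GatC k g U) : GatC k (fun x => f x * g x) U :=
  GatC.bilin_comp LC.mulL continuous_mul hU hf hg

lemma GatC.sumLC {ι : Type} {k : ℕ} (s : Finset ι) {f : ι → X → LC} {U : Set X} (hU : IsOpen U)
    (hf : ∀ i, GatC k (f i) U) : GatC k (fun x => ∑ i ∈ s, f i x) U := by
  classical
  induction s using Finset.induction_on with
  | empty => simpa using GatC.const 0 U
  | insert a s ha ih =>
    simp only [Finset.sum_insert ha]
    exact (hf a).add hU ih

end

/-- The evaluation `(f, t) ↦ f(e^{it})` is smooth on `LC × ℝ`. Its derivative is again composed of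
evaluations, at linear functions of the enlarged set of variables; for this reason the arguments are
allowed to be continuous linear functions of one variable. -/
lemma LC.gatC_eval {k : ℕ} : ∀ {W : Type u} [AddCommGroup W] [Module ℝ W] [TopologicalSpace W]
    [IsTopologicalAddGroup W] [ContinuousSMul ℝ W] [T2Space W] [LocallyConvexSpace ℝ W]
    (L : W →L[ℝ] LC) (L' : W →L[ℝ] ℝ), GatC k (fun w => (L w) (Circle.exp (L' w))) univ := by
  induction k with
  | zero =>
    intro W _ _ _ _ _ _ _ L L'
    exact (LC.continuous_eval₂.comp
      (L.continuous.prodMk (Circle.exp.continuous.comp L'.continuous))).continuousOn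
  | succ k ih =>
    intro W _ _ _ _ _ _ _ L L'
    have key : ∀ x h : W, Tendsto (gateauxQuot (fun w => (L w) (Circle.exp (L' w))) x h)
        (𝓝[≠] (0 : ℝ)) (𝓝 ((L' h) • (LC.del (L x)) (Circle.exp (L' x))
          + (L h) (Circle.exp (L' x)))) := by
      intro x h
      have h1 : HasDerivAt (fun t : ℝ => (L x) (Circle.exp (L' x + t * L' h)))
          (L' h • (LC.del (L x)) (Circle.exp (L' x))) 0 := by
        have h2 : HasDerivAt (fun t : ℝ => L' x + t * L' h) (L' h) 0 := by
          simpa using ((hasDerivAt_id (0 : ℝ)).mul_const (L' h)).const_add (L' x)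
        have h3 := LC.hasDerivAt_exp (L x) (L' x + 0 * L' h)
        have h4 := h3.scomp (0 : ℝ) h2
        rw [zero_mul, add_zero] at h4
        exact h4
      have h5 := hasDerivAt_iff_tendsto_slope_zero.1 h1
      have h6 : Tendsto (fun t : ℝ => (L h) (Circle.exp (L' x + t * L' h))) (𝓝[≠] 0)
          (𝓝 ((L h) (Circle.exp (L' x)))) := by
        have hc : Continuous fun t : ℝ => (L h) (Circle.exp (L' x + t * L' h)) :=
          (L h).smooth.continuous.comp (Circle.exp.continuous.comp (by fun_prop))
        have := hc.tendsto 0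
        rw [zero_mul, add_zero] at this
        exact this.mono_left nhdsWithin_le_nhds
      refine (h5.add h6).congr' ?_
      filter_upwards [self_mem_nhdsWithin] with t ht
      have ht : (t : ℂ) ≠ 0 := by exact_mod_cast ht
      simp only [gateauxQuot, map_add, map_smul, zero_add, zero_mul, add_zero, smul_eq_mul,
        LC.add_apply, LC.real_smul_apply, Complex.real_smul, Complex.ofReal_inv]
      field_simp
      ring
    refine ⟨(LC.continuous_eval₂.comp
      (L.continuous.prodMk (Circle.exp.continuous.comp L'.continuous))).continuousOn,
      fun x _ h => ?_, ?_⟩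
    · rw [gateauxDeriv_eq (key x h)]; exact key x h
    · have e : (fun p : W × W => gateauxDeriv (fun w => (L w) (Circle.exp (L' w))) p.1 p.2)
          = fun p : W × W => (LinearMap.lsmul ℝ ℂ)
              ((L'.comp (ContinuousLinearMap.snd ℝ W W)) p)
              (((LC.delL.comp L).comp (ContinuousLinearMap.fst ℝ W W)) p
                (Circle.exp ((L'.comp (ContinuousLinearMap.fst ℝ W W)) p)))
            + ((L.comp (ContinuousLinearMap.snd ℝ W W)) p)
              (Circle.exp ((L'.comp (ContinuousLinearMap.fst ℝ W W)) p)) := by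
        funext p; exact gateauxDeriv_eq (key p.1 p.2)
      rw [e, univ_prod_univ]
      refine GatC.add isOpen_univ (GatC.bilin_comp (LinearMap.lsmul ℝ ℂ) ?_ isOpen_univ
        (GatC.clm _ _) (ih _ _)) (ih _ _)
      exact continuous_smul

end Caloron

/-! ### Gateaux smoothness in finite dimensions -/

namespace Caloron

section FiniteDimensional
variable {X : Type u} [NormedAddCommGroup X] [NormedSpace ℝ X]
  {Y : Type v} [NormedAddCommGroup Y] [NormedSpace ℝ Y]

/-- The Gateaux derivative of a `C^1` map is additive in the direction: the difference quotient in the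
direction `h + k` is the sum of those in the direction `h` at `x` and in the direction `k` at the
moving point `x + t h`, and the latter converges by the mean value theorem. -/
lemma gateauxDeriv_add_vec {f : X → Y} {Ω : Set X} (hΩ : IsOpen Ω) (hf : GatC 1 f Ω) {x : X}
    (hx : x ∈ Ω) (h k : X) :
    gateauxDeriv f x (h + k) = gateauxDeriv f x h + gateauxDeriv f x k := by
  have claim : Tendsto (fun t : ℝ => gateauxQuot f (x + t • h) k t) (𝓝[≠] 0)
      (𝓝 (gateauxDeriv f x k)) := by
    rw [Metric.nhds_basis_ball.tendsto_right_iff]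
    intro ε hε
    have hopen := hf.2.2.continuousOn.isOpen_inter_preimage (hΩ.prod isOpen_univ)
      (Metric.isOpen_ball (x := gateauxDeriv f x k) (ε := ε))
    have hcont : Continuous fun q : ℝ × ℝ => (x + q.1 • h + q.2 • k, k) := by fun_prop
    have hgood : ∀ᶠ q : ℝ × ℝ in 𝓝 (0, 0), x + q.1 • h + q.2 • k ∈ Ω ∧
        gateauxDeriv f (x + q.1 • h + q.2 • k) k ∈ Metric.ball (gateauxDeriv f x k) ε := by
      have h1 := hcont.tendsto (0, 0)
      simp only [zero_smul, add_zero] at h1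
      filter_upwards [h1 (hopen.mem_nhds ⟨⟨hx, mem_univ _⟩, Metric.mem_ball_self hε⟩)] with q hq
      exact ⟨hq.1.1, hq.2⟩
    obtain ⟨δ, hδ, hball⟩ := Metric.eventually_nhds_iff.1 hgood
    have e1 : ∀ᶠ t : ℝ in 𝓝[≠] 0, |t| < δ := by
      refine Filter.Eventually.filter_mono nhdsWithin_le_nhds ?_
      filter_upwards [Metric.ball_mem_nhds (0 : ℝ) hδ] with t ht
      simpa using ht
    filter_upwards [e1, self_mem_nhdsWithin] with t ht ht0
    have hs : ∀ s ∈ uIcc 0 t, dist ((t, s) : ℝ × ℝ) (0, 0) < δ := by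
      intro s hs
      have h2 := abs_sub_left_of_mem_uIcc hs
      simp only [sub_zero] at h2
      simp only [Prod.dist_eq, Real.dist_eq, sub_zero]
      exact max_lt ht (h2.trans_lt ht)
    exact gateaux_mean_value (g := f) (D := fun w => gateauxDeriv f w k) (y := x + t • h) ht0
      Metric.isOpen_ball (convex_ball _ _) (fun s h' => hf.2.1 _ (hball (hs s h')).1 k)
      (fun s h' => (hball (hs s h')).2)
  refine tendsto_nhds_unique (hf.2.1 x hx (h + k)) (((hf.2.1 x hx h).add claim).congr fun t => ?_)
  simp only [gateauxQuot, ← smul_add, add_assoc]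
  congr 1
  abel

lemma gateauxDeriv_smul_vec {f : X → Y} {Ω : Set X} (hf : GatC 1 f Ω) {x : X}
    (hx : x ∈ Ω) (c : ℝ) (h : X) : gateauxDeriv f x (c • h) = c • gateauxDeriv f x h := by
  rcases eq_or_ne c 0 with rfl | hc
  · rw [zero_smul, zero_smul]
    refine gateauxDeriv_eq (tendsto_const_nhds.congr fun t => ?_)
    simp [gateauxQuot]
  · have h1 : Tendsto (fun t : ℝ => c * t) (𝓝[≠] 0) (𝓝[≠] 0) := by
      refine tendsto_nhdsWithin_iff.2 ⟨?_, ?_⟩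
      · have : Tendsto (fun t : ℝ => c * t) (𝓝 0) (𝓝 (c * 0)) := Continuous.tendsto (by fun_prop) 0
        rw [mul_zero] at this
        exact this.mono_left nhdsWithin_le_nhds
      · filter_upwards [self_mem_nhdsWithin] with t ht
        exact mul_ne_zero hc ht
    refine gateauxDeriv_eq ((((hf.2.1 x hx h).comp h1).const_smul c).congr fun t => ?_)
    simp only [gateauxQuot, Function.comp, smul_smul, mul_inv, mul_comm t c]
    rw [← mul_assoc, mul_inv_cancel₀ hc, one_mul]

/-- In finite dimensions, a Gateaux `C^1` map is Fréchet differentiable: the Gateaux derivative is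
linear and depends continuously on the point in operator norm. -/
lemma GatC.hasFDerivAt [FiniteDimensional ℝ X] {f : X → Y} {Ω : Set X} (hΩ : IsOpen Ω)
    (hf : GatC 1 f Ω) {x : X} (hx : x ∈ Ω) :
    ∃ L : X →L[ℝ] Y, HasFDerivAt f L x ∧ ∀ h, L h = gateauxDeriv f x h := by
  classical
  let L : X → X →L[ℝ] Y := fun y => if hy : y ∈ Ω then LinearMap.toContinuousLinearMap
    { toFun := gateauxDeriv f y
      map_add' := gateauxDeriv_add_vec hΩ hf hy
      map_smul' := gateauxDeriv_smul_vec hf hy } else 0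
  have hL : ∀ y ∈ Ω, ∀ h, L y h = gateauxDeriv f y h := by
    intro y hy h; simp only [L, hy, dif_pos]; rfl
  have hLc : ContinuousOn L Ω := by
    refine continuousOn_clm_apply.2 fun h => ?_
    have h1 : ContinuousOn (fun y => gateauxDeriv f y h) Ω :=
      hf.2.2.continuousOn.comp (f := fun y => (y, h)) (by fun_prop) fun y hy => ⟨hy, mem_univ _⟩
    exact h1.congr fun y hy => hL y hy h
  refine ⟨L x, ?_, hL x hx⟩
  rw [hasFDerivAt_iff_isLittleO_nhds_zero, Asymptotics.isLittleO_iff]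
  intro ε hε
  have h1 : ∀ᶠ y in 𝓝 x, y ∈ Ω ∧ dist (L y) (L x) < ε :=
    (hΩ.eventually_mem hx).and (Metric.tendsto_nhds.1 (hLc.continuousAt (hΩ.mem_nhds hx)) ε hε)
  obtain ⟨δ, hδ, hball⟩ := Metric.eventually_nhds_iff.1 h1
  filter_upwards [Metric.ball_mem_nhds (0 : X) hδ] with h hh
  have hmem : ∀ s ∈ Icc (0 : ℝ) 1, dist (x + s • h) x < δ := by
    intro s hs
    rw [dist_eq_norm, add_sub_cancel_left, norm_smul, Real.norm_of_nonneg hs.1]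
    have : ‖h‖ < δ := by simpa using hh
    nlinarith [norm_nonneg h, hs.2]
  have hder : ∀ s ∈ Icc (0 : ℝ) 1, HasDerivAt (fun s : ℝ => f (x + s • h) - s • L x h)
      (L (x + s • h) h - L x h) s := by
    intro s hs
    refine HasDerivAt.sub ?_ (by simpa using (hasDerivAt_id s).smul_const (L x h))
    rw [hasDerivAt_iff_tendsto_slope_zero, hL _ (hball (hmem s hs)).1]
    refine (hf.2.1 _ (hball (hmem s hs)).1 h).congr fun t => ?_
    simp only [gateauxQuot, add_smul, add_assoc]
  have := Convex.norm_image_sub_le_of_norm_hasDerivWithin_le (C := ε * ‖h‖)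
    (fun s hs => (hder s hs).hasDerivWithinAt) (fun s hs => ?_) (convex_Icc (0 : ℝ) 1)
    (left_mem_Icc.2 zero_le_one) (right_mem_Icc.2 zero_le_one)
  · simp only [one_smul, zero_smul, add_zero, sub_zero, norm_one, mul_one] at this
    rwa [sub_right_comm] at this
  · rw [← sub_apply]
    refine (ContinuousLinearMap.le_opNorm _ _).trans ?_
    gcongr
    rw [← dist_eq_norm]
    exact (hball (hmem s hs)).2.le

/-- On finite-dimensional spaces, Gateaux `C^k` maps are `C^k` in the usual sense. -/
theorem GatC.contDiffOn {k : ℕ} : ∀ {X : Type u} [NormedAddCommGroup X] [NormedSpace ℝ X]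
    [FiniteDimensional ℝ X] {f : X → Y} {Ω : Set X}, IsOpen Ω → GatC k f Ω →
    ContDiffOn ℝ k f Ω := by
  induction k with
  | zero =>
    intro X _ _ _ f Ω _ hf
    exact contDiffOn_zero.2 hf
  | succ k ih =>
    intro X _ _ _ f Ω hΩ hf
    have hf1 : GatC 1 f Ω := ⟨hf.1, hf.2.1, hf.2.2.continuousOn⟩
    rw [Nat.cast_succ, contDiffOn_succ_iff_fderiv_of_isOpen hΩ]
    refine ⟨fun x hx => ?_, fun h => absurd h (by simp), contDiffOn_clm_apply.2 fun h => ?_⟩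
    · obtain ⟨L, hL, -⟩ := hf1.hasFDerivAt hΩ hx
      exact hL.differentiableAt.differentiableWithinAt
    · have h1 := (ih (hΩ.prod isOpen_univ) hf.2.2).comp (f := fun y : X => (y, h)) (s := Ω)
        (contDiff_id.prodMk contDiff_const).contDiffOn fun y hy => ⟨hy, mem_univ _⟩
      refine h1.congr fun x hx => ?_
      obtain ⟨L, hL, hL'⟩ := hf1.hasFDerivAt hΩ hx
      rw [hL.fderiv, hL']; rfl

theorem FSmoothOn.contDiffOn [FiniteDimensional ℝ X] {f : X → Y} {Ω : Set X} (hΩ : IsOpen Ω)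
    (hf : FSmoothOn f Ω) : ContDiffOn ℝ ∞ f Ω :=
  contDiffOn_infty.2 fun k => (hf k).contDiffOn hΩ

end FiniteDimensional

end Caloron

/-! ### The exponential law for maps into the space of loops -/

namespace Caloron

lemma contMDiff_coe_circle : ContMDiff (𝓡 1) 𝓘(ℝ, ℂ) ∞ fun z : Circle => (z : ℂ) :=
  haveI : Fact (Module.finrank ℝ ℂ = 1 + 1) := finrank_real_complex_fact'
  contMDiff_coe_sphere (E := ℂ)

/-- Local smooth sections of the covering `t ↦ e^{it}`, given by the principal argument. -/
lemma exists_angle (z₀ : Circle) : ∃ l : Circle → ℝ, ContMDiffAt (𝓡 1) 𝓘(ℝ, ℝ) ∞ l z₀ ∧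
    ∀ z, Circle.exp (l z) = z := by
  refine ⟨fun z => Complex.arg ((z * z₀⁻¹ : Circle) : ℂ) + Complex.arg z₀, ?_, fun z => ?_⟩
  · have h1 : ContMDiff (𝓡 1) (𝓡 1) ∞ fun z : Circle => z * z₀⁻¹ :=
      contMDiff_id.mul contMDiff_const
    have h2 : ContMDiff (𝓡 1) 𝓘(ℝ, ℂ) ∞ fun z : Circle => ((z * z₀⁻¹ : Circle) : ℂ) :=
      contMDiff_coe_circle.comp h1
    have h3 : ContDiffAt ℝ ∞ (fun w : ℂ => Complex.arg w + Complex.arg z₀)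
        ((z₀ * z₀⁻¹ : Circle) : ℂ) := by
      have h4 : ContDiffAt ℝ ∞ Complex.log ((z₀ * z₀⁻¹ : Circle) : ℂ) := by
        refine ContDiffAt.restrict_scalars ℝ (Complex.contDiffAt_log ?_)
        rw [mul_inv_cancel]
        exact Complex.one_mem_slitPlane
      have h5 := (Complex.imCLM.contDiff.contDiffAt.comp _ h4).add
        (contDiffAt_const (c := Complex.arg z₀))
      refine h5.congr_of_eventuallyEq (Eventually.of_forall fun w => ?_)
      simp [Complex.log_im]
    exact h3.contMDiffAt.comp z₀ (h2 z₀)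
  · rw [Circle.exp_add, Circle.exp_arg, Circle.exp_arg, inv_mul_cancel_right]

section ExpCover
universe w w'
variable {E : Type u} [NormedAddCommGroup E] [NormedSpace ℝ E] {H : Type w} [TopologicalSpace H]
  {I : ModelWithCorners ℝ E H} {N : Type v} [TopologicalSpace N] [ChartedSpace H N]
  {Y : Type w'} [NormedAddCommGroup Y] [NormedSpace ℝ Y]

/-- Smoothness in the circle variable can be tested after pulling back along `t ↦ e^{it}`. -/
lemma contMDiffOn_prod_circle {F : N × Circle → Y} {U : Set N} (hU : IsOpen U)
    (h : ContMDiffOn (I.prod 𝓘(ℝ, ℝ)) 𝓘(ℝ, Y) ∞ (fun q : N × ℝ => F (q.1, Circle.exp q.2))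
      (U ×ˢ univ)) : ContMDiffOn (I.prod (𝓡 1)) 𝓘(ℝ, Y) ∞ F (U ×ˢ univ) := by
  rintro ⟨x, z⟩ ⟨hx, -⟩
  obtain ⟨l, hl, hexp⟩ := exists_angle z
  have h1 := h.contMDiffAt (x := (x, l z)) ((hU.prod isOpen_univ).mem_nhds ⟨hx, mem_univ _⟩)
  have h2 : ContMDiffAt (I.prod (𝓡 1)) (I.prod 𝓘(ℝ, ℝ)) ∞ (fun q : N × Circle => (q.1, l q.2))
      (x, z) := contMDiffAt_fst.prodMk (hl.comp (x, z) contMDiffAt_snd)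
  refine ((h1.comp (x, z) h2).congr_of_eventuallyEq (Eventually.of_forall fun q => ?_))
    |>.contMDiffWithinAt
  simp only [Function.comp, hexp]

lemma contMDiffOn_prod_exp {F : N × Circle → Y} {U : Set N}
    (h : ContMDiffOn (I.prod (𝓡 1)) 𝓘(ℝ, Y) ∞ F (U ×ˢ univ)) :
    ContMDiffOn (I.prod 𝓘(ℝ, ℝ)) 𝓘(ℝ, Y) ∞ (fun q : N × ℝ => F (q.1, Circle.exp q.2))
      (U ×ˢ univ) :=
  h.comp (contMDiff_fst.prodMk (contMDiff_circleExp.comp contMDiff_snd)).contMDiffOn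
    fun _ hq => ⟨hq.1, mem_univ _⟩

lemma contMDiff_circle_of_exp {F : Circle → Y} (h : ContDiff ℝ ∞ fun t : ℝ => F (Circle.exp t)) :
    ContMDiff (𝓡 1) 𝓘(ℝ, Y) ∞ F := by
  intro z
  obtain ⟨l, hl, hexp⟩ := exists_angle z
  refine ((h.contMDiff.contMDiffAt (x := l z)).comp z hl).congr_of_eventuallyEq
    (Eventually.of_forall fun q => ?_)
  simp only [Function.comp, hexp]

end ExpCover

section ExponentialLaw
variable {X : Type u} [NormedAddCommGroup X] [NormedSpace ℝ X]

/-- Smoothness of `(p, t) ↦ f(p)(e^{it})`. -/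
def JointlySmooth (f : X → LC) (Ω : Set X) : Prop :=
  ContDiffOn ℝ ∞ (fun q : X × ℝ => f q.1 (Circle.exp q.2)) (Ω ×ˢ univ)

lemma FSmoothOn.jointlySmooth [FiniteDimensional ℝ X] {f : X → LC} {Ω : Set X} (hΩ : IsOpen Ω)
    (hf : FSmoothOn f Ω) : JointlySmooth f Ω := by
  refine FSmoothOn.contDiffOn (hΩ.prod isOpen_univ) fun k => ?_
  have h1 : GatC k (fun q : X × ℝ => f q.1) (Ω ×ˢ univ) :=
    ((hf k).comp_clm (ContinuousLinearMap.fst ℝ X ℝ) hΩ).mono fun q hq => hq.1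
  have h2 : GatC k (fun q : X × ℝ => (f q.1, q.2)) (Ω ×ˢ univ) :=
    h1.prodMk (hΩ.prod isOpen_univ) (GatC.clm (ContinuousLinearMap.snd ℝ X ℝ) _)
  exact GatC.comp (hΩ.prod isOpen_univ) isOpen_univ
    (LC.gatC_eval (ContinuousLinearMap.fst ℝ LC ℝ) (ContinuousLinearMap.snd ℝ LC ℝ)) h2
    fun _ _ => mem_univ _

variable {f : X → LC} {Ω : Set X}

lemma JointlySmooth.contMDiffOn (hΩ : IsOpen Ω) (hf : JointlySmooth f Ω) :
    ContMDiffOn (𝓘(ℝ, X).prod (𝓡 1)) 𝓘(ℝ, ℂ) ∞ (fun q : X × Circle => f q.1 q.2) (Ω ×ˢ univ) := by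
  refine contMDiffOn_prod_circle hΩ ?_
  have h := ContDiffOn.contMDiffOn hf
  rw [modelWithCornersSelf_prod, ← chartedSpaceSelf_prod] at h
  exact h

lemma JointlySmooth.differentiableAt (hΩ : IsOpen Ω) (hf : JointlySmooth f Ω) {p : X} (hp : p ∈ Ω)
    (t : ℝ) : DifferentiableAt ℝ (fun q : X × ℝ => f q.1 (Circle.exp q.2)) (p, t) :=
  (hf.contDiffAt ((hΩ.prod isOpen_univ).mem_nhds ⟨hp, mem_univ _⟩)).differentiableAt (by simp)

lemma JointlySmooth.del_eq (hΩ : IsOpen Ω) (hf : JointlySmooth f Ω) {p : X} (hp : p ∈ Ω) (t : ℝ) :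
    LC.del (f p) (Circle.exp t)
      = fderiv ℝ (fun q : X × ℝ => f q.1 (Circle.exp q.2)) (p, t) (0, 1) := by
  have h1 : HasDerivAt (fun s : ℝ => (p, s)) ((0 : X), (1 : ℝ)) t :=
    (hasDerivAt_const t p).prodMk (hasDerivAt_id t)
  exact (LC.hasDerivAt_exp (f p) t).unique
    ((hf.differentiableAt hΩ hp t).hasFDerivAt.comp_hasDerivAt t h1)

lemma JointlySmooth.contDiffOn_fderiv (hΩ : IsOpen Ω) (hf : JointlySmooth f Ω) :
    ContDiffOn ℝ ∞ (fderiv ℝ fun q : X × ℝ => f q.1 (Circle.exp q.2)) (Ω ×ˢ univ) :=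
  ContDiffOn.fderiv_of_isOpen hf (hΩ.prod isOpen_univ) (by simp)

lemma JointlySmooth.del (hΩ : IsOpen Ω) (hf : JointlySmooth f Ω) :
    JointlySmooth (fun p => LC.del (f p)) Ω :=
  ((hf.contDiffOn_fderiv hΩ).clm_apply contDiffOn_const).congr
    fun q hq => hf.del_eq hΩ hq.1 q.2

/-- The derivative of `f` at `p` in the direction `h`, computed pointwise on the circle. -/
noncomputable def dirFun (f : X → LC) (p h : X) (z : Circle) : ℂ :=
  deriv (fun s : ℝ => f (p + s • h) z) 0

open scoped Classical in
/-- The loop `dirFun f p h`; zero if that function is not smooth. -/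
noncomputable def dirLoop (f : X → LC) (p h : X) : LC :=
  if hs : ContMDiff (𝓡 1) 𝓘(ℝ, ℂ) ∞ (dirFun f p h) then LC.mk _ hs else 0

lemma JointlySmooth.hasDerivAt (hΩ : IsOpen Ω) (hf : JointlySmooth f Ω) {p h : X} {s : ℝ}
    (hp : p + s • h ∈ Ω) (t : ℝ) : HasDerivAt (fun s : ℝ => f (p + s • h) (Circle.exp t))
      (fderiv ℝ (fun q : X × ℝ => f q.1 (Circle.exp q.2)) (p + s • h, t) (h, 0)) s := by
  have h1 : HasDerivAt (fun s : ℝ => (p + s • h, t)) (h, (0 : ℝ)) s := by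
    refine HasDerivAt.prodMk ?_ (hasDerivAt_const s t)
    simpa using ((hasDerivAt_id s).smul_const h).const_add p
  exact (hf.differentiableAt hΩ hp t).hasFDerivAt.comp_hasDerivAt s h1

lemma JointlySmooth.dirFun_eq (hΩ : IsOpen Ω) (hf : JointlySmooth f Ω) {p : X} (hp : p ∈ Ω) (h : X)
    (t : ℝ) : dirFun f p h (Circle.exp t)
      = fderiv ℝ (fun q : X × ℝ => f q.1 (Circle.exp q.2)) (p, t) (h, 0) := by
  have := (hf.hasDerivAt hΩ (p := p) (h := h) (s := 0) (by simpa using hp) t).deriv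
  rwa [zero_smul, add_zero] at this

lemma JointlySmooth.dirLoop_apply (hΩ : IsOpen Ω) (hf : JointlySmooth f Ω) {p : X} (hp : p ∈ Ω)
    (h : X) (z : Circle) : dirLoop f p h z = dirFun f p h z := by
  have hs : ContMDiff (𝓡 1) 𝓘(ℝ, ℂ) ∞ (dirFun f p h) := by
    refine contMDiff_circle_of_exp ?_
    simp only [hf.dirFun_eq hΩ hp]
    refine ContDiff.clm_apply (contDiffOn_univ.1 ?_) contDiff_const
    exact (hf.contDiffOn_fderiv hΩ).comp (f := fun t : ℝ => (p, t))
      (contDiff_const.prodMk contDiff_id).contDiffOn fun t _ => ⟨hp, mem_univ _⟩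
  rw [dirLoop, dif_pos hs]; rfl

lemma JointlySmooth.dirLoop_exp (hΩ : IsOpen Ω) (hf : JointlySmooth f Ω) {p : X} (hp : p ∈ Ω)
    (h : X) (t : ℝ) : dirLoop f p h (Circle.exp t)
      = fderiv ℝ (fun q : X × ℝ => f q.1 (Circle.exp q.2)) (p, t) (h, 0) := by
  rw [hf.dirLoop_apply hΩ hp, hf.dirFun_eq hΩ hp]

lemma JointlySmooth.dirLoop (hΩ : IsOpen Ω) (hf : JointlySmooth f Ω) :
    JointlySmooth (fun ph : X × X => dirLoop f ph.1 ph.2) (Ω ×ˢ univ) := by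
  have h1 : ContDiffOn ℝ ∞ (fun q : (X × X) × ℝ =>
      fderiv ℝ (fun q : X × ℝ => f q.1 (Circle.exp q.2)) (q.1.1, q.2)) ((Ω ×ˢ univ) ×ˢ univ) :=
    (hf.contDiffOn_fderiv hΩ).comp (f := fun q : (X × X) × ℝ => (q.1.1, q.2))
      (by fun_prop) fun q hq => ⟨hq.1.1, mem_univ _⟩
  refine (h1.clm_apply (g := fun q : (X × X) × ℝ => (q.1.2, (0 : ℝ))) (by fun_prop)).congr
    fun q hq => hf.dirLoop_exp hΩ hq.1.1 _ _

/-- The derivation `∂` commutes with directional derivatives: symmetry of second derivatives. -/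
lemma JointlySmooth.del_dirLoop (hΩ : IsOpen Ω) (hf : JointlySmooth f Ω) {p : X} (hp : p ∈ Ω)
    (h : X) : LC.del (Caloron.dirLoop f p h) = Caloron.dirLoop (fun p => LC.del (f p)) p h := by
  ext z
  obtain ⟨t, rfl⟩ : ∃ a, Circle.exp a = z := ⟨_, Circle.exp_arg z⟩
  set F : X × ℝ → ℂ := fun q => f q.1 (Circle.exp q.2) with hF
  have hnhds : Ω ×ˢ (univ : Set ℝ) ∈ 𝓝 (p, t) :=
    (hΩ.prod isOpen_univ).mem_nhds ⟨hp, mem_univ _⟩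
  have hd : DifferentiableAt ℝ (fderiv ℝ F) (p, t) :=
    ((hf.contDiffOn_fderiv hΩ).contDiffAt hnhds).differentiableAt (by simp)
  have hsymm : IsSymmSndFDerivAt ℝ F (p, t) :=
    (hf.contDiffAt hnhds).isSymmSndFDerivAt (by
      rw [minSmoothness_of_isRCLikeNormedField]; exact WithTop.coe_le_coe.2 le_top)
  have e1 : LC.del (Caloron.dirLoop f p h) (Circle.exp t)
      = fderiv ℝ (fderiv ℝ F) (p, t) (0, 1) (h, 0) := by
    have h1 : HasDerivAt (fun s : ℝ => (p, s)) ((0 : X), (1 : ℝ)) t :=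
      (hasDerivAt_const t p).prodMk (hasDerivAt_id t)
    have h2 := (hd.hasFDerivAt.comp_hasDerivAt t h1).clm_apply (hasDerivAt_const t (h, (0 : ℝ)))
    have h3 := (LC.hasDerivAt_exp (Caloron.dirLoop f p h) t)
    simp only [hf.dirLoop_exp hΩ hp] at h3
    have := h3.unique h2
    simpa using this
  have e2 : Caloron.dirLoop (fun p => LC.del (f p)) p h (Circle.exp t)
      = fderiv ℝ (fderiv ℝ F) (p, t) (h, 0) (0, 1) := by
    rw [(hf.del hΩ).dirLoop_exp hΩ hp]
    have : (fun q : X × ℝ => LC.del (f q.1) (Circle.exp q.2)) =ᶠ[𝓝 (p, t)]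
        fun q => fderiv ℝ F q (0, 1) := by
      filter_upwards [hnhds] with q hq
      exact hf.del_eq hΩ hq.1 q.2
    rw [this.fderiv_eq, fderiv_clm_apply hd (by fun_prop)]
    simp
  rw [e1, e2, hsymm.eq]

lemma derivCont_eq_zero (k : ℕ) (f : LC) : LC.derivCont k f = LC.derivCont 0 ((LC.del ^ k) f) := by
  ext z; rfl

/-- Iterates of `∂` preserve joint smoothness and commute with directional derivatives. -/
lemma JointlySmooth.del_pow (hΩ : IsOpen Ω) (hf : JointlySmooth f Ω) (k : ℕ) :
    JointlySmooth (fun p => (LC.del ^ k) (f p)) Ω ∧ ∀ p ∈ Ω, ∀ h,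
      (LC.del ^ k) (Caloron.dirLoop f p h) = Caloron.dirLoop (fun p => (LC.del ^ k) (f p)) p h := by
  induction k with
  | zero => exact ⟨hf, fun p _ h => rfl⟩
  | succ k ih =>
    simp only [pow_succ', Module.End.mul_apply]
    refine ⟨ih.1.del hΩ, fun p hp h => ?_⟩
    rw [ih.2 p hp h, ih.1.del_dirLoop hΩ hp]

lemma JointlySmooth.continuousOn_derivCont (hΩ : IsOpen Ω) (hf : JointlySmooth f Ω) :
    ContinuousOn (fun p => LC.derivCont 0 (f p)) Ω := by
  rw [continuousOn_iff_continuous_domRestrict]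
  refine ContinuousMap.continuous_of_continuous_uncurry _ ?_
  have h1 := (hf.contMDiffOn hΩ).continuousOn
  exact h1.comp_continuous (f := fun q : Ω × Circle => ((q.1 : X), q.2)) (by fun_prop)
    fun q => ⟨q.1.2, mem_univ _⟩

lemma JointlySmooth.continuousOn (hΩ : IsOpen Ω) (hf : JointlySmooth f Ω) : ContinuousOn f Ω :=
  LC.continuousOn_iff.2 fun k => by
    simp only [derivCont_eq_zero k]
    exact (hf.del_pow hΩ k).1.continuousOn_derivCont hΩ

/-- The difference quotients converge uniformly on the circle, by the mean value inequality applied to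
`s ↦ f(p + s h) - s D` with `D` the pointwise derivative. -/
lemma JointlySmooth.tendsto_derivCont (hΩ : IsOpen Ω) (hf : JointlySmooth f Ω) {p : X}
    (hp : p ∈ Ω) (h : X) : Tendsto (fun t => LC.derivCont 0 (gateauxQuot f p h t)) (𝓝[≠] 0)
      (𝓝 (LC.derivCont 0 (Caloron.dirLoop f p h))) := by
  set D : ℝ → C(Circle, ℂ) := fun s => LC.derivCont 0 (Caloron.dirLoop f (p + s • h) h) with hD
  have hD0 : D 0 = LC.derivCont 0 (Caloron.dirLoop f p h) := by simp [hD]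
  have hline : Tendsto (fun s : ℝ => (p + s • h, h)) (𝓝 0) (𝓝 (p, h)) := by
    have : Continuous fun s : ℝ => (p + s • h, h) := by fun_prop
    simpa using this.tendsto 0
  have hDc : Tendsto D (𝓝 0) (𝓝 (D 0)) := by
    have h1 := ((hf.dirLoop hΩ).continuousOn_derivCont (hΩ.prod isOpen_univ)).continuousAt
      ((hΩ.prod isOpen_univ).mem_nhds (⟨hp, mem_univ h⟩ : (p, h) ∈ Ω ×ˢ univ))
    rw [hD0]
    have h2 := Tendsto.comp (g := fun ph : X × X => LC.derivCont 0 (Caloron.dirLoop f ph.1 ph.2))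
      h1 hline
    simpa only [hD, Function.comp_def] using h2
  have hder : HasDerivAt (fun s : ℝ => LC.derivCont 0 (f (p + s • h))) (D 0) 0 := by
    rw [hasDerivAt_iff_isLittleO_nhds_zero, Asymptotics.isLittleO_iff]
    intro ε hε
    have h1 : ∀ᶠ s : ℝ in 𝓝 0, p + s • h ∈ Ω ∧ dist (D s) (D 0) < ε :=
      (eventually_line hΩ hp h).and (Metric.tendsto_nhds.1 hDc ε hε)
    obtain ⟨δ, hδ, hball⟩ := Metric.eventually_nhds_iff.1 h1
    filter_upwards [Metric.ball_mem_nhds (0 : ℝ) hδ] with t ht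
    rw [ContinuousMap.norm_le _ (by positivity)]
    intro z
    obtain ⟨a, rfl⟩ : ∃ a, Circle.exp a = z := ⟨_, Circle.exp_arg z⟩
    have hmem : ∀ s ∈ uIcc 0 t, dist s 0 < δ := by
      intro s hs
      have h2 := abs_sub_left_of_mem_uIcc hs
      rw [Real.dist_eq]
      simp only [sub_zero] at h2 ⊢
      exact h2.trans_lt (by simpa using ht)
    have hder : ∀ s ∈ uIcc 0 t, HasDerivWithinAt
        (fun s : ℝ => f (p + s • h) (Circle.exp a) - s • (D 0) (Circle.exp a))
        ((D s - D 0) (Circle.exp a)) (uIcc 0 t) s := by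
      intro s hs
      have hs' := (hball (hmem s hs)).1
      refine HasDerivAt.hasDerivWithinAt (HasDerivAt.sub ?_
        (by simpa using (hasDerivAt_id s).smul_const ((D 0) (Circle.exp a))))
      have h3 := hf.hasDerivAt hΩ hs' a
      rw [← hf.dirLoop_exp hΩ hs'] at h3
      exact h3
    have := Convex.norm_image_sub_le_of_norm_hasDerivWithin_le hder (C := ε)
      (fun s hs => (ContinuousMap.norm_coe_le_norm _ _).trans
        (by rw [← dist_eq_norm]; exact (hball (hmem s hs)).2.le))
      (convex_uIcc 0 t) left_mem_uIcc right_mem_uIcc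
    simp only [zero_smul, sub_zero, add_zero] at this
    simp only [zero_add, zero_smul, add_zero, ContinuousMap.sub_apply, ContinuousMap.smul_apply]
    rw [sub_right_comm] at this
    exact this
  have := hasDerivAt_iff_tendsto_slope_zero.1 hder
  rw [hD0] at this
  refine this.congr fun t => ?_
  simp only [gateauxQuot, map_smul, map_sub, zero_add, zero_smul, add_zero]

/-- The difference quotients converge in the topology of `LC`, as `∂` commutes with directional
derivatives. -/
lemma JointlySmooth.tendsto_gateauxQuot (hΩ : IsOpen Ω) (hf : JointlySmooth f Ω) {p : X}
    (hp : p ∈ Ω) (h : X) :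
    Tendsto (gateauxQuot f p h) (𝓝[≠] (0 : ℝ)) (𝓝 (Caloron.dirLoop f p h)) := by
  refine LC.tendsto_iff.2 fun k => ?_
  simp only [derivCont_eq_zero k, (hf.del_pow hΩ k).2 p hp h]
  refine ((hf.del_pow hΩ k).1.tendsto_derivCont hΩ hp h).congr fun t => ?_
  simp only [gateauxQuot, map_smul, map_sub]

lemma JointlySmooth.gateauxDeriv_eq (hΩ : IsOpen Ω) (hf : JointlySmooth f Ω) {p : X}
    (hp : p ∈ Ω) (h : X) : gateauxDeriv f p h = Caloron.dirLoop f p h :=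
  Caloron.gateauxDeriv_eq (hf.tendsto_gateauxQuot hΩ hp h)

lemma JointlySmooth.gatC {k : ℕ} : ∀ {X : Type u} [NormedAddCommGroup X] [NormedSpace ℝ X]
    {f : X → LC} {Ω : Set X}, IsOpen Ω → JointlySmooth f Ω → GatC k f Ω := by
  induction k with
  | zero => intro X _ _ f Ω hΩ hf; exact hf.continuousOn hΩ
  | succ k ih =>
    intro X _ _ f Ω hΩ hf
    refine ⟨hf.continuousOn hΩ, fun x hx h => ?_, ?_⟩
    · rw [hf.gateauxDeriv_eq hΩ hx]; exact hf.tendsto_gateauxQuot hΩ hx h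
    · exact (ih (hΩ.prod isOpen_univ) (hf.dirLoop hΩ)).congr (hΩ.prod isOpen_univ)
        fun p hp => (hf.gateauxDeriv_eq hΩ hp.1 p.2).symm

/-- The exponential law: a map from a finite-dimensional space to the space of smooth loops is
smooth if and only if it is jointly smooth in both variables. -/
theorem fsmoothOn_iff_jointlySmooth [FiniteDimensional ℝ X] (hΩ : IsOpen Ω) :
    FSmoothOn f Ω ↔ JointlySmooth f Ω :=
  ⟨fun h => h.jointlySmooth hΩ, fun h _ => h.gatC hΩ⟩

end ExponentialLaw

end Caloron

/-! ### Loop-valued functions on manifolds -/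

namespace Caloron

section LoopValued
variable {d n : ℕ} {M : Type v} [TopologicalSpace M] [ChartedSpace (Eu d) M]

lemma fsmoothM_pi {U : Set M} (hU : IsOpen U) {f : M → LV n} :
    FSmoothM d U f ↔ ∀ i, FSmoothM d U fun x => f x i := by
  constructor
  · intro hf i e he k
    exact GatC.clm_comp (e.isOpen_inter_preimage_symm hU)
      (ContinuousLinearMap.proj (R := ℝ) (φ := fun _ : Fin n => LC) i) (hf e he k)
  · intro hf e he k
    exact GatC.pi (e.isOpen_inter_preimage_symm hU) fun i => hf i e he k

section Exp
variable [IsManifold (𝓡 d) ∞ M]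

lemma mem_maximalAtlas_of_mem {e : OpenPartialHomeomorph M (Eu d)} (he : e ∈ atlas (Eu d) M) :
    e ∈ IsManifold.maximalAtlas (𝓡 d) ∞ M :=
  StructureGroupoid.subset_maximalAtlas _ he

/-- The exponential law on a manifold. -/
theorem fsmoothM_iff {U : Set M} (hU : IsOpen U) {f : M → LC} :
    FSmoothM d U f ↔
      ContMDiffOn (MI d) 𝓘(ℝ, ℂ) ∞ (fun q : M × Circle => f q.1 q.2) (U ×ˢ univ) := by
  constructor
  · rintro hf ⟨x, z⟩ ⟨hx, -⟩
    set e := chartAt (Eu d) x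
    have hΩ := e.isOpen_inter_preimage_symm hU
    have h1 := (JointlySmooth.contMDiffOn hΩ
      ((fsmoothOn_iff_jointlySmooth hΩ).1 (hf e (chart_mem_atlas _ x))))
    have h2 : ContMDiffOn (MI d) (MI d) ∞ (fun q : M × Circle => (e q.1, q.2))
        (e.source ×ˢ univ) :=
      ((contMDiffOn_of_mem_maximalAtlas (mem_maximalAtlas_of_mem (chart_mem_atlas _ x))).comp
        contMDiffOn_fst fun q hq => hq.1).prodMk contMDiffOn_snd
    have hmem : ((U ∩ e.source) ×ˢ univ : Set (M × Circle)) ∈ 𝓝 (x, z) :=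
      ((hU.inter e.open_source).prod isOpen_univ).mem_nhds
        ⟨⟨hx, mem_chart_source _ x⟩, mem_univ _⟩
    have h3 := (h1.comp (h2.mono (prod_mono inter_subset_right subset_rfl))
      (s := (U ∩ e.source) ×ˢ univ) fun q hq => ⟨⟨e.map_source hq.1.2, by
        simpa [e.left_inv hq.1.2] using hq.1.1⟩, mem_univ _⟩)
    refine ((h3.congr fun q hq => ?_).contMDiffAt hmem).contMDiffWithinAt
    simp only [Function.comp, e.left_inv hq.1.2]
  · intro hf e he
    have hΩ := e.isOpen_inter_preimage_symm hU
    rw [fsmoothOn_iff_jointlySmooth hΩ]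
    have h1 := contMDiffOn_prod_exp hf
    have h2 : ContMDiffOn ((𝓡 d).prod 𝓘(ℝ, ℝ)) ((𝓡 d).prod 𝓘(ℝ, ℝ)) ∞
        (fun q : Eu d × ℝ => (e.symm q.1, q.2)) ((e.target ∩ e.symm ⁻¹' U) ×ˢ univ) :=
      ((contMDiffOn_symm_of_mem_maximalAtlas (mem_maximalAtlas_of_mem he)).comp
        contMDiffOn_fst fun q hq => hq.1.1).prodMk contMDiffOn_snd
    have h3 := h1.comp h2 fun q hq => ⟨hq.1.2, mem_univ _⟩
    rw [← modelWithCornersSelf_prod, chartedSpaceSelf_prod] at h3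
    exact h3.contDiffOn

/-- The exponential law for maps into the space of loops in `ℂⁿ`. -/
theorem fsmoothM_iff_LV {U : Set M} (hU : IsOpen U) {f : M → LV n} :
    FSmoothM d U f ↔ ContMDiffOn (MI d) 𝓘(ℝ, Fin n → ℂ) ∞
      (fun (q : M × Circle) i => f q.1 i q.2) (U ×ˢ univ) := by
  rw [fsmoothM_pi hU, contMDiffOn_pi_space]
  exact forall_congr' fun i => fsmoothM_iff hU

end Exp

/-- The value of a loop of vectors at a point of the circle. -/
def LV.at (v : LV n) (z : Circle) : Fin n → ℂ := fun i => v i z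

section MF
variable {X : Type} [AddCommGroup X] [Module ℝ X] [TopologicalSpace X] [IsTopologicalAddGroup X]
  [ContinuousSMul ℝ X] [T2Space X] [LocallyConvexSpace ℝ X]

lemma FSmoothMF.add {U : Set M} (hU : IsOpen U) {f g : M → X → LV n}
    (hf : FSmoothMF d U f) (hg : FSmoothMF d U g) : FSmoothMF d U fun x v => f x v + g x v :=
  fun e he k => (hf e he k).add ((e.isOpen_inter_preimage_symm hU).prod isOpen_univ) (hg e he k)

lemma FSmoothMF.apply {U : Set M} (hU : IsOpen U) {f : M → LV n → LV n}
    (hf : FSmoothMF d U f) (v : LV n) : FSmoothM d U fun x => f x v :=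
  FSmoothM.comp_map hU (f := fun _ => v) hf fun _ _ _ => GatC.const _ _

/-- A matrix with smooth entries in the ring of loops, applied to a vector after a continuous linear
operation on its entries, gives a smooth map. -/
lemma fsmoothMF_matrix {U : Set M} (hU : IsOpen U) (T : LC →L[ℝ] LC) {a : M → Fin n → LV n}
    (ha : ∀ j, FSmoothM d U fun x => a x j) :
    FSmoothMF d U fun x (v : LV n) => ∑ j, T (v j) • a x j := by
  intro e he k
  have hΩ := e.isOpen_inter_preimage_symm hU
  have hΩ' := hΩ.prod (isOpen_univ (X := LV n))
  refine GatC.pi hΩ' fun i => ?_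
  simp only [Finset.sum_apply, Pi.smul_apply, smul_eq_mul]
  refine GatC.sumLC _ hΩ' fun j => GatC.mulLC hΩ' ?_ ?_
  · exact GatC.clm (X := Eu d × LV n) ((T.comp (ContinuousLinearMap.proj (R := ℝ)
      (φ := fun _ : Fin n => LC) j)).comp (ContinuousLinearMap.snd ℝ (Eu d) (LV n))) _
  · have h1 := GatC.clm_comp hΩ (ContinuousLinearMap.proj (R := ℝ) (φ := fun _ : Fin n => LC) i)
      (ha j e he k)
    exact (h1.comp_clm (ContinuousLinearMap.fst ℝ (Eu d) (LV n)) hΩ).mono fun q hq => hq.1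

lemma LV.sum_single (v : LV n) : v = ∑ j, v j • (Pi.single j 1 : LV n) := by
  rw [← pi_eq_sum_univ' v]

/-- A family of `LC`-linear maps is smooth as soon as the images of the standard basis are. -/
lemma fsmoothMF_linear {U : Set M} (hU : IsOpen U) {f : M → LV n → LV n}
    (hlin : ∀ x ∈ U, ∃ L : LV n →ₗ[LC] LV n, ∀ v, f x v = L v)
    (hf : ∀ j, FSmoothM d U fun x => f x (Pi.single j 1)) : FSmoothMF d U f := by
  refine (fsmoothMF_matrix hU (ContinuousLinearMap.id ℝ LC) hf).congr hU fun x hx v => ?_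
  obtain ⟨L, hL⟩ := hlin x hx
  simp only [ContinuousLinearMap.id_apply, hL]
  conv_rhs => rw [LV.sum_single v]
  simp

end MF

end LoopValued

/-! ### Differentials -/

section Differential
variable {d : ℕ} {M : Type v} [TopologicalSpace M] [ChartedSpace (Eu d) M]

lemma LC.mdifferentiableAt (f : LC) (z : Circle) : MDifferentiableAt (𝓡 1) 𝓘(ℝ, ℂ) f z :=
  f.smooth.mdifferentiableAt (by simp)

lemma contMDiff_circle_curve (z : Circle) :
    ContMDiff 𝓘(ℝ, ℝ) (𝓡 1) ∞ fun t : ℝ => z * Circle.exp t :=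
  contMDiff_const.mul contMDiff_circleExp

/-- `∂/∂θ` is the velocity of `t ↦ z e^{it}`. -/
lemma dFun_angVec {g : Circle → ℂ} {z : Circle} (hg : MDifferentiableAt (𝓡 1) 𝓘(ℝ, ℂ) g z) :
    dFun (𝓡 1) g z (angVec z) = deriv (fun t : ℝ => g (z * Circle.exp t)) 0 := by
  have h1 : MDifferentiableAt 𝓘(ℝ, ℝ) (𝓡 1) (fun t : ℝ => z * Circle.exp t) 0 :=
    (contMDiff_circle_curve z).mdifferentiableAt (by simp)
  have hg' : MDifferentiableAt (𝓡 1) 𝓘(ℝ, ℂ) g ((fun t : ℝ => z * Circle.exp t) 0) := by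
    simpa using hg
  have h2 := mfderiv_comp (0 : ℝ) hg' h1
  have h3 := congrArg (fun L : ℝ →L[ℝ] ℂ => L 1) h2
  rw [mfderiv_eq_fderiv] at h3
  rw [← fderiv_apply_one_eq_deriv]
  refine Eq.trans ?_ h3.symm
  simp only [dFun, angVec]
  change _ = (mfderiv (𝓡 1) 𝓘(ℝ, ℂ) g (z * Circle.exp 0)) _
  rw [Circle.exp_zero, mul_one]
  rfl

lemma LC.dFun_angVec (f : LC) (z : Circle) : dFun (𝓡 1) f z (angVec z) = LC.del f z :=
  Caloron.dFun_angVec (f.mdifferentiableAt z)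

lemma angForm_angVec (z : Circle) : angForm z (angVec z) = 1 := by
  have h1 : HasDerivAt (fun t : ℝ => ((z * Circle.exp t : Circle) : ℂ)) (z * Complex.I) 0 := by
    have h2 : HasDerivAt (fun t : ℝ => Complex.exp (t * Complex.I)) Complex.I 0 := by
      have h3 : HasDerivAt (fun t : ℝ => (t : ℂ) * Complex.I) Complex.I 0 := by
        simpa using (Complex.ofRealCLM.hasDerivAt (x := (0 : ℝ))).mul_const Complex.I
      simpa using h3.cexp
    have h4 := h2.const_mul (z : ℂ)
    simpa only [Circle.coe_mul, Circle.coe_exp] using h4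
  rw [angForm, dFun_angVec (contMDiff_coe_circle.mdifferentiableAt (by simp)), h1.deriv,
    mul_div_cancel_left₀ _ z.coe_ne_zero, Complex.I_im]

lemma angForm_add (z : Circle) (ξ η : TangentSpace (𝓡 1) z) :
    angForm z (ξ + η) = angForm z ξ + angForm z η := by
  have h (a b w : ℂ) : ((a + b) / w).im = (a / w).im + (b / w).im := by rw [add_div, Complex.add_im]
  simp only [angForm, dFun, map_add]
  exact h _ _ _

lemma angForm_smul (z : Circle) (c : ℝ) (ξ : TangentSpace (𝓡 1) z) :
    angForm z (c • ξ) = c * angForm z ξ := by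
  have h (a w : ℂ) : ((c • a) / w).im = c * (a / w).im := by
    rw [Complex.real_smul, mul_div_assoc, Complex.im_ofReal_mul]
  simp only [angForm, dFun, map_smul]
  exact h _ _

lemma angForm_zero (z : Circle) : angForm z (0 : TangentSpace (𝓡 1) z) = 0 := by
  have := angForm_smul z 0 0
  rwa [zero_smul, zero_mul] at this

lemma eq_angForm_smul_angVec (z : Circle) (ξ : TangentSpace (𝓡 1) z) :
    ξ = angForm z ξ • angVec z := by
  have hne : angVec z ≠ 0 := by
    intro h
    have := angForm_angVec z
    rw [h, angForm_zero] at this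
    exact zero_ne_one this
  have hfin : Module.finrank ℝ (Eu 1) = 1 := by simp
  obtain ⟨c, hc⟩ := exists_smul_eq_of_finrank_eq_one hfin (x := (angVec z : Eu 1)) hne ξ
  have hc' : ξ = c • angVec z := hc.symm
  conv_lhs => rw [hc']
  rw [hc', angForm_smul, angForm_angVec, mul_one]

lemma LC.dFun_eq (f : LC) (z : Circle) (ξ : TangentSpace (𝓡 1) z) :
    dFun (𝓡 1) f z ξ = (angForm z ξ : ℂ) * LC.del f z := by
  conv_lhs => rw [eq_angForm_smul_angVec z ξ]
  rw [← LC.dFun_angVec]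
  simp only [dFun, map_smul]
  exact Complex.real_smul

variable [IsManifold (𝓡 d) ∞ M]

/-- The differential of a loop-valued function is computed pointwise on the circle. -/
lemma dLoop_apply {U : Set M} (hU : IsOpen U) {f : M → LC} (hf : FSmoothM d U f) {x : M}
    (hx : x ∈ U) (X : TangentSpace (𝓡 d) x) (z : Circle) :
    dLoop d f x X z = dFun (𝓡 d) (fun y => f y z) x X := by
  set e := chartAt (Eu d) x with he
  have hΩ := e.isOpen_inter_preimage_symm hU
  have hj := (fsmoothOn_iff_jointlySmooth hΩ).1 (hf e (chart_mem_atlas _ x))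
  have hp : e x ∈ e.target ∩ e.symm ⁻¹' U :=
    ⟨mem_chart_target _ x, by simpa [he, (chartAt (Eu d) x).left_inv (mem_chart_source _ x)]⟩
  have hm : ContMDiffAt (𝓡 d) 𝓘(ℝ, ℂ) ∞ (fun y => f y z) x :=
    (((fsmoothM_iff hU).1 hf).contMDiffAt
      ((hU.prod isOpen_univ).mem_nhds (⟨hx, mem_univ _⟩ : (x, z) ∈ U ×ˢ univ))).comp x
      (contMDiffAt_id.prodMk contMDiffAt_const)
  obtain ⟨t, rfl⟩ : ∃ a, Circle.exp a = z := ⟨_, Circle.exp_arg z⟩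
  suffices main : ∀ X : Eu d, dLoop d f x X (Circle.exp t)
      = dFun (𝓡 d) (fun y => f y (Circle.exp t)) x X from main X
  intro X
  have h1 : dLoop d f x X = Caloron.dirLoop (f ∘ e.symm) (e x) X :=
    hj.gateauxDeriv_eq hΩ hp _
  have h2 := hj.hasDerivAt hΩ (p := e x) (h := X) (s := 0) (by simpa using hp) t
  rw [zero_smul, add_zero, ← hj.dirLoop_exp hΩ hp] at h2
  obtain ⟨L, hL⟩ : ∃ L : Eu d →L[ℝ] ℂ,
      L = mfderiv (𝓡 d) 𝓘(ℝ, ℂ) (fun y => f y (Circle.exp t)) x := ⟨_, rfl⟩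
  have h3 : HasFDerivAt (fun p : Eu d => f (e.symm p) (Circle.exp t)) L (e x) := by
    have h4 : HasFDerivWithinAt (fun p : Eu d => f (e.symm p) (Circle.exp t)) L
        (range (𝓡 d)) (e x) := by
      rw [hL]; exact (hm.mdifferentiableAt (by simp)).hasMFDerivAt.2
    rwa [ModelWithCorners.range_eq_univ, hasFDerivWithinAt_univ] at h4
  have h5 : HasDerivAt (fun s : ℝ => e x + s • X) X 0 := by
    simpa using ((hasDerivAt_id (0 : ℝ)).smul_const X).const_add (e x)
  have h6 := HasFDerivAt.comp_hasDerivAt_of_eq (0 : ℝ) h3 h5 (by simp)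
  rw [h1]
  refine (h2.unique h6).trans ?_
  rw [hL]; rfl

/-- The differential of a loop-valued function on `M` and of the corresponding function on
`M × S¹`. -/
theorem dFun_prod {U : Set M} (hU : IsOpen U) {f : M → LC} (hf : FSmoothM d U f) {x : M}
    (hx : x ∈ U) (X : TangentSpace (𝓡 d) x) (z : Circle) (ξ : TangentSpace (𝓡 1) z) :
    dFun (MI d) (fun q : M × Circle => f q.1 q.2) (x, z) (pairVec X ξ)
      = dLoop d f x X z + (angForm z ξ : ℂ) * LC.del (f x) z := by
  have hm := (((fsmoothM_iff hU).1 hf).contMDiffAt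
    ((hU.prod isOpen_univ).mem_nhds (⟨hx, mem_univ _⟩ : (x, z) ∈ U ×ˢ univ))).mdifferentiableAt
    (by simp)
  rw [dLoop_apply hU hf hx, ← LC.dFun_eq]
  exact mfderiv_prod_eq_add_apply hm

end Differential

end Caloron

/-! ### Extension of local sections -/

namespace Caloron

section Bump
universe w
variable {E : Type u} [NormedAddCommGroup E] [NormedSpace ℝ E] [FiniteDimensional ℝ E]
  {H : Type w} [TopologicalSpace H] {I : ModelWithCorners ℝ E H} {N : Type v} [TopologicalSpace N]
  [ChartedSpace H N] [T2Space N] [IsManifold I ∞ N]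

lemma exists_bump (I : ModelWithCorners ℝ E H) [IsManifold I ∞ N] {U : Set N} (hU : IsOpen U)
    {x : N} (hx : x ∈ U) : ∃ χ : N → ℝ, ContMDiff I 𝓘(ℝ, ℝ) ∞ χ ∧ (∀ᶠ y in 𝓝 x, χ y = 1) ∧
      tsupport χ ⊆ U := by
  obtain ⟨f, -, hf⟩ := (SmoothBumpFunction.nhds_basis_tsupport (I := I) x).mem_iff.1 (hU.mem_nhds hx)
  exact ⟨f, f.contMDiff, f.eventuallyEq_one, hf⟩

end Bump

section FibrewiseLinear

lemma contMDiffOn_smul_complex {E H N : Type*} [NormedAddCommGroup E] [NormedSpace ℝ E]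
    [TopologicalSpace H] {I : ModelWithCorners ℝ E H} [TopologicalSpace N] [ChartedSpace H N]
    {n : ℕ} {f : N → ℂ} {g : N → Fin n → ℂ} {U : Set N} (hf : ContMDiffOn I 𝓘(ℝ, ℂ) ∞ f U)
    (hg : ContMDiffOn I 𝓘(ℝ, Fin n → ℂ) ∞ g U) :
    ContMDiffOn I 𝓘(ℝ, Fin n → ℂ) ∞ (fun x => f x • g x) U := by
  have h : ContDiff ℝ ∞ fun p : ℂ × (Fin n → ℂ) => p.1 • p.2 :=
    contDiff_pi.2 fun i => contDiff_fst.mul ((contDiff_apply ℝ ℂ i).comp contDiff_snd)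
  exact h.contMDiff.comp_contMDiffOn (hf.prodMk_space hg)

variable {d n : ℕ} {M : Type v} [TopologicalSpace M] [ChartedSpace (Eu d) M]

lemma sum_single_complex (v : Fin n → ℂ) : v = ∑ j, v j • (Pi.single j 1 : Fin n → ℂ) := by
  rw [← pi_eq_sum_univ' v]

/-- A family of `ℂ`-linear maps of `ℂⁿ` is smooth as soon as the images of the standard basis
are. -/
lemma contMDiffOn_linear {U : Set (M × Circle)} {f : M × Circle → (Fin n → ℂ) → (Fin n → ℂ)}
    (hlin : ∀ p ∈ U, ∃ L : (Fin n → ℂ) →ₗ[ℂ] (Fin n → ℂ), ∀ v, f p v = L v)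
    (hf : ∀ j, ContMDiffOn (MI d) 𝓘(ℝ, Fin n → ℂ) ∞ (fun p => f p (Pi.single j 1)) U) :
    ContMDiffOn ((MI d).prod 𝓘(ℝ, Fin n → ℂ)) 𝓘(ℝ, Fin n → ℂ) ∞
      (fun q : (M × Circle) × (Fin n → ℂ) => f q.1 q.2) (U ×ˢ univ) := by
  have h1 : ContMDiffOn ((MI d).prod 𝓘(ℝ, Fin n → ℂ)) 𝓘(ℝ, Fin n → ℂ) ∞
      (fun q : (M × Circle) × (Fin n → ℂ) => ∑ j, q.2 j • f q.1 (Pi.single j 1)) (U ×ˢ univ) := by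
    refine contMDiffOn_finsetSum fun j _ => contMDiffOn_smul_complex ?_ ?_
    · have : ContDiff ℝ ∞ fun v : Fin n → ℂ => v j := contDiff_apply ℝ ℂ j
      exact (this.contMDiff.comp contMDiff_snd).contMDiffOn
    · exact (hf j).comp contMDiffOn_fst fun q hq => hq.1
  refine h1.congr fun q hq => ?_
  obtain ⟨L, hL⟩ := hlin q.1 hq.1
  simp only [hL]
  conv_lhs => rw [sum_single_complex q.2]
  simp

end FibrewiseLinear

section Extension
variable {d n : ℕ} {M : Type v} [TopologicalSpace M] [ChartedSpace (Eu d) M]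

section
variable [IsManifold (𝓡 d) ∞ M]

lemma FSmoothM.smul {U : Set M} (hU : IsOpen U) {f : M → LC} {g : M → LV n}
    (hf : FSmoothM d U f) (hg : FSmoothM d U g) : FSmoothM d U fun x => f x • g x := by
  rw [fsmoothM_iff_LV hU] at hg ⊢
  rw [fsmoothM_iff hU] at hf
  exact contMDiffOn_smul_complex hf hg

lemma FSmoothM.addLV {U : Set M} (hU : IsOpen U) {f g : M → LV n}
    (hf : FSmoothM d U f) (hg : FSmoothM d U g) : FSmoothM d U fun x => f x + g x := by
  rw [fsmoothM_iff_LV hU] at hf hg ⊢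
  exact hf.add hg

lemma fsmoothM_algebraMap {U : Set M} (hU : IsOpen U) {χ : M → ℂ}
    (hχ : ContMDiffOn (𝓡 d) 𝓘(ℝ, ℂ) ∞ χ U) : FSmoothM d U fun x => algebraMap ℂ LC (χ x) := by
  rw [fsmoothM_iff hU]
  exact hχ.comp contMDiffOn_fst fun q hq => hq.1

end

lemma fsmoothM_const {Y : Type} [AddCommGroup Y] [Module ℝ Y] [TopologicalSpace Y] [T2Space Y]
    (U : Set M) (c : Y) : FSmoothM d U fun _ => c :=
  fun _ _ _ => GatC.const _ _

lemma contMDiff_ofReal {E H : Type*} [NormedAddCommGroup E] [NormedSpace ℝ E] [TopologicalSpace H]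
    {I : ModelWithCorners ℝ E H} {N : Type*} [TopologicalSpace N] [ChartedSpace H N] {χ : N → ℝ}
    (hχ : ContMDiff I 𝓘(ℝ, ℝ) ∞ χ) : ContMDiff I 𝓘(ℝ, ℂ) ∞ fun x => (χ x : ℂ) :=
  Complex.ofRealCLM.contDiff.contMDiff.comp hχ

section Basic
variable {B : Type v} {R : Type} [CommRing R] {F : Type} [AddCommGroup F] [Module R F]
  {fib : B → Type u} [∀ b, AddCommGroup (fib b)] [∀ b, Module R (fib b)]

/-- The trivialisation at a point of its domain. -/
noncomputable def LocalTriv.equivAt (ψ : LocalTriv R F fib) {b : B} (h : b ∈ ψ.base) :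
    F ≃ₗ[R] fib b := (ψ.triv b h).symm

lemma LocalTriv.equivAt_apply (ψ : LocalTriv R F fib) {b : B} (h : b ∈ ψ.base) (v : F) :
    ψ.equivAt h v = ψ.frame b v := by simp [equivAt, frame, h]

lemma LocalTriv.equivAt_symm_apply (ψ : LocalTriv R F fib) {b : B} (h : b ∈ ψ.base) (v : fib b) :
    (ψ.equivAt h).symm v = ψ.coord b v := by simp [equivAt, coord, h]

lemma LocalTriv.coord_eq_zero (ψ : LocalTriv R F fib) {b : B} (h : b ∈ ψ.base) {v : fib b} :
    ψ.coord b v = 0 ↔ v = 0 := by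
  rw [← ψ.equivAt_symm_apply h, LinearEquiv.map_eq_zero_iff]

end Basic

namespace OVect
variable {A A' : OVect.{u} d n M}

lemma IsSmoothSecOn.congr {U : Set M} (hU : IsOpen U) {s t : ∀ x, A.fib x}
    (hs : A.IsSmoothSecOn U s) (h : ∀ x ∈ U, s x = t x) : A.IsSmoothSecOn U t := fun ψ hψ =>
  (hs ψ hψ).congr (hU.inter (A.isOpen ψ hψ)) fun x hx => by rw [h x hx.1]

lemma isSmoothSecOn_of_local {U : Set M} {s : ∀ x, A.fib x}
    (h : ∀ x ∈ U, ∃ W, IsOpen W ∧ x ∈ W ∧ A.IsSmoothSecOn (U ∩ W) s) : A.IsSmoothSecOn U s := by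
  intro ψ hψ
  refine FSmoothM.of_local fun x hx => ?_
  obtain ⟨W, hW, hxW, hs⟩ := h x hx.1
  exact ⟨W, hW, hxW, (hs ψ hψ).mono fun y hy => ⟨⟨hy.1.1, hy.2⟩, hy.1.2⟩⟩

/-- The section given by smooth coordinates in a local trivialisation is smooth. -/
lemma isSmoothSecOn_frame {ψ : LocalTriv LC (LV n) A.fib} (hψ : ψ ∈ A.atlas) {U : Set M}
    (hU : IsOpen U) (hUψ : U ⊆ ψ.base) {c : M → LV n} (hc : FSmoothM d U c) :
    A.IsSmoothSecOn U fun x => ψ.frame x (c x) := fun ψ' hψ' =>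
  FSmoothM.comp_map (hU.inter (A.isOpen ψ' hψ'))
    ((A.trans_smooth ψ hψ ψ' hψ').mono fun _ hx => ⟨hUψ hx.1, hx.2⟩) (hc.mono inter_subset_left)

lemma isFrame_equivAt {ψ : LocalTriv LC (LV n) A.fib} (hψ : ψ ∈ A.atlas) {x : M}
    (hx : x ∈ ψ.base) : A.IsFrame x (ψ.equivAt hx) := by
  intro ψ' hψ' hx'
  obtain ⟨γ, hγ, h⟩ := A.trans_based ψ hψ ψ' hψ' x ⟨hx, hx'⟩
  exact ⟨γ, hγ, fun v => by rw [ψ.equivAt_apply, ← h]; rfl⟩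

lemma exists_isFrame (x : M) : ∃ p, A.IsFrame x p := by
  obtain ⟨ψ, hψ, hx⟩ := A.cover x
  exact ⟨_, isFrame_equivAt hψ hx⟩

lemma isSmoothSecOn_zero (U : Set M) : A.IsSmoothSecOn U fun _ => 0 := fun ψ _ => by
  simp only [map_zero]; exact fsmoothM_const _ _

section
variable [IsManifold (𝓡 d) ∞ M]

lemma IsSmoothSecOn.smul {U : Set M} (hU : IsOpen U) {f : M → LC} {s : ∀ x, A.fib x}
    (hf : FSmoothM d U f) (hs : A.IsSmoothSecOn U s) : A.IsSmoothSecOn U fun x => f x • s x := by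
  intro ψ hψ
  have hU' := hU.inter (A.isOpen ψ hψ)
  exact (FSmoothM.smul hU' (hf.mono inter_subset_left) (hs ψ hψ)).congr hU' fun x _ => by
    rw [map_smul]

lemma IsSmoothSecOn.add {U : Set M} (hU : IsOpen U) {s t : ∀ x, A.fib x}
    (hs : A.IsSmoothSecOn U s) (ht : A.IsSmoothSecOn U t) :
    A.IsSmoothSecOn U fun x => s x + t x := by
  intro ψ hψ
  have hU' := hU.inter (A.isOpen ψ hψ)
  exact (FSmoothM.addLV hU' (hs ψ hψ) (ht ψ hψ)).congr hU' fun x _ => by rw [map_add]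

variable [T2Space M]

/-- A section that is smooth near `x` agrees near `x` with a global smooth section. -/
lemma exists_sec {U : Set M} (hU : IsOpen U) {s : ∀ x, A.fib x} (hs : A.IsSmoothSecOn U s) {x : M}
    (hx : x ∈ U) : ∃ t : A.Sec, ∀ᶠ y in 𝓝 x, t y = s y := by
  obtain ⟨χ, hχ, h1, h2⟩ := exists_bump (𝓡 d) hU hx
  refine ⟨⟨fun y => algebraMap ℂ LC (χ y) • s y, isSmoothSecOn_of_local fun y _ => ?_⟩, ?_⟩
  · by_cases hy : y ∈ U
    · refine ⟨U, hU, hy, ?_⟩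
      rw [univ_inter]
      exact hs.smul hU (fsmoothM_algebraMap hU (contMDiff_ofReal hχ).contMDiffOn)
    · refine ⟨(tsupport χ)ᶜ, (isClosed_tsupport χ).isOpen_compl, fun h => hy (h2 h), ?_⟩
      rw [univ_inter]
      refine (isSmoothSecOn_zero _).congr (isClosed_tsupport χ).isOpen_compl fun w hw => ?_
      simp [image_eq_zero_of_notMem_tsupport hw]
  · filter_upwards [h1] with y hy
    rw [hy, Complex.ofReal_one, map_one, one_smul]

lemma exists_sec_frame {ψ : LocalTriv LC (LV n) A.fib} (hψ : ψ ∈ A.atlas) {x : M}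
    (hx : x ∈ ψ.base) (v : LV n) : ∃ t : A.Sec, ∀ᶠ y in 𝓝 x, t y = ψ.frame y v :=
  exists_sec (A.isOpen ψ hψ)
    (isSmoothSecOn_frame hψ (A.isOpen ψ hψ) subset_rfl (fsmoothM_const _ v)) hx

lemma exists_sec_eq {x : M} (v : A.fib x) : ∃ t : A.Sec, t x = v := by
  obtain ⟨ψ, hψ, hx⟩ := A.cover x
  obtain ⟨t, ht⟩ := exists_sec_frame hψ hx (ψ.coord x v)
  exact ⟨t, by rw [ht.self_of_nhds, ψ.frame_coord hx]⟩

/-- A fibrewise `LC`-linear map that preserves smooth sections is smooth. -/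
lemma readMap_smooth (f : ∀ x, A.fib x →ₗ[LC] A'.fib x)
    (hf : ∀ s : A.Sec, A'.IsSmoothSecOn univ fun x => f x (s x))
    {ψ : LocalTriv LC (LV n) A.fib} (hψ : ψ ∈ A.atlas)
    {ψ' : LocalTriv LC (LV n) A'.fib} (hψ' : ψ' ∈ A'.atlas) :
    FSmoothMF d (ψ.base ∩ ψ'.base) (readMap ψ ψ' fun x v => f x v) := by
  have hU := (A.isOpen ψ hψ).inter (A'.isOpen ψ' hψ')
  refine fsmoothMF_linear hU (fun x _ => ⟨(ψ'.coord x ∘ₗ f x) ∘ₗ ψ.frame x, fun v => rfl⟩)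
    fun j => FSmoothM.of_local fun x hx => ?_
  obtain ⟨t, ht⟩ := exists_sec_frame hψ hx.1 (Pi.single j 1)
  obtain ⟨W, hW, hWo, hxW⟩ := eventually_nhds_iff.1 ht
  refine ⟨W, hWo, hxW, ?_⟩
  refine (((hf t) ψ' hψ').mono fun y hy => ⟨mem_univ _, hy.1.2⟩).congr (hU.inter hWo) fun y hy =>
    congrArg (fun v => ψ'.coord y (f y v)) (hW y hy.2)

end
end OVect

namespace FrVect
variable {E E' : FrVect.{u} d n M}

lemma IsSmoothSecOn.mono {U V : Set (M × Circle)} {s : ∀ p, E.fib p} (hs : E.IsSmoothSecOn U s)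
    (h : V ⊆ U) : E.IsSmoothSecOn V s := fun ψ hψ => (hs ψ hψ).mono (inter_subset_inter_left _ h)

lemma IsSmoothSecOn.congr {U : Set (M × Circle)} {s t : ∀ p, E.fib p}
    (hs : E.IsSmoothSecOn U s) (h : ∀ p ∈ U, s p = t p) : E.IsSmoothSecOn U t := fun ψ hψ =>
  (hs ψ hψ).congr fun p hp => by rw [h p hp.1]

lemma isSmoothSecOn_of_local {U : Set (M × Circle)} {s : ∀ p, E.fib p}
    (h : ∀ p ∈ U, ∃ W, IsOpen W ∧ p ∈ W ∧ E.IsSmoothSecOn (U ∩ W) s) : E.IsSmoothSecOn U s := by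
  intro ψ hψ
  refine contMDiffOn_of_locally_contMDiffOn fun p hp => ?_
  obtain ⟨W, hW, hpW, hs⟩ := h p hp.1
  exact ⟨W, hW, hpW, (hs ψ hψ).mono fun y hy => ⟨⟨hy.1.1, hy.2⟩, hy.1.2⟩⟩

lemma IsSmoothSecOn.smul {U : Set (M × Circle)} {f : M × Circle → ℂ} {s : ∀ p, E.fib p}
    (hf : ContMDiffOn (MI d) 𝓘(ℝ, ℂ) ∞ f U) (hs : E.IsSmoothSecOn U s) :
    E.IsSmoothSecOn U fun p => f p • s p := by
  intro ψ hψ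
  exact (contMDiffOn_smul_complex (hf.mono inter_subset_left) (hs ψ hψ)).congr fun p _ => by
    rw [map_smul]

lemma IsSmoothSecOn.add {U : Set (M × Circle)} {s t : ∀ p, E.fib p}
    (hs : E.IsSmoothSecOn U s) (ht : E.IsSmoothSecOn U t) :
    E.IsSmoothSecOn U fun p => s p + t p := by
  intro ψ hψ
  exact ((hs ψ hψ).add (ht ψ hψ)).congr fun p _ => by rw [map_add]; rfl

lemma isSmoothSecOn_zero (U : Set (M × Circle)) : E.IsSmoothSecOn U fun _ => 0 := fun ψ _ => by
  simp only [map_zero]; exact contMDiffOn_const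

lemma IsSmoothSecOn.sum {ι : Type} (S : Finset ι) {U : Set (M × Circle)} {s : ι → ∀ p, E.fib p}
    (hs : ∀ i ∈ S, E.IsSmoothSecOn U (s i)) : E.IsSmoothSecOn U fun p => ∑ i ∈ S, s i p := by
  classical
  induction S using Finset.induction_on with
  | empty => simpa using isSmoothSecOn_zero U
  | insert a S ha ih =>
    simp only [Finset.sum_insert ha]
    exact (hs a (Finset.mem_insert_self _ _)).add
      (ih fun i hi => hs i (Finset.mem_insert_of_mem hi))

/-- The section given by smooth coordinates in a local trivialisation is smooth. -/
lemma isSmoothSecOn_frame {ψ : LocalTriv ℂ (Fin n → ℂ) E.fib} (hψ : ψ ∈ E.atlas)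
    {U : Set (M × Circle)} (hUψ : U ⊆ ψ.base) {c : M × Circle → Fin n → ℂ}
    (hc : ContMDiffOn (MI d) 𝓘(ℝ, Fin n → ℂ) ∞ c U) :
    E.IsSmoothSecOn U fun p => ψ.frame p (c p) := fun ψ' hψ' =>
  (E.trans_smooth ψ hψ ψ' hψ').comp
    ((contMDiffOn_id.prodMk hc).mono (t := U ∩ ψ'.base) inter_subset_left)
    fun _ hp => ⟨⟨hUψ hp.1, hp.2⟩, mem_univ _⟩

/-- Near a point of the domain, a product with a bump function is a smooth section. -/
lemma isSmoothSecOn_bump {U V : Set (M × Circle)} (hU : IsOpen U) {s : ∀ p, E.fib p}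
    (hs : E.IsSmoothSecOn (U ∩ V) s) (hV : IsOpen V) {χ : M × Circle → ℝ}
    (hχ : ContMDiff (MI d) 𝓘(ℝ, ℝ) ∞ χ) (hsupp : tsupport χ ∩ V ⊆ U) :
    E.IsSmoothSecOn V fun p => (χ p : ℂ) • s p := by
  refine isSmoothSecOn_of_local fun y hyV => ?_
  by_cases hy : y ∈ U
  · refine ⟨U ∩ V, hU.inter hV, ⟨hy, hyV⟩, ?_⟩
    exact (hs.smul (contMDiff_ofReal hχ).contMDiffOn).mono inter_subset_right
  · refine ⟨(tsupport χ)ᶜ, (isClosed_tsupport χ).isOpen_compl, fun h => hy (hsupp ⟨h, hyV⟩), ?_⟩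
    refine (isSmoothSecOn_zero _).congr fun w hw => ?_
    simp [image_eq_zero_of_notMem_tsupport hw.2]

section
variable [IsManifold (𝓡 d) ∞ M] [T2Space M]

/-- A section that is smooth near `p` agrees near `p` with a global smooth section. -/
lemma exists_sec {U : Set (M × Circle)} (hU : IsOpen U) {s : ∀ p, E.fib p}
    (hs : E.IsSmoothSecOn U s) {p : M × Circle} (hp : p ∈ U) :
    ∃ t : E.Sec, ∀ᶠ q in 𝓝 p, t q = s q := by
  obtain ⟨χ, hχ, h1, h2⟩ := exists_bump (MI d) hU hp
  refine ⟨⟨fun y => (χ y : ℂ) • s y, isSmoothSecOn_bump hU (by rwa [inter_univ]) isOpen_univ hχ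
    (by rwa [inter_univ])⟩, ?_⟩
  filter_upwards [h1] with y hy
  rw [hy, Complex.ofReal_one, one_smul]

lemma exists_sec_frame {ψ : LocalTriv ℂ (Fin n → ℂ) E.fib} (hψ : ψ ∈ E.atlas) {p : M × Circle}
    (hp : p ∈ ψ.base) (v : Fin n → ℂ) : ∃ t : E.Sec, ∀ᶠ q in 𝓝 p, t q = ψ.frame q v :=
  exists_sec (E.isOpen ψ hψ) (isSmoothSecOn_frame hψ subset_rfl contMDiffOn_const) hp

/-- A fibrewise linear map that preserves smooth sections is smooth. -/
lemma readMap_smooth (f : ∀ p, E.fib p →ₗ[ℂ] E'.fib p)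
    (hf : ∀ s : E.Sec, E'.IsSmoothSecOn univ fun p => f p (s p))
    {ψ : LocalTriv ℂ (Fin n → ℂ) E.fib} (hψ : ψ ∈ E.atlas)
    {ψ' : LocalTriv ℂ (Fin n → ℂ) E'.fib} (hψ' : ψ' ∈ E'.atlas) :
    ContMDiffOn ((MI d).prod 𝓘(ℝ, Fin n → ℂ)) 𝓘(ℝ, Fin n → ℂ) ∞
      (fun q : (M × Circle) × (Fin n → ℂ) => readMap ψ ψ' (fun p v => f p v) q.1 q.2)
      ((ψ.base ∩ ψ'.base) ×ˢ univ) := by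
  refine contMDiffOn_linear (fun x _ => ⟨(ψ'.coord x ∘ₗ f x) ∘ₗ ψ.frame x, fun v => rfl⟩)
    fun j => contMDiffOn_of_locally_contMDiffOn fun x hx => ?_
  obtain ⟨t, ht⟩ := exists_sec_frame hψ hx.1 (Pi.single j 1)
  obtain ⟨W, hW, hWo, hxW⟩ := eventually_nhds_iff.1 ht
  refine ⟨W, hWo, hxW, ?_⟩
  refine (((hf t) ψ' hψ').mono fun y hy => ⟨mem_univ _, hy.1.2⟩).congr fun y hy =>
    congrArg (fun v => ψ'.coord y (f y v)) (hW y hy.2).symm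

end
end FrVect

end Extension
end Caloron

/-! ### The loop group -/

namespace Caloron

section LoopGroup
variable {n : ℕ}

lemma LV.at_act (γ : Matrix.GeneralLinearGroup (Fin n) LC) (c : LV n) (z : Circle) :
    (act γ c).at z = (Matrix.GeneralLinearGroup.map (n := Fin n) (LC.eval z) γ).1.mulVec (c.at z) := by
  funext i
  change LC.eval z (∑ j, γ.1 i j * c j) = ∑ j, γ.1 i j z * c j z
  rw [map_sum]; rfl

@[simp] lemma LV.at_constLoop (v : Fin n → ℂ) (z : Circle) : (constLoop v).at z = v := rfl

lemma constLoop_single (j : Fin n) : constLoop (Pi.single j 1) = (Pi.single j 1 : LV n) := by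
  funext i
  rcases eq_or_ne i j with rfl | h
  · simp [constLoop]
  · simp [constLoop, h]

lemma constLoop_add (v w : Fin n → ℂ) : constLoop (v + w) = constLoop v + constLoop w := by
  funext i; simp [constLoop]

lemma constLoop_smul (c : ℂ) (v : Fin n → ℂ) :
    constLoop (c • v) = algebraMap ℂ LC c • constLoop v := by
  funext i; simp [constLoop]

/-- The based loops are those that act trivially at the base point. -/
lemma mem_OmegaGL_iff {γ : Matrix.GeneralLinearGroup (Fin n) LC} :
    γ ∈ OmegaGL n ↔ ∀ c : LV n, (act γ c).at 1 = c.at 1 := by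
  rw [OmegaGL, MonoidHom.mem_ker]
  constructor
  · intro h c
    rw [LV.at_act, h]; simp
  · intro h
    refine Units.ext (Matrix.ext_of_mulVec_single fun j => ?_)
    have := h (constLoop (Pi.single j 1))
    rw [LV.at_act, LV.at_constLoop] at this
    rw [this, Units.val_one, Matrix.one_mulVec]

/-- Every `LC`-linear automorphism of `LV` is the action of a loop in `GL_n(ℂ)`. -/
lemma exists_act (f : LV n ≃ₗ[LC] LV n) :
    ∃ γ : Matrix.GeneralLinearGroup (Fin n) LC, ∀ v, f v = act γ v := by
  refine ⟨⟨LinearMap.toMatrix' f.toLinearMap, LinearMap.toMatrix' f.symm.toLinearMap, ?_, ?_⟩,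
    fun v => (LinearMap.toMatrix'_mulVec f.toLinearMap v).symm⟩
  · rw [← LinearMap.toMatrix'_comp]; simp
  · rw [← LinearMap.toMatrix'_comp]; simp

/-- The action of a loop of matrices as a linear automorphism. -/
noncomputable def actEquiv (γ : Matrix.GeneralLinearGroup (Fin n) LC) : LV n ≃ₗ[LC] LV n :=
  LinearEquiv.ofLinearMap (Matrix.mulVecLin γ.1) (Matrix.mulVecLin γ⁻¹.1)
    (by rw [← Matrix.mulVecLin_mul, ← Units.val_mul, mul_inv_cancel]; simp)
    (by rw [← Matrix.mulVecLin_mul, ← Units.val_mul, inv_mul_cancel]; simp)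

end LoopGroup

/-! ### Fibres of bundles that are caloron transforms of each other -/

section Pairing
variable {d n : ℕ} {M : Type v} [TopologicalSpace M] [ChartedSpace (Eu d) M]

lemma FrVect.IsSmoothSecOn.loop {E : FrVect.{u} d n M} {s : ∀ p, E.fib p}
    (hs : E.IsSmoothSecOn univ s) (x : M) : E.IsSmoothLoop x fun z => s (x, z) := fun ψ hψ =>
  (hs ψ hψ).comp (contMDiffOn_const.prodMk contMDiffOn_id) fun _ hz => ⟨mem_univ _, hz⟩

namespace CaloronPairing
variable {A A' A'' : OVect.{u} d n M} {E E' E'' : FrVect.{u} d n M}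

section Fibre
variable (P : CaloronPairing A E)

/-- Evaluation as a map that is linear along the evaluation homomorphism of the ring of loops. -/
noncomputable def evL (x : M) (z : Circle) : A.fib x →ₛₗ[LC.eval z] E.fib (x, z) where
  toFun := P.ev x z
  map_add' := P.map_add x z
  map_smul' := P.map_smul x z

lemma ev_zero (x : M) (z : Circle) : P.ev x z 0 = 0 := (P.evL x z).map_zero

lemma ev_sub (x : M) (z : Circle) (v w : A.fib x) : P.ev x z (v - w) = P.ev x z v - P.ev x z w :=
  (P.evL x z).map_sub v w

lemma ev_algebraMap_smul (x : M) (z : Circle) (c : ℂ) (v : A.fib x) :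
    P.ev x z (algebraMap ℂ LC c • v) = c • P.ev x z v := P.map_smul x z _ v

lemma ev_ext {x : M} {v w : A.fib x} (h : ∀ z, P.ev x z v = P.ev x z w) : v = w := by
  rw [← sub_eq_zero]
  obtain ⟨ψ, hψ, hx⟩ := A.cover x
  rw [← ψ.coord_eq_zero hx]
  funext i
  ext z
  have h1 : P.ev x z (v - w) = 0 := by rw [P.ev_sub, h, sub_self]
  exact (P.ev_eq_zero x z _).1 h1 ψ hψ hx i

lemma ev_linear {x : M} (p : LV n →ₗ[LC] A.fib x) (c : LV n) (z : Circle) :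
    P.ev x z (p c) = ∑ j, c j z • P.ev x z (p (Pi.single j 1)) := by
  conv_lhs => rw [LV.sum_single c, map_sum]
  refine (map_sum (P.evL x z) _ _).trans (Finset.sum_congr rfl fun j _ => ?_)
  rw [p.map_smul]
  exact P.map_smul x z _ _

/-- The value at `z` of an `LC`-linear combination depends on the values at `z` of the coefficients
only. -/
lemma ev_linear_congr {x : M} (p : LV n →ₗ[LC] A.fib x) {c c' : LV n} {z : Circle}
    (h : c.at z = c'.at z) : P.ev x z (p c) = P.ev x z (p c') := by
  rw [P.ev_linear p c, P.ev_linear p c']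
  exact Finset.sum_congr rfl fun j _ => by
    rw [show c j z = c' j z from congrFun h j]

/-- A frame of the fibre of `𝖤` over `x` gives frames of the fibres of `E` over `{x} × S¹`. -/
noncomputable def frameAt {x : M} (p : LV n ≃ₗ[LC] A.fib x) (z : Circle) :
    (Fin n → ℂ) ≃ₗ[ℂ] E.fib (x, z) :=
  let L : (Fin n → ℂ) →ₗ[ℂ] E.fib (x, z) :=
    { toFun := fun w => P.ev x z (p (constLoop w))
      map_add' := fun v w => by rw [constLoop_add, _root_.map_add, P.map_add]
      map_smul' := fun c v => by
        rw [constLoop_smul, _root_.map_smul, P.ev_algebraMap_smul, RingHom.id_apply] }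
  have hs : Function.Surjective L := fun w => by
    obtain ⟨u, rfl⟩ := P.surjective x z w
    refine ⟨(p.symm u).at z, ?_⟩
    refine (P.ev_linear_congr (p : LV n →ₗ[LC] A.fib x)
      (c := constLoop ((p.symm u).at z)) (c' := p.symm u) (z := z) rfl).trans ?_
    rw [LinearEquiv.coe_coe, LinearEquiv.apply_symm_apply]
  -- A surjection between spaces of the same finite dimension is injective.
  LinearEquiv.ofBijective L ⟨by
    obtain ⟨ψ, -, h⟩ := E.cover (x, z)
    have e := ψ.equivAt h
    have h1 : Function.Surjective (e.symm.toLinearMap ∘ₗ L) := e.symm.surjective.comp hs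
    have h2 := LinearMap.injective_iff_surjective.2 h1
    exact Function.Injective.of_comp (f := e.symm) h2, hs⟩

lemma frameAt_apply {x : M} (p : LV n ≃ₗ[LC] A.fib x) (z : Circle) (w : Fin n → ℂ) :
    P.frameAt p z w = P.ev x z (p (constLoop w)) := rfl

lemma frameAt_at {x : M} (p : LV n ≃ₗ[LC] A.fib x) (z : Circle) (c : LV n) :
    P.frameAt p z (c.at z) = P.ev x z (p c) :=
  P.ev_linear_congr (p : LV n →ₗ[LC] A.fib x) rfl

lemma ev_eq_zero_iff {x : M} (p : LV n ≃ₗ[LC] A.fib x) (z : Circle) (c : LV n) :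
    P.ev x z (p c) = 0 ↔ c.at z = 0 := by
  rw [← P.frameAt_at, LinearEquiv.map_eq_zero_iff]

/-- The based frames are the `LC`-linear frames that restrict to the framing at the base point. -/
lemma isFrame_iff {x : M} (p : LV n ≃ₗ[LC] A.fib x) :
    A.IsFrame x p ↔ ∀ v, P.ev x 1 (p (constLoop v)) = E.framing x v := by
  refine ⟨P.framing x p, fun h ψ hψ hx => ?_⟩
  obtain ⟨γ, hγ⟩ := exists_act (p.trans (ψ.equivAt hx).symm)
  have hγ' : ∀ c, p c = ψ.equivAt hx (act γ c) := fun c => by rw [← hγ]; simp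
  refine ⟨γ, mem_OmegaGL_iff.2 fun c => ?_, fun v => by
    rw [← hγ, LinearEquiv.trans_apply, ψ.equivAt_symm_apply]⟩
  have h1 : P.ev x 1 (ψ.equivAt hx (act γ c)) = P.ev x 1 (ψ.equivAt hx c) := by
    rw [← hγ', ← P.frameAt_at, ← P.frameAt_at, P.frameAt_apply, P.frameAt_apply, h,
      P.framing x _ (OVect.isFrame_equivAt hψ hx)]
  rw [← P.frameAt_at, ← P.frameAt_at] at h1
  exact (P.frameAt _ _).injective h1

/-- A vector of `𝖤` with the prescribed value at `z`. -/
noncomputable def lift {x : M} {z : Circle} (e : E.fib (x, z)) : A.fib x :=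
  (P.surjective x z e).choose

@[simp] lemma ev_lift {x : M} {z : Circle} (e : E.fib (x, z)) : P.ev x z (P.lift e) = e :=
  (P.surjective x z e).choose_spec

lemma isSmoothSecOn_iff {s : ∀ x, A.fib x} : A.IsSmoothSecOn univ s ↔
    E.IsSmoothSecOn univ fun p => P.ev p.1 p.2 (s p.1) := by
  rw [P.sections univ s isOpen_univ, univ_prod_univ]

/-- The section of `E` that corresponds to a section of `𝖤`. -/
noncomputable def toSec (t : A.Sec) : E.Sec :=
  ⟨fun p => P.ev p.1 p.2 (t p.1), P.isSmoothSecOn_iff.1 t.2⟩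

lemma corr_toSec (t : A.Sec) : P.Corr (P.toSec t) t := fun _ _ => rfl

/-- The section of `𝖤` that corresponds to a section of `E`. -/
noncomputable def ofSec (s : E.Sec) : A.Sec :=
  ⟨fun x => ((P.loops x fun z => s (x, z)).1 (s.2.loop x)).choose, P.isSmoothSecOn_iff.2 (by
    have : (fun p : M × Circle => P.ev p.1 p.2
        ((P.loops p.1 fun z => s (p.1, z)).1 (s.2.loop p.1)).choose) = s.1 := by
      funext p
      exact ((P.loops p.1 fun z => s (p.1, z)).1 (s.2.loop p.1)).choose_spec p.2
    rw [this]; exact s.2)⟩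

lemma corr_ofSec (s : E.Sec) : P.Corr s (P.ofSec s) := fun x z =>
  ((P.loops x fun z => s (x, z)).1 (s.2.loop x)).choose_spec z

lemma ev_ofSec (s : E.Sec) (x : M) (z : Circle) : P.ev x z (P.ofSec s x) = s (x, z) :=
  P.corr_ofSec s x z

lemma Corr.left_unique {P : CaloronPairing A E} {s s' : E.Sec} {t : A.Sec} (h : P.Corr s t)
    (h' : P.Corr s' t) : s = s' :=
  Subtype.ext (funext fun p => (h p.1 p.2).symm.trans (h' p.1 p.2))

lemma Corr.right_unique {P : CaloronPairing A E} {s : E.Sec} {t t' : A.Sec} (h : P.Corr s t)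
    (h' : P.Corr s t') : t = t' :=
  Subtype.ext (funext fun x => P.ev_ext fun z => (h x z).trans (h' x z).symm)

lemma Corr.eq_ofSec {P : CaloronPairing A E} {s : E.Sec} {t : A.Sec} (h : P.Corr s t) :
    t = P.ofSec s := h.right_unique (P.corr_ofSec s)

end Fibre

/-! ### Morphisms of bundles that are caloron transforms of each other -/

section Hom
variable (P : CaloronPairing A E) (P' : CaloronPairing A' E')

lemma ev_map_eq_zero {x : M} {z : Circle} (f : A.fib x →ₗ[LC] A'.fib x) {u : A.fib x}
    (hu : P.ev x z u = 0) : P'.ev x z (f u) = 0 := by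
  obtain ⟨ψ, hψ, hx⟩ := A.cover x
  obtain ⟨c, rfl⟩ := (ψ.equivAt hx).surjective u
  have h1 : c.at z = (0 : LV n).at z := (P.ev_eq_zero_iff _ z c).1 hu
  have h2 := P'.ev_linear_congr (f ∘ₗ (ψ.equivAt hx).toLinearMap) h1
  rw [map_zero, P'.ev_zero] at h2
  exact h2

/-- The linear map of fibres of the framed bundles induced by an `LC`-linear map. -/
noncomputable def descend {x : M} {z : Circle} (f : A.fib x →ₗ[LC] A'.fib x) :
    E.fib (x, z) →ₗ[ℂ] E'.fib (x, z) :=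
  have key : ∀ u w : A.fib x, P.ev x z u = P.ev x z w → P'.ev x z (f u) = P'.ev x z (f w) := by
    intro u w h
    rw [← sub_eq_zero, ← P'.ev_sub, ← map_sub]
    exact P.ev_map_eq_zero P' f (by rw [P.ev_sub, h, sub_self])
  { toFun := fun e => P'.ev x z (f (P.lift e))
    map_add' := fun e e' => by
      rw [← P'.map_add, ← _root_.map_add]
      exact key _ _ (by simp [P.map_add])
    map_smul' := fun c e => by
      rw [RingHom.id_apply, ← P'.ev_algebraMap_smul, ← _root_.map_smul]
      exact key _ _ (by simp [P.ev_algebraMap_smul]) }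

lemma descend_ev {x : M} {z : Circle} (f : A.fib x →ₗ[LC] A'.fib x) (v : A.fib x) :
    P.descend P' f (P.ev x z v) = P'.ev x z (f v) := by
  change P'.ev x z (f (P.lift (P.ev x z v))) = _
  rw [← sub_eq_zero, ← P'.ev_sub, ← map_sub]
  exact P.ev_map_eq_zero P' f (by rw [P.ev_sub, P.ev_lift, sub_self])

/-- A morphism of framed bundles is determined by its effect on evaluations. -/
lemma ev_hom_ext {g g' : FrVect.Hom E E'}
    (h : ∀ x z v, g.toEquiv (x, z) (P.ev x z v) = g'.toEquiv (x, z) (P.ev x z v)) : g = g' := by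
  refine FrVect.Hom.ext fun p e => ?_
  obtain ⟨v, rfl⟩ := P.surjective p.1 p.2 e
  exact h p.1 p.2 v

/-- A morphism of `Ω` vector bundles is determined by the evaluations of its values. -/
lemma hom_ev_ext {f f' : OVect.Hom A A'}
    (h : ∀ x z v, P'.ev x z (f.toEquiv x v) = P'.ev x z (f'.toEquiv x v)) : f = f' :=
  OVect.Hom.ext fun x v => P'.ev_ext fun z => h x z v

lemma isSmoothSecOn_descend (f : OVect.Hom A A') (s : E.Sec) : E'.IsSmoothSecOn univ
    fun p => P.descend P' (f.toEquiv p.1).toLinearMap (s p) := by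
  have h := P'.isSmoothSecOn_iff.1 (f.mapSec (P.ofSec s)).2
  refine h.congr fun p _ => ?_
  have h2 : s p = P.ev p.1 p.2 (P.ofSec s p.1) := (P.ev_ofSec s p.1 p.2).symm
  rw [h2, P.descend_ev P']; rfl

variable [IsManifold (𝓡 d) ∞ M] [T2Space M]

/-- The morphism of framed bundles induced by a morphism of `Ω` vector bundles. -/
noncomputable def homFr (f : OVect.Hom A A') : FrVect.Hom E E' where
  toEquiv p := LinearEquiv.ofLinearMap (P.descend P' (f.toEquiv p.1).toLinearMap)
    (P'.descend P (f.toEquiv p.1).symm.toLinearMap)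
    (LinearMap.ext fun e => by
      obtain ⟨v, rfl⟩ := P'.surjective p.1 p.2 e
      exact (congrArg _ (P'.descend_ev P _ v)).trans ((P.descend_ev P' _ _).trans (by simp)))
    (LinearMap.ext fun e => by
      obtain ⟨v, rfl⟩ := P.surjective p.1 p.2 e
      exact (congrArg _ (P.descend_ev P' _ v)).trans ((P'.descend_ev P _ _).trans (by simp)))
  smooth _ hψ _ hψ' := FrVect.readMap_smooth (fun p => P.descend P' (f.toEquiv p.1).toLinearMap)
    (P.isSmoothSecOn_descend P' f) hψ hψ'
  smooth_symm _ hψ _ hψ' := FrVect.readMap_smooth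
    (fun p => P'.descend P (f.toEquiv p.1).symm.toLinearMap)
    (P'.isSmoothSecOn_descend P f.inv) hψ' hψ
  framed x v := by
    obtain ⟨ψ, hψ, hx⟩ := A.cover x
    have h1 : A'.IsFrame x ((ψ.equivAt hx).trans (f.toEquiv x)) := by
      intro ψ' hψ' hx'
      obtain ⟨γ, hγ, h⟩ := f.based ψ hψ ψ' hψ' x ⟨hx, hx'⟩
      refine ⟨γ, hγ, fun v => ?_⟩
      rw [← h, LinearEquiv.trans_apply, ψ.equivAt_apply]; rfl
    rw [← P.framing x _ (OVect.isFrame_equivAt hψ hx), ← P'.framing x _ h1]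
    exact P.descend_ev P' _ _

lemma homFr_ev (f : OVect.Hom A A') (x : M) (z : Circle) (v : A.fib x) :
    (P.homFr P' f).toEquiv (x, z) (P.ev x z v) = P'.ev x z (f.toEquiv x v) :=
  P.descend_ev P' _ v

lemma exists_map_loop (g : FrVect.Hom E E') {x : M} (v : A.fib x) :
    ∃ w : A'.fib x, ∀ z, P'.ev x z w = g.toEquiv (x, z) (P.ev x z v) := by
  obtain ⟨t, rfl⟩ := OVect.exists_sec_eq v
  exact (P'.loops x _).1 ((g.mapSec (P.toSec t)).2.loop x)

/-- The map of fibres of the `Ω` vector bundles induced by a morphism of framed bundles. -/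
noncomputable def ascend (g : FrVect.Hom E E') (x : M) : A.fib x →ₗ[LC] A'.fib x where
  toFun v := (P.exists_map_loop P' g v).choose
  map_add' v w := P'.ev_ext fun z => by
    have h := fun v : A.fib x => (P.exists_map_loop P' g v).choose_spec z
    exact (h (v + w)).trans (by rw [P'.map_add, h, h, P.map_add, _root_.map_add])
  map_smul' f v := P'.ev_ext fun z => by
    have h := fun v : A.fib x => (P.exists_map_loop P' g v).choose_spec z
    exact (h (f • v)).trans (by
      rw [RingHom.id_apply, P'.map_smul, h, P.map_smul, _root_.map_smul])

lemma ev_ascend (g : FrVect.Hom E E') (x : M) (z : Circle) (v : A.fib x) :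
    P'.ev x z (P.ascend P' g x v) = g.toEquiv (x, z) (P.ev x z v) :=
  (P.exists_map_loop P' g v).choose_spec z

lemma isSmoothSecOn_ascend (g : FrVect.Hom E E') (t : A.Sec) :
    A'.IsSmoothSecOn univ fun x => P.ascend P' g x (t x) := by
  refine P'.isSmoothSecOn_iff.2 ((g.mapSec (P.toSec t)).2.congr fun p _ => ?_)
  exact (P.ev_ascend P' g p.1 p.2 (t p.1)).symm

/-- The morphism of `Ω` vector bundles induced by a morphism of framed bundles. -/
noncomputable def homO (g : FrVect.Hom E E') : OVect.Hom A A' :=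
  let e : ∀ x, A.fib x ≃ₗ[LC] A'.fib x := fun x =>
    LinearEquiv.ofLinearMap (P.ascend P' g x) (P'.ascend P g.inv x)
      (LinearMap.ext fun v => P'.ev_ext fun z => by
        rw [LinearMap.comp_apply, ev_ascend, ev_ascend, LinearMap.id_apply]
        exact (g.toEquiv (x, z)).apply_symm_apply _)
      (LinearMap.ext fun v => P.ev_ext fun z => by
        rw [LinearMap.comp_apply, ev_ascend, ev_ascend, LinearMap.id_apply]
        exact (g.toEquiv (x, z)).symm_apply_apply _)
  { toEquiv := e
    smooth := fun _ hψ _ hψ' => OVect.readMap_smooth (P.ascend P' g)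
      (P.isSmoothSecOn_ascend P' g) hψ hψ'
    smooth_symm := fun _ hψ _ hψ' => OVect.readMap_smooth (P'.ascend P g.inv)
      (P'.isSmoothSecOn_ascend P g.inv) hψ' hψ
    based := fun ψ hψ ψ' hψ' x hx => by
      have h1 : A'.IsFrame x ((ψ.equivAt hx.1).trans (e x)) := by
        refine (P'.isFrame_iff _).2 fun v => ?_
        rw [← g.framed, ← P.framing x _ (OVect.isFrame_equivAt hψ hx.1)]
        exact P.ev_ascend P' g x 1 _
      obtain ⟨γ, hγ, h⟩ := h1 ψ' hψ' hx.2
      refine ⟨γ, hγ, fun v => ?_⟩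
      rw [← h, LinearEquiv.trans_apply, ψ.equivAt_apply]; rfl }

lemma ev_homO (g : FrVect.Hom E E') (x : M) (z : Circle) (v : A.fib x) :
    P'.ev x z ((P.homO P' g).toEquiv x v) = g.toEquiv (x, z) (P.ev x z v) :=
  P.ev_ascend P' g x z v

end Hom
end CaloronPairing
end Pairing
end Caloron

/-! ### Associated bundles -/

namespace Caloron

lemma LC.isUnit_of_ne_zero {f : LC} (h : ∀ z, f z ≠ 0) : IsUnit f := by
  have hs : ContMDiff (𝓡 1) 𝓘(ℝ, ℂ) ∞ fun z => (f z)⁻¹ := fun z =>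
    ((contDiffAt_inv ℝ (h z)).contMDiffAt).comp z (f.smooth z)
  refine IsUnit.of_mul_eq_one (LC.mk _ hs) ?_
  ext z
  exact mul_inv_cancel₀ (h z)

section Assoc
variable {d n : ℕ} {M : Type v} [TopologicalSpace M] [ChartedSpace (Eu d) M]
  {A : OVect.{u} d n M} {E : FrVect.{u} d n M}

namespace CaloronPairing
variable (P : CaloronPairing A E)

/-- Two based frames differ by the action of a based loop. -/
lemma exists_act_of_isFrame (P : CaloronPairing A E) {x : M} {p p' : LV n ≃ₗ[LC] A.fib x}
    (hp : A.IsFrame x p) (hp' : A.IsFrame x p') : ∃ γ ∈ OmegaGL n, ∀ u, p' u = p (act γ u) := by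
  obtain ⟨γ, hγ⟩ := exists_act (p'.trans p.symm)
  have h : ∀ u, p' u = p (act γ u) := fun u => by rw [← hγ]; simp
  refine ⟨γ, mem_OmegaGL_iff.2 fun c => (P.frameAt p 1).injective ?_, h⟩
  rw [P.frameAt_at, ← h, ← P.frameAt_at, P.frameAt_apply, P.frameAt_apply, P.framing x p hp,
    P.framing x p' hp']

/-- The bundle `E` of a caloron pairing is associated to the frame bundle of `𝖤`. -/
theorem isAssociated : P.IsAssociated := by
  intro x z
  constructor
  · intro w
    obtain ⟨p, hp⟩ := A.exists_isFrame x
    refine ⟨p, hp, 1, (P.frameAt p z).symm w, ?_⟩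
    rw [Units.val_one, Matrix.one_mulVec, ← P.frameAt_apply, LinearEquiv.apply_symm_apply]
  · intro p p' hp hp' g g' v v'
    have key : ∀ γ : Matrix.GeneralLinearGroup (Fin n) LC, (∀ u, p' u = p (act γ u)) →
        (P.ev x z (p (constLoop (g.1.mulVec v))) = P.ev x z (p' (constLoop (g'.1.mulVec v'))) ↔
          g.1.mulVec v = (Matrix.GeneralLinearGroup.map (n := Fin n) (LC.eval z) γ).1.mulVec
            (g'.1.mulVec v')) := by
      intro γ h
      rw [h, ← P.frameAt_at, ← P.frameAt_at, LV.at_act, LV.at_constLoop, LV.at_constLoop,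
        (P.frameAt p z).injective.eq_iff]
    constructor
    · intro h
      obtain ⟨γ, hγ, hpp⟩ := P.exists_act_of_isFrame hp hp'
      rw [key γ hpp] at h
      set γz := Matrix.GeneralLinearGroup.map (n := Fin n) (LC.eval z) γ
      refine ⟨γ, hγ, g⁻¹ * γz * g', hpp, (by group : g' = γz⁻¹ * g * (g⁻¹ * γz * g')), ?_⟩
      have e : (g⁻¹ * γz * g')⁻¹ = g'⁻¹ * γz⁻¹ * g := by group
      rw [e, Units.val_mul, ← Matrix.mulVec_mulVec, h, Matrix.mulVec_mulVec, Matrix.mulVec_mulVec,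
        ← Units.val_mul, ← Units.val_mul]
      have e' : g'⁻¹ * γz⁻¹ * γz * g' = 1 := by group
      rw [e', Units.val_one, Matrix.one_mulVec]
    · rintro ⟨γ, -, k, hpp, rfl, rfl⟩
      rw [key γ hpp, Matrix.mulVec_mulVec, Matrix.mulVec_mulVec, ← Units.val_mul, ← Units.val_mul]
      congr 2
      group

lemma isLoopFrame_frameAt {x : M} {p : LV n ≃ₗ[LC] A.fib x} (hp : A.IsFrame x p) :
    E.IsLoopFrame x (P.frameAt p) :=
  ⟨fun v => (P.loops x _).2 ⟨p (constLoop v), fun _ => rfl⟩,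
    LinearEquiv.ext fun v => P.framing x p hp v⟩

/-- Every based loop of frames of `E` comes from a based frame of `𝖤`: the matrix that compares it
with a given based frame has nowhere vanishing determinant. -/
lemma exists_isFrame_of_isLoopFrame {x : M} {q : ∀ z : Circle, (Fin n → ℂ) ≃ₗ[ℂ] E.fib (x, z)}
    (hq : E.IsLoopFrame x q) : ∃ p, A.IsFrame x p ∧ ∀ z, P.frameAt p z = q z := by
  choose b hb using fun j => (P.loops x _).1 (hq.1 (Pi.single j 1))
  obtain ⟨p₀, hp₀⟩ := A.exists_isFrame x
  -- `L` is the frame sought; `C` is its matrix with respect to `p₀`.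
  let L : LV n →ₗ[LC] A.fib x := Fintype.linearCombination LC b
  have hL : ∀ c z, P.ev x z (L c) = q z (c.at z) := by
    intro c z
    rw [P.ev_linear L c z]
    conv_rhs => rw [sum_single_complex (c.at z), map_sum]
    refine Finset.sum_congr rfl fun j _ => ?_
    rw [_root_.map_smul, ← hb j z]
    congr 2
    simp [L, Fintype.linearCombination_apply, Pi.single_apply]
  let C : Matrix (Fin n) (Fin n) LC := LinearMap.toMatrix' (p₀.symm.toLinearMap ∘ₗ L)
  have hC : ∀ c, C.mulVec c = p₀.symm (L c) := fun c => LinearMap.toMatrix'_mulVec _ c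
  have hCz : ∀ z w, (C.map (LC.eval z)).mulVec w = (P.frameAt p₀ z).symm (q z w) := by
    intro z w
    rw [LinearEquiv.eq_symm_apply]
    have h1 : (C.map (LC.eval z)).mulVec w = LV.at (C.mulVec (constLoop w)) z := by
      funext i
      change ∑ j, C i j z * w j = LC.eval z (∑ j, C i j * constLoop w j)
      rw [map_sum]; rfl
    rw [h1, P.frameAt_at, hC, LinearEquiv.apply_symm_apply, hL]; rfl
  have hdet : IsUnit C.det := by
    refine LC.isUnit_of_ne_zero fun z hz => ?_
    have h1 : (C.map (LC.eval z)).det = 0 := by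
      rw [← RingHom.mapMatrix_apply, ← RingHom.map_det]; exact hz
    obtain ⟨w, hw, h2⟩ := Matrix.exists_mulVec_eq_zero_iff.2 h1
    rw [hCz, LinearEquiv.map_eq_zero_iff, LinearEquiv.map_eq_zero_iff] at h2
    exact hw h2
  let γ : Matrix.GeneralLinearGroup (Fin n) LC := Matrix.GeneralLinearGroup.mk'' C hdet
  have hp : ∀ c, (actEquiv γ).trans p₀ c = L c := by
    intro c
    change p₀ (C.mulVec c) = L c
    rw [hC, LinearEquiv.apply_symm_apply]
  refine ⟨(actEquiv γ).trans p₀, (P.isFrame_iff _).2 fun v => ?_,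
    fun z => LinearEquiv.ext fun w => ?_⟩
  · rw [hp, hL, hq.2]; rfl
  · rw [P.frameAt_apply, hp, hL]; rfl

/-- The bundle `𝖤` of a caloron pairing is associated to the bundle of based loops of frames of
`E`. -/
theorem isLoopAssociated : P.IsLoopAssociated := by
  intro x
  refine ⟨fun w => ?_, fun q hq v => ?_, fun q q' hq hq' v v' => ?_⟩
  · obtain ⟨p, hp⟩ := A.exists_isFrame x
    refine ⟨P.frameAt p, P.isLoopFrame_frameAt hp, p.symm w, fun z => ?_⟩
    have := P.frameAt_at p z (p.symm w)
    rw [LinearEquiv.apply_symm_apply] at this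
    exact this.symm
  · obtain ⟨p, -, h⟩ := P.exists_isFrame_of_isLoopFrame hq
    exact ⟨p v, fun z => by rw [← h, ← P.frameAt_at]; rfl⟩
  · obtain ⟨p, hp, h⟩ := P.exists_isFrame_of_isLoopFrame hq
    obtain ⟨p', hp', h'⟩ := P.exists_isFrame_of_isLoopFrame hq'
    have h1 : (∀ z, q z (fun i => v i z) = q' z fun i => v' i z) ↔ p v = p' v' := by
      simp only [← h, ← h']
      constructor
      · intro e
        exact P.ev_ext fun z => by
          rw [← P.frameAt_at, ← P.frameAt_at]; exact e z
      · intro e z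
        exact (P.frameAt_at p z v).trans ((congrArg (P.ev x z) e).trans (P.frameAt_at p' z v').symm)
    have h2 : ∀ γ : Matrix.GeneralLinearGroup (Fin n) LC, (∀ z w, q' z w =
          q z ((Matrix.GeneralLinearGroup.map (n := Fin n) (LC.eval z) γ).1.mulVec w)) ↔
        ∀ u, p' u = p (act γ u) := by
      intro γ
      simp only [← h, ← h']
      constructor
      · intro e u
        exact P.ev_ext fun z => by
          rw [← P.frameAt_at, ← P.frameAt_at, e, LV.at_act]
      · intro e z w
        have := P.frameAt_at p' z (constLoop w)
        rw [e, ← P.frameAt_at, LV.at_act, LV.at_constLoop] at this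
        exact this
    rw [h1]
    constructor
    · intro e
      obtain ⟨γ, hγ, hpp⟩ := P.exists_act_of_isFrame hp hp'
      refine ⟨γ, hγ, (h2 γ).2 hpp, ?_⟩
      rw [hpp, p.injective.eq_iff] at e
      rw [e, ← act_mul, inv_mul_cancel, act_one]
    · rintro ⟨γ, -, hq, rfl⟩
      rw [(h2 γ).1 hq, ← act_mul, mul_inv_cancel, act_one]

end CaloronPairing
end Assoc
end Caloron

/-! ### General position -/

namespace Caloron

section GeneralPosition
open MeasureTheory
variable {K : Type} [Fintype K] [DecidableEq K] {n : ℕ}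

/-- A parametrisation of the tuples `B` for which `∑ l, W k l t * B l` is singular for some `t`,
because its column `j` is a linear combination of the other columns. The parameters are a tuple of
matrices: the matrices with index different from `k` are those of `B`, and in the `k`-th matrix the
columns different from `j` are those of the singular matrix, while the column `j` stores the
coefficients of the linear combination and, in the diagonal entry, the parameter `t`. As `t` is
real, the parameters lie in a hyperplane. -/
noncomputable def singularParam (c : K → ℝ → ℂ) (W : K → K → ℝ → Matrix (Fin n) (Fin n) ℂ) (k : K)
    (j : Fin n) (b : K → Fin n → Fin n → ℂ) : K → Fin n → Fin n → ℂ := fun l i m =>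
  if l = k then (c k (b k j j).re)⁻¹ *
    ((if m = j then ∑ m' ∈ Finset.univ.erase j, b k m' j * b k i m' else b k i m)
      - ∑ l ∈ Finset.univ.erase k, ∑ i', W k l (b k j j).re i i' * b l i' m)
  else b l i m

/-- The image of a hyperplane under a differentiable self-map is a null set. -/
lemma measure_singularParam [MeasurableSpace (K → Fin n → Fin n → ℂ)]
    [BorelSpace (K → Fin n → Fin n → ℂ)] (μ : Measure (K → Fin n → Fin n → ℂ)) [μ.IsAddHaarMeasure]
    (c : K → ℝ → ℂ) (W : K → K → ℝ → Matrix (Fin n) (Fin n) ℂ)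
    (hc : ∀ k t, c k t ≠ 0 → DifferentiableAt ℝ (c k) t)
    (hW : ∀ k l t i m, c k t ≠ 0 → DifferentiableAt ℝ (fun t => W k l t i m) t) (k : K)
    (j : Fin n) : μ (singularParam c W k j ''
      {b | (b k j j).im = 0 ∧ c k (b k j j).re ≠ 0}) = 0 := by
  refine addHaar_image_eq_zero_of_differentiableOn_of_addHaar_eq_zero _ ?_ ?_
  · rintro b ⟨-, hb⟩
    refine DifferentiableAt.differentiableWithinAt ?_
    have hentry : ∀ l i m, DifferentiableAt ℝ (fun b : K → Fin n → Fin n → ℂ => b l i m) b := by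
      intro l i m; fun_prop
    have ht : DifferentiableAt ℝ (fun b : K → Fin n → Fin n → ℂ => (b k j j).re) b :=
      Complex.reCLM.differentiableAt.comp b (hentry k j j)
    have hc' : DifferentiableAt ℝ (fun b : K → Fin n → Fin n → ℂ => c k (b k j j).re) b :=
      DifferentiableAt.comp b (hc k _ hb) ht
    have hW' : ∀ l i i', DifferentiableAt ℝ
        (fun b : K → Fin n → Fin n → ℂ => W k l (b k j j).re i i') b := fun l i i' =>
      DifferentiableAt.comp (g := fun t => W k l t i i') b (hW k l _ i i' hb) ht
    refine differentiableAt_pi.2 fun l => differentiableAt_pi.2 fun i => differentiableAt_pi.2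
      fun m => ?_
    unfold singularParam
    by_cases hl : l = k
    · simp only [hl, if_true]
      refine (hc'.inv hb).mul (DifferentiableAt.sub ?_ ?_)
      · by_cases hm : m = j
        · simp only [hm, if_true]
          exact DifferentiableAt.fun_sum fun m' _ => (hentry _ _ _).mul (hentry _ _ _)
        · simp only [hm, if_false]
          exact hentry _ _ _
      · exact DifferentiableAt.fun_sum fun l _ => DifferentiableAt.fun_sum fun i' _ =>
          (hW' l i i').mul (hentry _ _ _)
    · simp only [hl, if_false]
      exact hentry _ _ _
  · let L : (K → Fin n → Fin n → ℂ) →ₗ[ℝ] ℝ := Complex.imLm ∘ₗ (LinearMap.proj j) ∘ₗ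
      (LinearMap.proj (R := ℝ) (φ := fun _ : Fin n => Fin n → ℂ) j) ∘ₗ
      (LinearMap.proj (R := ℝ) (φ := fun _ : K => Fin n → Fin n → ℂ) k)
    refine measure_mono_null (t := (LinearMap.ker L : Set (K → Fin n → Fin n → ℂ)))
      (fun b hb => hb.1) (Measure.addHaar_submodule _ _ fun h => ?_)
    have h1 : (fun _ _ _ => Complex.I : K → Fin n → Fin n → ℂ) ∈ LinearMap.ker L := by
      rw [h]; trivial
    have h2 : Complex.I.im = 0 := h1
    simp at h2

/-- There is a tuple `B` of matrices such that the matrices `∑ l, W k l t * B l` are invertible for all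
`k` and `t` with `c k t ≠ 0`. In fact almost every tuple has this property: the singular matrices form
a set of real codimension `2`, and there is only one real parameter. -/
theorem exists_nonsingular (c : K → ℝ → ℂ) (W : K → K → ℝ → Matrix (Fin n) (Fin n) ℂ)
    (hc : ∀ k t, c k t ≠ 0 → DifferentiableAt ℝ (c k) t)
    (hW : ∀ k l t i m, c k t ≠ 0 → DifferentiableAt ℝ (fun t => W k l t i m) t)
    (hWc : ∀ k t, W k k t = c k t • (1 : Matrix (Fin n) (Fin n) ℂ)) :
    ∃ B : K → Matrix (Fin n) (Fin n) ℂ, ∀ k t, c k t ≠ 0 → (∑ l, W k l t * B l).det ≠ 0 := by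
  let _ : MeasurableSpace (K → Fin n → Fin n → ℂ) := borel _
  have _ : BorelSpace (K → Fin n → Fin n → ℂ) := ⟨rfl⟩
  by_contra! H
  have hcover : (univ : Set (K → Fin n → Fin n → ℂ)) ⊆ ⋃ k : K, ⋃ j : Fin n,
      singularParam c W k j '' {b | (b k j j).im = 0 ∧ c k (b k j j).re ≠ 0} := by
    intro B _
    obtain ⟨k, t, ht, hdet⟩ := H fun l => Matrix.of (B l)
    set S : Matrix (Fin n) (Fin n) ℂ := ∑ l, W k l t * Matrix.of (B l) with hS
    obtain ⟨w, hw, hSw⟩ := Matrix.exists_mulVec_eq_zero_iff.2 hdet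
    obtain ⟨j, hj⟩ := Function.ne_iff.1 hw
    have hj : w j ≠ 0 := hj
    -- As `w j ≠ 0`, column `j` of `S` is a combination of the other columns.
    have hcol : ∀ i, ∑ m ∈ Finset.univ.erase j, (-(w m / w j)) * S i m = S i j := by
      intro i
      have h1 : ∑ m, S i m * w m = 0 := congrFun hSw i
      rw [← Finset.add_sum_erase _ _ (Finset.mem_univ j)] at h1
      have h2 : ∑ m ∈ Finset.univ.erase j, (-(w m / w j)) * S i m
          = -(w j)⁻¹ * ∑ m ∈ Finset.univ.erase j, S i m * w m := by
        rw [Finset.mul_sum]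
        exact Finset.sum_congr rfl fun m _ => by rw [div_eq_mul_inv]; ring
      rw [h2, eq_neg_of_add_eq_zero_right h1]
      field_simp
    simp only [mem_iUnion]
    refine ⟨k, j, fun l i m => if l = k then (if m = j then (if i = j then (t : ℂ)
      else -(w i / w j)) else S i m) else B l i m, ⟨by simp, by simpa using ht⟩, ?_⟩
    funext l i m
    unfold singularParam
    by_cases hl : l = k
    · subst hl
      simp only [if_true, Complex.ofReal_re]
      have h1 : (if m = j then ∑ m' ∈ Finset.univ.erase j, (if m' = j then (t : ℂ)
          else -(w m' / w j)) * (if m' = j then (if i = j then (t : ℂ) else -(w i / w j))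
            else S i m') else if m = j then (if i = j then (t : ℂ) else -(w i / w j)) else S i m)
          = S i m := by
        by_cases hm : m = j
        · simp only [hm, if_true]
          rw [← hcol i]
          exact Finset.sum_congr rfl fun m' hm' => by simp [Finset.ne_of_mem_erase hm']
        · simp only [hm, if_false]
      have h2 : ∑ l' ∈ Finset.univ.erase l, ∑ i', W l l' t i i' * (if l' = l then (if m = j then
          (if i' = j then (t : ℂ) else -(w i' / w j)) else S i' m) else B l' i' m)
          = S i m - c l t * B l i m := by
        have h3 : S i m = ∑ l', ∑ i', W l l' t i i' * B l' i' m := by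
          simp [hS, Matrix.sum_apply, Matrix.mul_apply]
        rw [h3, ← Finset.add_sum_erase _ _ (Finset.mem_univ l), hWc]
        simp only [Matrix.smul_apply, Matrix.one_apply, smul_eq_mul, mul_ite, mul_one, mul_zero,
          ite_mul, zero_mul, Finset.sum_ite_eq, Finset.mem_univ, if_true, add_sub_cancel_left]
        exact Finset.sum_congr rfl fun l' hl' => by
          simp [Finset.ne_of_mem_erase hl']
      rw [h1, h2, sub_sub_cancel, inv_mul_cancel_left₀ ht]
    · simp only [hl, if_false]
  have hnull : (Measure.addHaar : Measure (K → Fin n → Fin n → ℂ))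
      (univ : Set (K → Fin n → Fin n → ℂ)) = 0 :=
    measure_mono_null hcover (measure_iUnion_null fun k => measure_iUnion_null fun j =>
      measure_singularParam Measure.addHaar c W hc hW k j)
  exact isOpen_univ.measure_ne_zero Measure.addHaar univ_nonempty hnull

end GeneralPosition

/-! ### Smooth solutions of linear systems -/

section Cramer
variable {n : ℕ} {E H N : Type*} [NormedAddCommGroup E] [NormedSpace ℝ E]
    [TopologicalSpace H] {I : ModelWithCorners ℝ E H} [TopologicalSpace N] [ChartedSpace H N]

lemma contMDiffOn_det {R : N → Matrix (Fin n) (Fin n) ℂ} {U : Set N}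
    (hR : ∀ i j, ContMDiffOn I 𝓘(ℝ, ℂ) ∞ (fun x => R x i j) U) :
    ContMDiffOn I 𝓘(ℝ, ℂ) ∞ (fun x => (R x).det) U := by
  have h : ContDiff ℝ ∞ fun m : Fin n → Fin n → ℂ => (Matrix.of m).det := by
    simp only [Matrix.det_apply]
    refine ContDiff.sum fun σ _ => ContDiff.const_smul _ (contDiff_prod fun i _ => ?_)
    exact contDiff_apply_apply ℝ ℂ (σ i) i
  refine h.contMDiff.comp_contMDiffOn (f := fun x i j => R x i j) ?_
  exact contMDiffOn_pi_space.2 fun i => contMDiffOn_pi_space.2 fun j => hR i j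

/-- Cramer's rule: the solution of a linear system with smooth coefficients is smooth. -/
lemma contMDiffOn_of_mulVec {R : N → Matrix (Fin n) (Fin n) ℂ} {c a : N → Fin n → ℂ} {U : Set N}
    (hR : ∀ i j, ContMDiffOn I 𝓘(ℝ, ℂ) ∞ (fun x => R x i j) U)
    (hc : ContMDiffOn I 𝓘(ℝ, Fin n → ℂ) ∞ c U) (hdet : ∀ x ∈ U, (R x).det ≠ 0)
    (h : ∀ x ∈ U, (R x).mulVec (a x) = c x) : ContMDiffOn I 𝓘(ℝ, Fin n → ℂ) ∞ a U := by
  have hc' := contMDiffOn_pi_space.1 hc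
  have h1 : ContMDiffOn I 𝓘(ℝ, Fin n → ℂ) ∞ (fun x => (R x).cramer (c x)) U := by
    refine contMDiffOn_pi_space.2 fun i => ?_
    simp only [Matrix.cramer_apply]
    refine contMDiffOn_det fun i' j => ?_
    by_cases hj : j = i
    · subst hj; simpa only [Matrix.updateCol_self] using hc' i'
    · simpa only [Matrix.updateCol_ne hj] using hR i' j
  have h2 : ContMDiffOn I 𝓘(ℝ, ℂ) ∞ (fun x => ((R x).det)⁻¹) U := fun x hx =>
    (contDiffAt_inv ℝ (hdet x hx)).contMDiffAt.comp_contMDiffWithinAt x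
      (contMDiffOn_det hR x hx)
  refine (contMDiffOn_smul_complex h2 h1).congr fun x hx => ?_
  have h3 : (R x).mulVec ((R x).det⁻¹ • (R x).cramer (c x)) = c x := by
    rw [Matrix.mulVec_smul, Matrix.mulVec_cramer, smul_smul, inv_mul_cancel₀ (hdet x hx), one_smul]
  have h4 := Matrix.mulVec_injective_iff_isUnit.2
    ((Matrix.isUnit_iff_isUnit_det _).2 (hdet x hx).isUnit)
  exact h4 ((h x hx).trans h3.symm)

end Cramer
end Caloron

/-! ### Smooth families of frames and the existence of loops of frames -/

namespace Caloron
namespace FrVect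
variable {d n : ℕ} {M : Type v} [TopologicalSpace M] [ChartedSpace (Eu d) M] {E : FrVect.{u} d n M}

lemma bijective_iff_det_ne_zero {ψ : LocalTriv ℂ (Fin n → ℂ) E.fib} {p : M × Circle}
    (hp : p ∈ ψ.base) (L : (Fin n → ℂ) →ₗ[ℂ] E.fib p) :
    Function.Bijective L ↔ (LinearMap.toMatrix' (ψ.coord p ∘ₗ L)).det ≠ 0 := by
  have h1 : Function.Bijective L ↔ Function.Bijective (ψ.coord p ∘ₗ L) := by
    have h2 : ψ.coord p = ((ψ.equivAt hp).symm : E.fib p →ₗ[ℂ] (Fin n → ℂ)) :=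
      LinearMap.ext fun v => (ψ.equivAt_symm_apply hp v).symm
    rw [h2]
    exact (EquivLike.comp_bijective L (ψ.equivAt hp).symm).symm
  rw [h1, LinearMap.det_toMatrix', ← isUnit_iff_ne_zero, ← LinearMap.isUnit_iff_isUnit_det,
    Module.End.isUnit_iff]

/-- The matrices of a smooth family of linear maps depend smoothly on the point. -/
lemma contMDiffOn_toMatrix {W : Set (M × Circle)} {q : ∀ p, (Fin n → ℂ) →ₗ[ℂ] E.fib p}
    (hq : ∀ v, E.IsSmoothSecOn W fun p => q p v) {ψ : LocalTriv ℂ (Fin n → ℂ) E.fib}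
    (hψ : ψ ∈ E.atlas) (i j : Fin n) : ContMDiffOn (MI d) 𝓘(ℝ, ℂ) ∞
      (fun p => LinearMap.toMatrix' (ψ.coord p ∘ₗ q p) i j) (W ∩ ψ.base) := by
  refine (contMDiffOn_pi_space.1 (hq (Pi.single j 1) ψ hψ) i).congr fun p _ => ?_
  rw [LinearMap.toMatrix'_apply]; rfl

lemma eventually_bijective {W : Set (M × Circle)} (hW : IsOpen W)
    {q : ∀ p, (Fin n → ℂ) →ₗ[ℂ] E.fib p} (hq : ∀ v, E.IsSmoothSecOn W fun p => q p v)
    {p : M × Circle} (hp : p ∈ W) (hb : Function.Bijective (q p)) :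
    ∀ᶠ p' in 𝓝 p, Function.Bijective (q p') := by
  obtain ⟨ψ, hψ, hpψ⟩ := E.cover p
  have hU := hW.inter (E.isOpen ψ hψ)
  have h1 := (contMDiffOn_det (contMDiffOn_toMatrix hq hψ)).continuousOn.continuousAt
    (hU.mem_nhds ⟨hp, hpψ⟩)
  filter_upwards [h1.eventually_ne ((bijective_iff_det_ne_zero hpψ _).1 hb),
    (E.isOpen ψ hψ).mem_nhds hpψ] with p' h2 h3
  exact (bijective_iff_det_ne_zero h3 _).2 h2

/-- The coordinates of a smooth section with respect to a smooth family of frames are smooth. -/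
lemma contMDiffOn_coordinates {W : Set (M × Circle)}
    {q : ∀ p, (Fin n → ℂ) →ₗ[ℂ] E.fib p} (hq : ∀ v, E.IsSmoothSecOn W fun p => q p v)
    (hb : ∀ p ∈ W, Function.Bijective (q p)) {s : ∀ p, E.fib p} (hs : E.IsSmoothSecOn W s)
    {c : M × Circle → Fin n → ℂ} (hc : ∀ p ∈ W, q p (c p) = s p) :
    ContMDiffOn (MI d) 𝓘(ℝ, Fin n → ℂ) ∞ c W := by
  refine contMDiffOn_of_locally_contMDiffOn fun p hp => ?_
  obtain ⟨ψ, hψ, hpψ⟩ := E.cover p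
  refine ⟨ψ.base, E.isOpen ψ hψ, hpψ, contMDiffOn_of_mulVec (contMDiffOn_toMatrix hq hψ) (hs ψ hψ)
    (fun p hp => (bijective_iff_det_ne_zero hp.2 _).1 (hb p hp.1)) fun p hp => ?_⟩
  rw [LinearMap.toMatrix'_mulVec, LinearMap.comp_apply, hc p hp.1]

lemma isSmoothSecOn_combination {W : Set (M × Circle)} {q : ∀ p, (Fin n → ℂ) →ₗ[ℂ] E.fib p}
    (hq : ∀ v, E.IsSmoothSecOn W fun p => q p v) {c : M × Circle → Fin n → ℂ}
    (hc : ContMDiffOn (MI d) 𝓘(ℝ, Fin n → ℂ) ∞ c W) : E.IsSmoothSecOn W fun p => q p (c p) := by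
  refine (IsSmoothSecOn.sum Finset.univ fun j _ =>
    (hq (Pi.single j 1)).smul (contMDiffOn_pi_space.1 hc j)).congr fun p _ => ?_
  conv_rhs => rw [sum_single_complex (c p), map_sum]
  exact Finset.sum_congr rfl fun j _ => by rw [map_smul]

/-- Near a circle there is a smooth family of frames: a generic combination of local frames, cut off
by bump functions on the circle, is a frame at every point of the circle. -/
lemma exists_frames (x₀ : M) : ∃ U : Set M, IsOpen U ∧ x₀ ∈ U ∧
    ∃ q : ∀ p, (Fin n → ℂ) →ₗ[ℂ] E.fib p, (∀ v, E.IsSmoothSecOn (U ×ˢ univ) fun p => q p v) ∧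
      ∀ p ∈ U ×ˢ (univ : Set Circle), Function.Bijective (q p) := by
  classical
  choose ψ hψ hbase using fun z : Circle => E.cover (x₀, z)
  have hopen : ∀ w, IsOpen {z : Circle | (x₀, z) ∈ (ψ w).base} := fun w =>
    (E.isOpen _ (hψ w)).preimage (by fun_prop)
  choose χ hχ hχ1 hsupp using fun w : Circle => exists_bump (𝓡 1) (hopen w) (hbase w)
  obtain ⟨S, -, hS⟩ := isCompact_univ.elim_nhds_subcover (fun w => {z | χ w z = 1})
    fun w _ => hχ1 w
  have hcover : ∀ z, ∃ k : S, χ k z ≠ 0 := fun z => by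
    obtain ⟨w, hw, hz⟩ := mem_iUnion₂.1 (hS (mem_univ z))
    exact ⟨⟨w, hw⟩, by rw [show χ w z = 1 from hz]; exact one_ne_zero⟩
  -- The supports of the bump functions lie in the domains of the frames for all `x` near `x₀`.
  have hnear : ∀ᶠ x in 𝓝 x₀, ∀ k : S, ∀ z ∈ tsupport (χ k), (x, z) ∈ (ψ k).base := by
    refine eventually_all.2 fun k => ?_
    refine (isClosed_tsupport _).isCompact.eventually_forall_of_forall_eventually fun z hz => ?_
    exact (E.isOpen _ (hψ k)).mem_nhds (hsupp k hz)
  obtain ⟨U₁, hU₁, hU₁o, hx₁⟩ := eventually_nhds_iff.1 hnear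
  have hterm : ∀ (k : S) (v : Fin n → ℂ),
      E.IsSmoothSecOn (U₁ ×ˢ univ) fun p => (χ k p.2 : ℂ) • (ψ k).frame p v := by
    intro k v
    refine isSmoothSecOn_bump (χ := fun p => χ k p.2) (E.isOpen _ (hψ k))
      (isSmoothSecOn_frame (hψ k) inter_subset_left contMDiffOn_const) (hU₁o.prod isOpen_univ)
      ((hχ k).comp contMDiff_snd) ?_
    rintro p ⟨h1, h2⟩
    exact hU₁ p.1 h2.1 k p.2 (tsupport_comp_subset_preimage (χ k) continuous_snd h1)
  have hin : ∀ (k : S) z, χ k z ≠ 0 → (x₀, z) ∈ (ψ k).base := fun k z h =>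
    hU₁ x₀ hx₁ k z (subset_tsupport _ h)
  have hexp : ContMDiff 𝓘(ℝ, ℝ) (MI d) ∞ fun t : ℝ => (x₀, Circle.exp t) :=
    contMDiff_const.prodMk contMDiff_circleExp
  -- `W k l` is the transition matrix from the frame `l` to the frame `k`, cut off by `χ l`. It is
  -- smooth only where the frame `k` is defined, in particular where `χ k` does not vanish.
  let W : S → S → ℝ → Matrix (Fin n) (Fin n) ℂ := fun k l t => (χ l (Circle.exp t) : ℂ) •
    LinearMap.toMatrix' ((ψ k).coord (x₀, Circle.exp t) ∘ₗ (ψ l).frame (x₀, Circle.exp t))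
  obtain ⟨B, hB⟩ := exists_nonsingular (fun (k : S) t => (χ k (Circle.exp t) : ℂ)) W
    (fun k t _ => ((contMDiff_ofReal (hχ k)).comp contMDiff_circleExp).contDiff.differentiable
      (by simp) t)
    (fun k l t i m hk => by
      have h1 := contMDiffOn_pi_space.1 (hterm l (Pi.single m 1) (ψ k) (hψ k)) i
      have h2 := h1.contMDiffAt (x := (x₀, Circle.exp t))
        (((hU₁o.prod isOpen_univ).inter (E.isOpen _ (hψ k))).mem_nhds
          ⟨⟨hx₁, mem_univ _⟩, hin k _ fun h => hk (by simp [h])⟩)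
      have h3 := (h2.comp t hexp.contMDiffAt).contDiffAt.differentiableAt (by simp)
      refine h3.congr_of_eventuallyEq (Eventually.of_forall fun t => ?_)
      simp only [W, Matrix.smul_apply, LinearMap.toMatrix'_apply, Function.comp, map_smul]
      rfl)
    (fun k t => by
      by_cases hk : χ k (Circle.exp t) = 0
      · simp [W, hk]
      · have h1 : (ψ k).coord (x₀, Circle.exp t) ∘ₗ (ψ k).frame (x₀, Circle.exp t)
            = LinearMap.id := LinearMap.ext fun v => (ψ k).coord_frame (hin k _ hk) v
        simp only [W, h1, LinearMap.toMatrix'_id])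
  let q : ∀ p, (Fin n → ℂ) →ₗ[ℂ] E.fib p := fun p =>
    ∑ l : S, (χ l p.2 : ℂ) • ((ψ l).frame p ∘ₗ Matrix.mulVecLin (B l))
  have hq : ∀ v, E.IsSmoothSecOn (U₁ ×ˢ univ) fun p => q p v := fun v => by
    refine (IsSmoothSecOn.sum (Finset.univ : Finset S) fun l _ =>
      hterm l ((B l).mulVec v)).congr fun p _ => ?_
    simp [q, LinearMap.sum_apply]
  have hbij : ∀ z, Function.Bijective (q (x₀, z)) := by
    intro z
    obtain ⟨k, hk⟩ := hcover z
    obtain ⟨t, rfl⟩ : ∃ t, Circle.exp t = z := ⟨_, (exists_angle z).choose_spec.2 z⟩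
    rw [bijective_iff_det_ne_zero (hin k _ hk)]
    convert hB k t (by simpa using hk) using 2
    have h1 : (ψ k).coord (x₀, Circle.exp t) ∘ₗ q (x₀, Circle.exp t)
        = ∑ l : S, (χ l (Circle.exp t) : ℂ) • (((ψ k).coord (x₀, Circle.exp t) ∘ₗ
          (ψ l).frame (x₀, Circle.exp t)) ∘ₗ Matrix.mulVecLin (B l)) := by
      ext v
      simp [q]
    rw [h1, map_sum]
    refine Finset.sum_congr rfl fun l _ => ?_
    rw [map_smul, LinearMap.toMatrix'_comp, Matrix.smul_mul]
    congr 2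
    exact LinearMap.toMatrix'_toLin' (B l)
  -- By compactness of the circle, invertibility persists on nearby circles.
  have hev : ∀ᶠ x in 𝓝 x₀, ∀ z ∈ (univ : Set Circle), Function.Bijective (q (x, z)) :=
    isCompact_univ.eventually_forall_of_forall_eventually fun z _ =>
      eventually_bijective (hU₁o.prod isOpen_univ) hq ⟨hx₁, mem_univ z⟩ (hbij z)
  obtain ⟨U₂, hU₂, hU₂o, hx₂⟩ := eventually_nhds_iff.1 hev
  exact ⟨U₁ ∩ U₂, hU₁o.inter hU₂o, ⟨hx₁, hx₂⟩, q, fun v => (hq v).mono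
    (prod_mono inter_subset_left subset_rfl), fun p hp => hU₂ p.1 hp.1.2 p.2 (mem_univ _)⟩

/-- Near every circle there is a smooth family of frames that extends the framing. -/
theorem exists_loopFrames (x₀ : M) : ∃ U : Set M, IsOpen U ∧ x₀ ∈ U ∧
    ∃ q : ∀ p, (Fin n → ℂ) →ₗ[ℂ] E.fib p, (∀ v, E.IsSmoothSecOn (U ×ˢ univ) fun p => q p v) ∧
      (∀ p ∈ U ×ˢ (univ : Set Circle), Function.Bijective (q p)) ∧
      ∀ x ∈ U, ∀ v, q (x, 1) v = E.framing x v := by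
  classical
  obtain ⟨U, hU, hx₀, q, hq, hb⟩ := exists_frames (E := E) x₀
  have hb1 : ∀ x ∈ U, Function.Bijective (q (x, 1)) := fun x hx => hb (x, 1) ⟨hx, mem_univ _⟩
  -- The change of frames over the base point.
  let a : M → (Fin n → ℂ) →ₗ[ℂ] (Fin n → ℂ) := fun x => if h : Function.Bijective (q (x, 1)) then
    (LinearEquiv.ofBijective (q (x, 1)) h).symm.toLinearMap ∘ₗ (E.framing x).toLinearMap else 0
  have ha : ∀ x ∈ U, ∀ v, q (x, 1) (a x v) = E.framing x v := fun x hx v => by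
    simp only [a, hb1 x hx, dif_pos]
    exact (LinearEquiv.ofBijective (q (x, 1)) (hb1 x hx)).apply_symm_apply _
  have hab : ∀ x ∈ U, Function.Bijective (a x) := fun x hx => by
    simp only [a, hb1 x hx, dif_pos]
    exact ((E.framing x).trans (LinearEquiv.ofBijective (q (x, 1)) (hb1 x hx)).symm).bijective
  have hι : ContMDiff (𝓡 d) (MI d) ∞ fun x : M => (x, (1 : Circle)) :=
    contMDiff_id.prodMk contMDiff_const
  have hsm : ∀ v, ContMDiffOn (𝓡 d) 𝓘(ℝ, Fin n → ℂ) ∞ (fun x => a x v) U := fun v => by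
    refine contMDiffOn_of_locally_contMDiffOn fun x hx => ?_
    obtain ⟨ψ, hψ, hxψ⟩ := E.cover (x, 1)
    refine ⟨{y | (y, 1) ∈ ψ.base}, (E.isOpen ψ hψ).preimage hι.continuous, hxψ,
      contMDiffOn_of_mulVec (R := fun x => LinearMap.toMatrix' (ψ.coord (x, 1) ∘ₗ q (x, 1)))
        (fun i j => (contMDiffOn_toMatrix hq hψ i j).comp hι.contMDiffOn
          fun y hy => ⟨⟨hy.1, mem_univ _⟩, hy.2⟩)
        ((E.framing_smooth ψ hψ v).mono inter_subset_right)
        (fun y hy => (bijective_iff_det_ne_zero hy.2 _).1 (hb1 y hy.1)) fun y hy => ?_⟩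
    rw [LinearMap.toMatrix'_mulVec, LinearMap.comp_apply, ha y hy.1]
  refine ⟨U, hU, hx₀, fun p => q p ∘ₗ a p.1, fun v => isSmoothSecOn_combination hq
    (c := fun p => a p.1 v) ((hsm v).comp contMDiffOn_fst fun p hp => hp.1),
    fun p hp => (hb p hp).comp (hab p.1 hp.1), fun x hx v => ha x hx v⟩

end FrVect
end Caloron

/-! ### The caloron transform of a bundle -/

namespace Caloron
namespace OVect
variable {d n : ℕ} {M : Type v} [TopologicalSpace M] [ChartedSpace (Eu d) M] (A : OVect.{u} d n M)

variable {A} in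
/-- Vanishing at a point of the circle may be tested in one based trivialisation. -/
lemma vanishes_iff {ψ : LocalTriv LC (LV n) A.fib} (hψ : ψ ∈ A.atlas) {x : M} (hx : x ∈ ψ.base)
    {z : Circle} {v : A.fib x} : A.Vanishes x z v ↔ (ψ.coord x v).at z = 0 := by
  refine ⟨fun h => funext fun i => h ψ hψ hx i, fun h ψ' hψ' hx' i => ?_⟩
  obtain ⟨γ, -, hγ⟩ := A.trans_based ψ hψ ψ' hψ' x ⟨hx, hx'⟩
  have h1 : ψ'.coord x v = act γ (ψ.coord x v) := by
    rw [← hγ, readMap, ψ.frame_coord hx]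
  have h2 : (ψ'.coord x v).at z = 0 := by rw [h1, LV.at_act, h, Matrix.mulVec_zero]
  exact congrFun h2 i

/-- The vectors of the fibre over `x` that vanish at the point `z` of the circle. -/
def vanishing (x : M) (z : Circle) : Submodule LC (A.fib x) where
  carrier := {v | A.Vanishes x z v}
  add_mem' {v w} hv hw ψ hψ hx i := by
    rw [map_add, Pi.add_apply, LC.add_apply, hv ψ hψ hx i, hw ψ hψ hx i, add_zero]
  zero_mem' ψ hψ hx i := by rw [map_zero]; rfl
  smul_mem' f v hv ψ hψ hx i := by
    rw [map_smul, Pi.smul_apply, smul_eq_mul, LC.mul_apply, hv ψ hψ hx i, mul_zero]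

/-- The fibre over `(x, z)` of the caloron transform: the vectors over `x`, modulo those that vanish
at `z`. -/
def CaloronFib (p : M × Circle) : Type u := A.fib p.1 ⧸ A.vanishing p.1 p.2

noncomputable instance (p : M × Circle) : AddCommGroup (A.CaloronFib p) :=
  inferInstanceAs (AddCommGroup (A.fib p.1 ⧸ A.vanishing p.1 p.2))

noncomputable instance (p : M × Circle) : Module ℂ (A.CaloronFib p) :=
  Module.compHom (A.fib p.1 ⧸ A.vanishing p.1 p.2) (algebraMap ℂ LC)

variable {A}

/-- The class of a vector: its value at `z`. -/
noncomputable def toCaloronFib (x : M) (z : Circle) (v : A.fib x) : A.CaloronFib (x, z) :=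
  (Submodule.Quotient.mk v : A.fib x ⧸ A.vanishing x z)

lemma toCaloronFib_add (x : M) (z : Circle) (v w : A.fib x) :
    toCaloronFib x z (v + w) = toCaloronFib x z v + toCaloronFib x z w := rfl

lemma toCaloronFib_eq_iff {x : M} {z : Circle} {v w : A.fib x} :
    toCaloronFib x z v = toCaloronFib x z w ↔ A.Vanishes x z (v - w) :=
  Submodule.Quotient.eq (A.vanishing x z)

lemma toCaloronFib_smul (x : M) (z : Circle) (f : LC) (v : A.fib x) :
    toCaloronFib x z (f • v) = f z • toCaloronFib x z v := by
  change toCaloronFib x z (f • v) = toCaloronFib x z (algebraMap ℂ LC (f z) • v)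
  rw [toCaloronFib_eq_iff, ← sub_smul]
  intro ψ hψ hx i
  rw [map_smul, Pi.smul_apply, smul_eq_mul, LC.mul_apply]
  have h : (f - algebraMap ℂ LC (f z)) z = 0 := sub_self (f z)
  rw [h, zero_mul]

lemma toCaloronFib_surjective (x : M) (z : Circle) :
    Function.Surjective (toCaloronFib (A := A) x z) := Submodule.Quotient.mk_surjective _

lemma toCaloronFib_eq_zero {x : M} {z : Circle} {v : A.fib x} :
    toCaloronFib x z v = 0 ↔ A.Vanishes x z v :=
  Submodule.Quotient.mk_eq_zero (A.vanishing x z)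

/-- The coordinates of the value at `z` with respect to a based trivialisation. -/
noncomputable def coordAt (ψ : LocalTriv LC (LV n) A.fib) (x : M) (z : Circle) :
    A.fib x →ₛₗ[LC.eval z] (Fin n → ℂ) where
  toFun v := (ψ.coord x v).at z
  map_add' v w := by rw [map_add]; rfl
  map_smul' f v := by rw [map_smul]; rfl

/-- The trivialisation of the caloron transform induced by a based trivialisation. -/
noncomputable def caloronTriv (ψ : A.atlas) : LocalTriv ℂ (Fin n → ℂ) A.CaloronFib where
  base := ψ.1.base ×ˢ univ
  triv p hp :=
    let Q : (A.fib p.1 ⧸ A.vanishing p.1 p.2) →ₛₗ[LC.eval p.2] (Fin n → ℂ) :=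
      (A.vanishing p.1 p.2).liftQ (coordAt ψ.1 p.1 p.2) fun _ hv => (vanishes_iff ψ.2 hp.1).1 hv
    let L : A.CaloronFib p →ₗ[ℂ] (Fin n → ℂ) :=
      { toFun := Q
        map_add' := Q.map_add
        map_smul' := fun c v => Q.map_smulₛₗ (algebraMap ℂ LC c) v }
    LinearEquiv.ofBijective L ⟨by
      rw [← LinearMap.ker_eq_bot, LinearMap.ker_eq_bot']
      intro v hv
      obtain ⟨v, rfl⟩ := toCaloronFib_surjective p.1 p.2 v
      exact toCaloronFib_eq_zero.2 ((vanishes_iff ψ.2 hp.1).2 hv),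
      fun w => ⟨toCaloronFib p.1 p.2 (ψ.1.frame p.1 (constLoop w)), by
        change (ψ.1.coord p.1 (ψ.1.frame p.1 (constLoop w))).at p.2 = w
        rw [ψ.1.coord_frame hp.1, LV.at_constLoop]⟩⟩

lemma caloronTriv_coord (ψ : A.atlas) {x : M} (hx : x ∈ ψ.1.base) (z : Circle) (v : A.fib x) :
    (caloronTriv ψ).coord (x, z) (toCaloronFib x z v) = (ψ.1.coord x v).at z := by
  have h : (x, z) ∈ (caloronTriv ψ).base := ⟨hx, mem_univ z⟩
  simp only [LocalTriv.coord, h, dif_pos]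
  rfl

lemma caloronTriv_frame (ψ : A.atlas) {x : M} (hx : x ∈ ψ.1.base) (z : Circle) (w : Fin n → ℂ) :
    (caloronTriv ψ).frame (x, z) w = toCaloronFib x z (ψ.1.frame x (constLoop w)) := by
  have h : (x, z) ∈ (caloronTriv ψ).base := ⟨hx, mem_univ z⟩
  have h1 := caloronTriv_coord ψ hx z (ψ.1.frame x (constLoop w))
  rw [ψ.1.coord_frame hx, LV.at_constLoop] at h1
  exact (congrArg ((caloronTriv ψ).frame (x, z)) h1.symm).trans (LocalTriv.frame_coord _ h _)

lemma caloronTriv_ext (ψ : A.atlas) {x : M} (hx : x ∈ ψ.1.base) {z : Circle}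
    {e e' : A.CaloronFib (x, z)}
    (h : (caloronTriv ψ).coord (x, z) e = (caloronTriv ψ).coord (x, z) e') : e = e' := by
  have hz : (x, z) ∈ (caloronTriv ψ).base := ⟨hx, mem_univ z⟩
  rw [← LocalTriv.frame_coord _ hz e, h, LocalTriv.frame_coord _ hz e']

/-- A loop of vectors that is smooth in a trivialisation comes from a vector of the bundle of
loops. -/
lemma exists_toCaloronFib_eq (ψ : A.atlas) {x : M} (hx : x ∈ ψ.1.base)
    {σ : ∀ z, A.CaloronFib (x, z)} (h : ContMDiff (𝓡 1) 𝓘(ℝ, Fin n → ℂ) ∞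
      fun z => (caloronTriv ψ).coord (x, z) (σ z)) : ∃ v, ∀ z, toCaloronFib x z v = σ z := by
  refine ⟨ψ.1.frame x fun i => LC.mk _ (contMDiff_pi_space.1 h i),
    fun z => caloronTriv_ext ψ hx ?_⟩
  rw [caloronTriv_coord _ hx, LocalTriv.coord_frame _ hx]
  rfl

lemma contMDiff_toCaloronFib (ψ : A.atlas) {x : M} (hx : x ∈ ψ.1.base) (v : A.fib x) :
    ContMDiff (𝓡 1) 𝓘(ℝ, Fin n → ℂ) ∞
      fun z => (caloronTriv ψ).coord (x, z) (toCaloronFib x z v) := by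
  refine contMDiff_pi_space.2 fun i => (ψ.1.coord x v i).smooth.congr fun z => ?_
  rw [caloronTriv_coord ψ hx]; rfl

/-- A based trivialisation over a given point. -/
noncomputable def trivAt (x : M) : A.atlas := ⟨(A.cover x).choose, (A.cover x).choose_spec.1⟩

lemma mem_trivAt (x : M) : x ∈ (trivAt (A := A) x).1.base := (A.cover x).choose_spec.2

/-- The framing of the caloron transform. -/
noncomputable def caloronFraming (x : M) : (Fin n → ℂ) ≃ₗ[ℂ] A.CaloronFib (x, 1) :=
  (caloronTriv (trivAt x)).equivAt (show (x, 1) ∈ (caloronTriv (trivAt x)).base from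
    ⟨mem_trivAt x, mem_univ _⟩)

lemma caloronFraming_apply (x : M) (v : Fin n → ℂ) : caloronFraming (A := A) x v
    = toCaloronFib x 1 ((trivAt x).1.frame x (constLoop v)) :=
  (LocalTriv.equivAt_apply _ _ v).trans (caloronTriv_frame _ (mem_trivAt x) 1 v)

/-- The framing is given by the values at the base point of any based frame. -/
lemma toCaloronFib_isFrame {x : M} {p : LV n ≃ₗ[LC] A.fib x} (hp : A.IsFrame x p)
    (v : Fin n → ℂ) : toCaloronFib x 1 (p (constLoop v)) = caloronFraming x v := by
  have hx := mem_trivAt (A := A) x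
  rw [caloronFraming_apply, toCaloronFib_eq_iff,
    vanishes_iff (trivAt x).2 hx, map_sub, LocalTriv.coord_frame _ hx]
  obtain ⟨γ, hγ, h⟩ := hp _ (trivAt x).2 hx
  rw [h]
  funext i
  have h1 := congrFun (mem_OmegaGL_iff.1 hγ (constLoop v)) i
  exact sub_eq_zero.2 h1

variable [IsManifold (𝓡 d) ∞ M]

variable (A) in
/-- The caloron transform of an `Ω` vector bundle. -/
noncomputable def caloron : FrVect.{u} d n M where
  fib := A.CaloronFib
  atlas := range caloronTriv
  isOpen := by
    rintro _ ⟨ψ, rfl⟩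
    exact (A.isOpen _ ψ.2).prod isOpen_univ
  cover p := ⟨_, ⟨trivAt p.1, rfl⟩, mem_trivAt p.1, mem_univ _⟩
  trans_smooth := by
    rintro _ ⟨ψ, rfl⟩ _ ⟨ψ', rfl⟩
    refine contMDiffOn_linear
      (fun p _ => ⟨(caloronTriv ψ').coord p ∘ₗ (caloronTriv ψ).frame p, fun v => rfl⟩) fun j => ?_
    have hU := (A.isOpen _ ψ.2).inter (A.isOpen _ ψ'.2)
    have h1 := (fsmoothM_iff_LV hU).1
      ((A.trans_smooth _ ψ.2 _ ψ'.2).apply hU (constLoop (Pi.single j 1)))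
    refine (h1.mono fun p hp => ⟨⟨hp.1.1, hp.2.1⟩, mem_univ _⟩).congr fun p hp => ?_
    rw [readMap]
    refine (congrArg ((caloronTriv ψ').coord p) (caloronTriv_frame ψ hp.1.1 p.2 _)).trans ?_
    exact caloronTriv_coord ψ' hp.2.1 p.2 _
  framing := caloronFraming
  framing_smooth := by
    rintro _ ⟨ψ, rfl⟩ v
    refine (contMDiffOn_const (c := v)).congr fun x hx => ?_
    have hx' : x ∈ ψ.1.base := hx.1
    rw [← toCaloronFib_isFrame (isFrame_equivAt ψ.2 hx'), caloronTriv_coord ψ hx',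
      LocalTriv.equivAt_apply, LocalTriv.coord_frame _ hx', LV.at_constLoop]

variable (A) in
/-- Evaluation at the points of the circle relates a bundle to its caloron transform. -/
noncomputable def caloronPairing : CaloronPairing A A.caloron where
  ev := toCaloronFib
  map_add := toCaloronFib_add
  map_smul := toCaloronFib_smul
  ev_eq_zero _ _ _ := toCaloronFib_eq_zero
  surjective := toCaloronFib_surjective
  loops x σ := by
    constructor
    · intro h
      have hx := mem_trivAt (A := A) x
      have h1 := h _ ⟨trivAt x, rfl⟩
      have h2 : {z : Circle | (x, z) ∈ (caloronTriv (trivAt (A := A) x)).base} = univ :=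
        eq_univ_of_forall fun z => ⟨hx, mem_univ z⟩
      rw [h2, contMDiffOn_univ] at h1
      exact exists_toCaloronFib_eq _ hx h1
    · rintro ⟨v, hv⟩ _ ⟨ψ, rfl⟩
      by_cases hx : x ∈ ψ.1.base
      · obtain rfl : (fun z => toCaloronFib x z v) = σ := funext hv
        exact (contMDiff_toCaloronFib ψ hx v).contMDiffOn
      · exact fun z hz => absurd hz.1 hx
  sections U s hU := by
    have key : ∀ ψ : A.atlas, FSmoothM d (U ∩ ψ.1.base) (fun x => ψ.1.coord x (s x)) ↔
        ContMDiffOn (MI d) 𝓘(ℝ, Fin n → ℂ) ∞ (fun p : M × Circle =>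
          (caloronTriv ψ).coord p (toCaloronFib p.1 p.2 (s p.1)))
          (U ×ˢ univ ∩ (caloronTriv ψ).base) := fun ψ => by
      have h1 : U ×ˢ univ ∩ (caloronTriv ψ).base = (U ∩ ψ.1.base) ×ˢ univ := by
        rw [caloronTriv, prod_inter_prod, univ_inter]
      rw [fsmoothM_iff_LV (hU.inter (A.isOpen _ ψ.2)), h1]
      exact contMDiffOn_congr fun p hp => (caloronTriv_coord ψ hp.1.2 p.2 (s p.1)).symm
    constructor
    · rintro h _ ⟨ψ, rfl⟩
      exact (key ψ).1 (h _ ψ.2)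
    · intro h ψ hψ
      exact (key ⟨ψ, hψ⟩).2 (h _ ⟨⟨ψ, hψ⟩, rfl⟩)
  framing x p hp v := toCaloronFib_isFrame hp v

end OVect
end Caloron

/-! ### The inverse caloron transform of a bundle -/

namespace Caloron
namespace FrVect
variable {d n : ℕ} {M : Type v} [TopologicalSpace M] [ChartedSpace (Eu d) M] (E : FrVect.{u} d n M)

/-- The fibre over `x` of the inverse caloron transform: the smooth sections along `{x} × S¹`. -/
def LoopFib (x : M) : Type u := {σ : ∀ z : Circle, E.fib (x, z) // E.IsSmoothLoop x σ}

variable {E}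

lemma LoopFib.ext {x : M} {σ τ : E.LoopFib x} (h : ∀ z, σ.1 z = τ.1 z) : σ = τ :=
  Subtype.ext (funext h)

variable (E) in
/-- Smooth sections along `{x} × S¹` as a subgroup of all sections. -/
def loopSubgroup (x : M) : AddSubgroup (∀ z : Circle, E.fib (x, z)) where
  carrier := {σ | E.IsSmoothLoop x σ}
  add_mem' {σ τ} hσ hτ ψ hψ := ((hσ ψ hψ).add (hτ ψ hψ)).congr fun z _ => by
    rw [Pi.add_apply, map_add]; rfl
  zero_mem' ψ _ := contMDiffOn_const.congr fun z _ => by rw [Pi.zero_apply, map_zero]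
  neg_mem' {σ} hσ ψ hψ := (hσ ψ hψ).neg.congr fun z _ => by
    rw [Pi.neg_apply, map_neg]

noncomputable instance (x : M) : AddCommGroup (E.LoopFib x) :=
  inferInstanceAs (AddCommGroup (E.loopSubgroup x))

noncomputable instance (x : M) : SMul LC (E.LoopFib x) :=
  ⟨fun f σ => ⟨fun z => f z • σ.1 z, fun ψ hψ =>
    (contMDiffOn_smul_complex f.smooth.contMDiffOn (σ.2 ψ hψ)).congr fun z _ => by rw [map_smul]⟩⟩

noncomputable instance (x : M) : Module LC (E.LoopFib x) where
  one_smul σ := LoopFib.ext fun z => one_smul ℂ (σ.1 z)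
  mul_smul f g σ := LoopFib.ext fun z => mul_smul (f z) (g z) (σ.1 z)
  smul_zero f := LoopFib.ext fun z => smul_zero (f z)
  smul_add f σ τ := LoopFib.ext fun z => smul_add (f z) (σ.1 z) (τ.1 z)
  add_smul f g σ := LoopFib.ext fun z => add_smul (f z) (g z) (σ.1 z)
  zero_smul σ := LoopFib.ext fun z => zero_smul ℂ (σ.1 z)

lemma IsSmoothSecOn.loop_of_mem {U : Set M} {s : ∀ p, E.fib p} (hs : E.IsSmoothSecOn (U ×ˢ univ) s)
    {x : M} (hx : x ∈ U) : E.IsSmoothLoop x fun z => s (x, z) := fun ψ hψ =>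
  (hs ψ hψ).comp (contMDiffOn_const.prodMk contMDiffOn_id) fun _ hz => ⟨⟨hx, mem_univ _⟩, hz⟩

variable (E) in
/-- A smooth family of frames of `E` over `U × S¹` that extends the framing, i.e. a smooth local
section of the bundle of loops of frames. -/
structure LoopFrames where
  base : Set M
  isOpen : IsOpen base
  q : ∀ p, (Fin n → ℂ) →ₗ[ℂ] E.fib p
  smooth : ∀ v, E.IsSmoothSecOn (base ×ˢ univ) fun p => q p v
  bijective : ∀ p ∈ base ×ˢ (univ : Set Circle), Function.Bijective (q p)
  framing : ∀ x ∈ base, ∀ v, q (x, 1) v = E.framing x v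

namespace LoopFrames
variable (F F' : E.LoopFrames)

lemma bijective' {x : M} (hx : x ∈ F.base) (z : Circle) : Function.Bijective (F.q (x, z)) :=
  F.bijective (x, z) ⟨hx, mem_univ z⟩

lemma contMDiff_at (c : LV n) (U : Set (M × Circle)) :
    ContMDiffOn (MI d) 𝓘(ℝ, Fin n → ℂ) ∞ (fun p : M × Circle => c.at p.2) U :=
  contMDiffOn_pi_space.2 fun i => ((c i).smooth.comp contMDiff_snd).contMDiffOn

/-- The section along `{x} × S¹` with given coordinates. -/
noncomputable def toLoop {x : M} (hx : x ∈ F.base) : LV n →ₗ[LC] E.LoopFib x where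
  toFun c := ⟨fun z => F.q (x, z) (c.at z),
    (isSmoothSecOn_combination F.smooth (contMDiff_at c _)).loop_of_mem hx⟩
  map_add' c c' := LoopFib.ext fun z => (F.q (x, z)).map_add (c.at z) (c'.at z)
  map_smul' f c := LoopFib.ext fun z => (F.q (x, z)).map_smul (f z) (c.at z)

lemma toLoop_bijective {x : M} (hx : x ∈ F.base) : Function.Bijective (F.toLoop hx) := by
  constructor
  · intro c c' h
    funext i
    ext z
    have h1 : F.q (x, z) (c.at z) = F.q (x, z) (c'.at z) :=
      congrArg (fun σ : E.LoopFib x => σ.1 z) h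
    exact congrFun ((F.bijective' hx z).1 h1) i
  · intro σ
    choose a ha using fun z => (F.bijective' hx z).2 (σ.1 z)
    have hsm : ContMDiff (𝓡 1) 𝓘(ℝ, Fin n → ℂ) ∞ a := by
      rw [← contMDiffOn_univ]
      refine contMDiffOn_of_locally_contMDiffOn fun z _ => ?_
      obtain ⟨ψ, hψ, hz⟩ := E.cover (x, z)
      refine ⟨{z | (x, z) ∈ ψ.base}, (E.isOpen ψ hψ).preimage (by fun_prop), hz, ?_⟩
      refine contMDiffOn_of_mulVec
        (R := fun z => LinearMap.toMatrix' (ψ.coord (x, z) ∘ₗ F.q (x, z)))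
        (fun i j => (contMDiffOn_toMatrix F.smooth hψ i j).comp
          (contMDiffOn_const.prodMk contMDiffOn_id) fun w hw => ⟨⟨hx, mem_univ _⟩, hw.2⟩)
        ((σ.2 ψ hψ).mono inter_subset_right)
        (fun w hw => (bijective_iff_det_ne_zero hw.2 _).1 (F.bijective' hx w)) fun w hw => ?_
      rw [LinearMap.toMatrix'_mulVec, LinearMap.comp_apply, ha]
    exact ⟨fun i => LC.mk _ (contMDiff_pi_space.1 hsm i), LoopFib.ext ha⟩

/-- The based trivialisation given by a smooth family of loops of frames. -/
noncomputable def triv : LocalTriv LC (LV n) E.LoopFib where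
  base := F.base
  triv _ hx := (LinearEquiv.ofBijective (F.toLoop hx) (F.toLoop_bijective hx)).symm

lemma triv_frame {x : M} (hx : x ∈ F.base) (c : LV n) (z : Circle) :
    (F.triv.frame x c).1 z = F.q (x, z) (c.at z) := by
  have h : x ∈ F.triv.base := hx
  simp only [LocalTriv.frame, h, dif_pos]
  rfl

lemma triv_coord {x : M} (hx : x ∈ F.base) (σ : E.LoopFib x) (z : Circle) :
    F.q (x, z) ((F.triv.coord x σ).at z) = σ.1 z := by
  rw [← F.triv_frame hx, F.triv.frame_coord hx]

variable (E) in
lemma exists_mem (x : M) : ∃ F : E.LoopFrames, x ∈ F.base := by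
  obtain ⟨U, hU, hx, q, h1, h2, h3⟩ := exists_loopFrames (E := E) x
  exact ⟨⟨U, hU, q, h1, h2, h3⟩, hx⟩

lemma isSmoothSecOn_iff [IsManifold (𝓡 d) ∞ M] {U : Set M} (hU : IsOpen U)
    (s : ∀ x, E.LoopFib x) : FSmoothM d (U ∩ F.base) (fun x => F.triv.coord x (s x)) ↔
      E.IsSmoothSecOn ((U ∩ F.base) ×ˢ univ) fun p => (s p.1).1 p.2 := by
  have hsub : (U ∩ F.base) ×ˢ (univ : Set Circle) ⊆ F.base ×ˢ univ :=
    prod_mono inter_subset_right subset_rfl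
  have h2 : ∀ p ∈ (U ∩ F.base) ×ˢ (univ : Set Circle),
      F.q p ((F.triv.coord p.1 (s p.1)).at p.2) = (s p.1).1 p.2 := fun p hp =>
    F.triv_coord hp.1.2 (s p.1) p.2
  rw [fsmoothM_iff_LV (hU.inter F.isOpen)]
  constructor
  · intro h
    exact (isSmoothSecOn_combination (fun v => (F.smooth v).mono hsub) h).congr h2
  · intro h
    exact contMDiffOn_coordinates (fun v => (F.smooth v).mono hsub)
      (fun p hp => F.bijective p (hsub hp)) h h2

end LoopFrames

variable [IsManifold (𝓡 d) ∞ M]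

variable (E) in
/-- The inverse caloron transform of a framed vector bundle. -/
noncomputable def invCaloron : OVect.{u} d n M where
  fib := E.LoopFib
  atlas := range LoopFrames.triv
  isOpen := by
    rintro _ ⟨F, rfl⟩
    exact F.isOpen
  cover x := by
    obtain ⟨F, hF⟩ := LoopFrames.exists_mem E x
    exact ⟨_, ⟨F, rfl⟩, hF⟩
  trans_smooth := by
    rintro _ ⟨F, rfl⟩ _ ⟨F', rfl⟩
    refine fsmoothMF_linear (F.isOpen.inter F'.isOpen)
      (fun x _ => ⟨F'.triv.coord x ∘ₗ F.triv.frame x, fun v => rfl⟩) fun j => ?_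
    refine (F'.isSmoothSecOn_iff F.isOpen fun x => F.triv.frame x (Pi.single j 1)).2 ?_
    refine ((isSmoothSecOn_combination F.smooth (LoopFrames.contMDiff_at (Pi.single j 1) _)).mono
      (prod_mono inter_subset_left subset_rfl)).congr fun p hp => ?_
    exact (F.triv_frame hp.1.1 _ p.2).symm
  trans_based := by
    rintro _ ⟨F, rfl⟩ _ ⟨F', rfl⟩ x ⟨hx, hx'⟩
    obtain ⟨γ, hγ⟩ := exists_act ((F.triv.equivAt hx).trans (F'.triv.equivAt hx').symm)
    have hγ' : ∀ c, F'.triv.coord x (F.triv.frame x c) = act γ c := fun c => by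
      rw [← hγ, LinearEquiv.trans_apply, LocalTriv.equivAt_symm_apply, LocalTriv.equivAt_apply]
    refine ⟨γ, mem_OmegaGL_iff.2 fun c => (F'.bijective' hx' 1).1 ?_, hγ'⟩
    rw [← hγ', F'.triv_coord hx', F.triv_frame hx, F.framing x hx, F'.framing x hx']

variable (E) in
/-- Evaluation of loops relates a bundle to its inverse caloron transform. -/
noncomputable def invCaloronPairing : CaloronPairing E.invCaloron E where
  ev _ z σ := σ.1 z
  map_add _ _ _ _ := rfl
  map_smul _ _ _ _ := rfl
  ev_eq_zero x z σ := by
    have key : ∀ F : E.LoopFrames, x ∈ F.base → (σ.1 z = 0 ↔ (F.triv.coord x σ).at z = 0) :=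
      fun F hx => by
        have h := F.triv_coord hx σ z
        constructor
        · intro h0
          refine (F.bijective' hx z).1 ?_
          rw [map_zero]
          exact h.trans h0
        · intro h0
          refine h.symm.trans ?_
          rw [h0, map_zero]
    constructor
    · rintro h _ ⟨F, rfl⟩ hx i
      exact congrFun ((key F hx).1 h) i
    · intro h
      obtain ⟨F, hx⟩ := LoopFrames.exists_mem E x
      exact (key F hx).2 (funext fun i => h _ ⟨F, rfl⟩ hx i)
  surjective x z e := by
    obtain ⟨F, hx⟩ := LoopFrames.exists_mem E x
    obtain ⟨w, hw⟩ := (F.bijective' hx z).2 e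
    exact ⟨F.toLoop hx (constLoop w), hw⟩
  loops x σ := ⟨fun h => ⟨⟨σ, h⟩, fun _ => rfl⟩, fun ⟨τ, h⟩ => by
    obtain rfl : (fun z => τ.1 z) = σ := funext h
    exact τ.2⟩
  sections U s hU := by
    constructor
    · intro h
      refine isSmoothSecOn_of_local fun p hp => ?_
      obtain ⟨F, hx⟩ := LoopFrames.exists_mem E p.1
      refine ⟨F.base ×ˢ univ, F.isOpen.prod isOpen_univ, ⟨hx, mem_univ _⟩, ?_⟩
      rw [prod_inter_prod, univ_inter]
      exact (F.isSmoothSecOn_iff hU s).1 (h _ ⟨F, rfl⟩)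
    · rintro h _ ⟨F, rfl⟩
      exact (F.isSmoothSecOn_iff hU s).2 (h.mono (prod_mono inter_subset_left subset_rfl))
  framing x p hp v := by
    obtain ⟨F, hx⟩ := LoopFrames.exists_mem E x
    obtain ⟨γ, hγ, h⟩ := hp _ ⟨F, rfl⟩ hx
    refine (F.triv_coord hx (p (constLoop v)) 1).symm.trans ?_
    rw [← F.framing x hx]
    refine congrArg (F.q (x, 1)) ?_
    exact (congrArg (fun c : LV n => c.at 1) (h (constLoop v))).trans
      (mem_OmegaGL_iff.1 hγ (constLoop v))

end FrVect
end Caloron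

/-! ### Vector fields on `M` and on `M × S¹` -/

namespace Caloron

variable {d : ℕ} {M : Type v} [TopologicalSpace M] [ChartedSpace (Eu d) M]
  [IsManifold (𝓡 d) ∞ M]

/-- A vector field on `M × S¹` that is given by smooth vector fields along the two factors. -/
lemma contMDiff_pairVec {N : Type v} [TopologicalSpace N] {E H : Type} [NormedAddCommGroup E]
    [NormedSpace ℝ E] [TopologicalSpace H] {I : ModelWithCorners ℝ E H} [ChartedSpace H N]
    {h : N → M} {k : N → Circle} {X : ∀ q, TangentSpace (𝓡 d) (h q)}
    {ξ : ∀ q, TangentSpace (𝓡 1) (k q)}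
    (hX : ContMDiff I (𝓡 d).tangent ∞ fun q => (⟨h q, X q⟩ : TangentBundle (𝓡 d) M))
    (hξ : ContMDiff I (𝓡 1).tangent ∞ fun q => (⟨k q, ξ q⟩ : TangentBundle (𝓡 1) Circle)) :
    ContMDiff I (MI d).tangent ∞
      fun q => (⟨(h q, k q), pairVec (X q) (ξ q)⟩ : TangentBundle (MI d) (M × Circle)) :=
  contMDiff_equivTangentBundleProd_symm.comp (hX.prodMk hξ)

lemma contMDiff_horizontalField {X : ∀ x : M, TangentSpace (𝓡 d) x} (hX : IsSmoothField d X) :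
    ContMDiff (MI d) (MI d).tangent ∞ fun p : M × Circle =>
      (⟨p, pairVec (X p.1) (0 : TangentSpace (𝓡 1) p.2)⟩ : TangentBundle (MI d) (M × Circle)) :=
  contMDiff_pairVec (hX.comp contMDiff_fst)
    ((Bundle.contMDiff_zeroSection ℝ (TangentSpace (𝓡 1) : Circle → Type)).comp contMDiff_snd)

/-- The vector field `∂/∂θ` on the circle is smooth. -/
lemma contMDiff_angVec :
    ContMDiff (𝓡 1) (𝓡 1).tangent ∞ fun z => (⟨z, angVec z⟩ : TangentBundle (𝓡 1) Circle) := by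
  -- `∂/∂θ` is the image of `(0, d/dt)` at `(z, 0)` under the tangent map of `(z, t) ↦ z e^{it}`.
  let F : Circle × ℝ → Circle := fun q => q.1 * Circle.exp q.2
  have hF : ContMDiff ((𝓡 1).prod 𝓘(ℝ, ℝ)) (𝓡 1) ∞ F :=
    contMDiff_fst.mul (contMDiff_circleExp.comp contMDiff_snd)
  have h1 : ContMDiff (𝓡 1) ((𝓡 1).prod 𝓘(ℝ, ℝ)).tangent ∞ fun z : Circle =>
      (⟨(z, 0), ((0 : Eu 1), (1 : ℝ))⟩ : TangentBundle ((𝓡 1).prod 𝓘(ℝ, ℝ)) (Circle × ℝ)) :=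
    contMDiff_equivTangentBundleProd_symm.comp
      ((Bundle.contMDiff_zeroSection ℝ (TangentSpace (𝓡 1) : Circle → Type)).prodMk
        (contMDiff_const (c := (⟨0, (1 : ℝ)⟩ : TangentBundle 𝓘(ℝ, ℝ) ℝ))))
  have h2 := (hF.contMDiff_tangentMap (m := ∞) (by simp)).comp h1
  refine h2.congr fun z => ?_
  have hcast : ∀ (w : Circle) (ξ : Eu 1), w = z →
      (⟨z, ξ⟩ : TangentBundle (𝓡 1) Circle) = ⟨w, ξ⟩ := by rintro _ _ rfl; rfl
  refine (hcast (z * Circle.exp 0) _ (by simp)).trans ?_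
  have h3 : MDifferentiableAt ((𝓡 1).prod 𝓘(ℝ, ℝ)) (𝓡 1) F (z, 0) :=
    hF.mdifferentiableAt (by simp)
  have h4 := mfderiv_prod_eq_add_apply (v := (((0 : Eu 1), (1 : ℝ)) :
    TangentSpace ((𝓡 1).prod 𝓘(ℝ, ℝ)) (z, (0 : ℝ)))) h3
  refine congrArg (fun ξ : Eu 1 => (⟨z * Circle.exp 0, ξ⟩ : TangentBundle (𝓡 1) Circle)) ?_
  refine Eq.trans ?_ h4.symm
  refine Eq.symm ((congrArg₂ (· + ·) (ContinuousLinearMap.map_zero _) rfl).trans (zero_add _))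

lemma contMDiff_verticalField :
    ContMDiff (MI d) (MI d).tangent ∞ fun p : M × Circle =>
      (⟨p, pairVec (0 : TangentSpace (𝓡 d) p.1) (angVec p.2)⟩ :
        TangentBundle (MI d) (M × Circle)) :=
  contMDiff_pairVec
    ((Bundle.contMDiff_zeroSection ℝ (TangentSpace (𝓡 d) : M → Type)).comp contMDiff_fst)
    (contMDiff_angVec.comp contMDiff_snd)

/-- The components of a smooth vector field on `M × S¹`. -/
lemma contMDiff_fstField {X : ∀ p : M × Circle, TangentSpace (MI d) p}
    (hX : ContMDiff (MI d) (MI d).tangent ∞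
      fun p => (⟨p, X p⟩ : TangentBundle (MI d) (M × Circle))) :
    ContMDiff (MI d) (𝓡 d).tangent ∞ fun p : M × Circle =>
      (⟨p.1, (X p : Eu d × Eu 1).1⟩ : TangentBundle (𝓡 d) M) :=
  contMDiff_fst.comp (contMDiff_equivTangentBundleProd.comp hX)

lemma contMDiff_angForm {X : ∀ p : M × Circle, TangentSpace (MI d) p}
    (hX : ContMDiff (MI d) (MI d).tangent ∞
      fun p => (⟨p, X p⟩ : TangentBundle (MI d) (M × Circle))) :
    ContMDiff (MI d) 𝓘(ℝ, ℝ) ∞ fun p : M × Circle => angForm p.2 (X p : Eu d × Eu 1).2 := by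
  have h1 : ContMDiff (MI d) (𝓡 1).tangent ∞ fun p : M × Circle =>
      (⟨p.2, (X p : Eu d × Eu 1).2⟩ : TangentBundle (𝓡 1) Circle) :=
    contMDiff_snd.comp (contMDiff_equivTangentBundleProd.comp hX)
  have h2 : ContMDiff (MI d) 𝓘(ℝ, ℂ) ∞ fun p : M × Circle =>
      dFun (𝓡 1) (fun w : Circle => (w : ℂ)) p.2 (X p : Eu d × Eu 1).2 :=
    (contMDiff_snd_tangentBundle_modelSpace ℂ 𝓘(ℝ, ℂ)).comp
      ((contMDiff_coe_circle.contMDiff_tangentMap (m := ∞) (by simp)).comp h1)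
  have h3 : ContMDiff (MI d) 𝓘(ℝ, ℂ) ∞ fun p : M × Circle => ((p.2)⁻¹ : Circle).1 :=
    contMDiff_coe_circle.comp (contMDiff_snd.inv)
  have h4 : ContDiff ℝ ∞ fun w : ℂ × ℂ => (w.1 * w.2).im :=
    Complex.imCLM.contDiff.comp (contDiff_fst.mul contDiff_snd)
  refine (h4.contMDiff.comp (h2.prodMk_space h3)).congr fun p => ?_
  have h5 (a : ℂ) (z : Circle) : (a / z).im = (a * ((z⁻¹ : Circle) : ℂ)).im := by
    rw [div_eq_mul_inv, ← Circle.coe_inv]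
  exact h5 _ p.2

lemma IsSmoothField.sum {ι : Type} (S : Finset ι) {Y : ι → ∀ x : M, TangentSpace (𝓡 d) x}
    (hY : ∀ i, IsSmoothField d (Y i)) (c : ι → ℝ) :
    IsSmoothField d fun x => ∑ i ∈ S, c i • Y i x := by
  classical
  induction S using Finset.induction_on with
  | empty =>
    simp only [Finset.sum_empty]
    exact Bundle.contMDiff_zeroSection ℝ (TangentSpace (𝓡 d) : M → Type)
  | insert i S hi ih =>
    simp only [Finset.sum_insert hi]
    exact ((hY i).const_smul_section (a := c i)).add_section ih

variable [T2Space M]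

/-- Global vector fields that form a frame of the tangent bundle near a point, with smooth
coefficient functions. -/
lemma exists_localFields (x₀ : M) : ∃ (W : Set M) (Y : Fin d → ∀ x : M, TangentSpace (𝓡 d) x)
    (a : Fin d → ∀ x : M, TangentSpace (𝓡 d) x → ℝ), IsOpen W ∧ x₀ ∈ W ∧
    (∀ i, IsSmoothField d (Y i)) ∧ (∀ x ∈ W, ∀ v, v = ∑ i, a i x v • Y i x) ∧
    ∀ i (X : ∀ p : M × Circle, TangentSpace (𝓡 d) p.1),
      ContMDiff (MI d) (𝓡 d).tangent ∞ (fun p => (⟨p.1, X p⟩ : TangentBundle (𝓡 d) M)) →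
      ContMDiffOn (MI d) 𝓘(ℝ, ℝ) ∞ (fun p => a i p.1 (X p)) (W ×ˢ univ) := by
  let e := trivializationAt (Eu d) (TangentSpace (𝓡 d) : M → Type) x₀
  have hx₀ : x₀ ∈ e.baseSet := mem_baseSet_trivializationAt _ _ _
  let b := (EuclideanSpace.basisFun (Fin d) ℝ).toBasis
  obtain ⟨χ, hχ, hχ1, hsupp⟩ := exists_bump (𝓡 d) e.open_baseSet hx₀
  obtain ⟨W, hW, hWo, hxW⟩ := eventually_nhds_iff.1 hχ1
  refine ⟨W ∩ e.baseSet, fun i => χ • e.localFrame b i, fun i x v => (e ⟨x, v⟩).2 i,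
    hWo.inter e.open_baseSet, ⟨hxW, hx₀⟩, fun i => ?_, fun x hx v => ?_, fun i X hX => ?_⟩
  · exact ContMDiffOn.smul_section_of_tsupport hχ.contMDiffOn e.open_baseSet hsupp
      (e.contMDiffOn_localFrame_baseSet ∞ b i)
  · obtain ⟨hxW', hxe⟩ := hx
    have h1 := (e.basisAt b hxe).sum_repr v
    refine h1.symm.trans (Finset.sum_congr rfl fun i _ => ?_)
    have h2 : (χ • e.localFrame b i) x = e.localFrame b i x := by
      rw [Pi.smul_apply', hW x hxW', one_smul]
    change _ = (e ⟨x, v⟩).2 i • (χ • e.localFrame b i) x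
    rw [h2, e.localFrame_apply_of_mem_baseSet b hxe]
    congr 1
  · have h1 : ContMDiffOn (MI d) ((𝓡 d).prod 𝓘(ℝ, Eu d)) ∞
        (fun p : M × Circle => e ⟨p.1, X p⟩) ((W ∩ e.baseSet) ×ˢ univ) :=
      e.contMDiffOn.comp hX.contMDiffOn fun p hp => e.mem_source.2 hp.1.2
    have h2 : ContDiff ℝ ∞ fun w : Eu d => w i := (EuclideanSpace.proj i : Eu d →L[ℝ] ℝ).contDiff
    exact h2.contMDiff.comp_contMDiffOn (contMDiff_snd.comp_contMDiffOn h1)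

/-- Every tangent vector is the value of a global smooth vector field. -/
lemma exists_field_eq (x : M) (X : TangentSpace (𝓡 d) x) : ∃ Y : ∀ x : M, TangentSpace (𝓡 d) x,
    IsSmoothField d Y ∧ Y x = X := by
  obtain ⟨W, Y, a, -, hxW, hY, hsum, -⟩ := exists_localFields (d := d) x
  exact ⟨_, IsSmoothField.sum Finset.univ hY fun i => a i x X, (hsum x hxW X).symm⟩

end Caloron

/-! ### From module connections and Higgs fields to framed connections -/

namespace Caloron

variable {d n : ℕ} {M : Type v} [TopologicalSpace M] [ChartedSpace (Eu d) M]

/-- The component of a tangent vector of `M × S¹` along `M`. -/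
def fstVec {p : M × Circle} (X : TangentSpace (MI d) p) : TangentSpace (𝓡 d) p.1 :=
  (X : Eu d × Eu 1).1

/-- The component of a tangent vector of `M × S¹` along the circle. -/
def sndVec {p : M × Circle} (X : TangentSpace (MI d) p) : TangentSpace (𝓡 1) p.2 :=
  (X : Eu d × Eu 1).2

/-- The rules for a covariant derivative at `p` in the direction `X`. -/
structure IsCovDeriv {E : FrVect.{u} d n M} {p : M × Circle} (X : TangentSpace (MI d) p)
    (D : E.Sec → E.fib p) : Prop where
  add : ∀ s t r : E.Sec, (∀ q, r q = s q + t q) → D r = D s + D t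
  leibniz : ∀ f : M × Circle → ℂ, ContMDiff (MI d) 𝓘(ℝ, ℂ) ∞ f → ∀ s t : E.Sec,
    (∀ q, t q = f q • s q) → D t = f p • D s + dFun (MI d) f p X • s p

namespace IsCovDeriv
variable {E : FrVect.{u} d n M} {p : M × Circle} {X : TangentSpace (MI d) p} {D : E.Sec → E.fib p}

lemma zero (h : IsCovDeriv X D) {r : E.Sec} (hr : ∀ q, r q = 0) : D r = 0 := by
  have h1 := h.add r r r fun q => by rw [hr, add_zero]
  exact left_eq_add.1 h1

lemma sum (h : IsCovDeriv X D) {ι : Type} (S : Finset ι) (s : ι → E.Sec) :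
    ∀ r : E.Sec, (∀ q, r q = ∑ i ∈ S, s i q) → D r = ∑ i ∈ S, D (s i) := by
  classical
  induction S using Finset.induction_on with
  | empty => exact fun r hr => by simpa using h.zero (r := r) fun q => by simpa using hr q
  | insert i S hi ih =>
    intro r hr
    rw [Finset.sum_insert hi, ← ih ⟨fun q => ∑ i ∈ S, s i q,
      FrVect.IsSmoothSecOn.sum S fun i _ => (s i).2⟩ fun q => rfl]
    exact h.add _ _ _ fun q => by rw [hr q, Finset.sum_insert hi]

variable [IsManifold (𝓡 d) ∞ M] [T2Space M]

/-- If `r` vanishes near `p` and `χ` is a bump function supported there, then `χ r = 0`, and the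
Leibniz rule gives `D r = 0`. -/
lemma eq_zero_of_eventually (h : IsCovDeriv X D) {r : E.Sec} (hr : ∀ᶠ q in 𝓝 p, r q = 0) :
    D r = 0 := by
  obtain ⟨W, hW, hWo, hpW⟩ := eventually_nhds_iff.1 hr
  obtain ⟨χ, hχ, hχ1, hsupp⟩ := exists_bump (MI d) hWo hpW
  have hz : ∀ q, (χ q : ℂ) • r q = 0 := fun q => by
    by_cases hq : q ∈ W
    · rw [hW q hq, smul_zero]
    · rw [image_eq_zero_of_notMem_tsupport fun h => hq (hsupp h), Complex.ofReal_zero, zero_smul]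
  have h1 := h.leibniz (fun q => (χ q : ℂ)) (contMDiff_ofReal hχ) r
    ⟨fun _ => 0, FrVect.isSmoothSecOn_zero _⟩ fun q => (hz q).symm
  rw [h.zero (r := ⟨fun _ => 0, FrVect.isSmoothSecOn_zero _⟩) fun q => rfl, hχ1.self_of_nhds,
    hr.self_of_nhds, smul_zero, add_zero, Complex.ofReal_one, one_smul] at h1
  exact h1.symm

/-- A covariant derivative is local. -/
lemma congr (h : IsCovDeriv X D) {s t : E.Sec} (hst : ∀ᶠ q in 𝓝 p, s q = t q) : D s = D t := by
  let r : E.Sec := ⟨fun q => s q + (-1 : ℂ) • t q,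
    s.2.add (FrVect.IsSmoothSecOn.smul contMDiffOn_const t.2)⟩
  have h1 : D s = D r + D t := h.add r t s fun q =>
    show s q = (s q + (-1 : ℂ) • t q) + t q by rw [neg_one_smul, neg_add_cancel_right]
  have h2 : D r = 0 := h.eq_zero_of_eventually (hst.mono fun q hq =>
    show s q + (-1 : ℂ) • t q = 0 by rw [hq, neg_one_smul, add_neg_cancel])
  rw [h1, h2, zero_add]

lemma expand (h : IsCovDeriv X D) {s : E.Sec} {e : Fin n → E.Sec} {f : Fin n → M × Circle → ℂ}
    (hf : ∀ i, ContMDiff (MI d) 𝓘(ℝ, ℂ) ∞ (f i)) (hs : ∀ᶠ q in 𝓝 p, s q = ∑ i, f i q • e i q) :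
    D s = ∑ i, (f i p • D (e i) + dFun (MI d) (f i) p X • e i p) := by
  let t : Fin n → E.Sec := fun i => ⟨fun q => f i q • e i q,
    FrVect.IsSmoothSecOn.smul (hf i).contMDiffOn (e i).2⟩
  let r : E.Sec := ⟨fun q => ∑ i, t i q, FrVect.IsSmoothSecOn.sum _ fun i _ => (t i).2⟩
  rw [h.congr (t := r) hs, h.sum Finset.univ t r fun q => rfl]
  exact Finset.sum_congr rfl fun i _ => h.leibniz (f i) (hf i) (e i) (t i) fun q => rfl

end IsCovDeriv

lemma FrConn.isCovDeriv [IsManifold (𝓡 d) ∞ M] {E : FrVect.{u} d n M} (D : FrConn E)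
    (p : M × Circle) (X : TangentSpace (MI d) p) : IsCovDeriv X fun s => D.toFun s p X :=
  ⟨fun s t r h => D.add s t r h p X, fun f hf s t h => D.leibniz f hf s t h p X⟩

variable [IsManifold (𝓡 d) ∞ M]

lemma contMDiff_of_fsmoothM {C : M → LC} (hC : FSmoothM d univ C) :
    ContMDiff (MI d) 𝓘(ℝ, ℂ) ∞ fun q : M × Circle => C q.1 q.2 := by
  have h := (fsmoothM_iff isOpen_univ).1 hC
  rwa [univ_prod_univ, contMDiffOn_univ] at h

variable [T2Space M]

namespace OVect
variable {A : OVect.{u} d n M}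

/-- The coordinates of a section in a based trivialisation agree near a given point with globally
defined smooth functions. -/
lemma exists_expansion {ψ : LocalTriv LC (LV n) A.fib} (hψ : ψ ∈ A.atlas) {x : M}
    (hx : x ∈ ψ.base) (t : A.Sec) : ∃ C : Fin n → M → LC, (∀ i, FSmoothM d univ (C i)) ∧
      ∀ᶠ y in 𝓝 x, ∀ i, C i y = ψ.coord y (t y) i := by
  obtain ⟨χ, hχ, hχ1, hsupp⟩ := exists_bump (𝓡 d) (A.isOpen ψ hψ) hx
  refine ⟨fun i y => algebraMap ℂ LC (χ y) * ψ.coord y (t y) i, fun i => ?_,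
    hχ1.mono fun y hy i => by
      beta_reduce; rw [hy, Complex.ofReal_one, map_one, one_mul]⟩
  refine FSmoothM.of_local fun y _ => ?_
  by_cases hy : y ∈ ψ.base
  · have hU : IsOpen (univ ∩ ψ.base) := isOpen_univ.inter (A.isOpen ψ hψ)
    refine ⟨ψ.base, A.isOpen ψ hψ, hy, ?_⟩
    exact (fsmoothM_pi hU).1 (FSmoothM.smul hU
      (fsmoothM_algebraMap hU (contMDiff_ofReal hχ).contMDiffOn) (t.2 ψ hψ)) i
  · refine ⟨(tsupport χ)ᶜ, (isClosed_tsupport χ).isOpen_compl, fun h => hy (hsupp h), ?_⟩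
    refine (fsmoothM_const _ (0 : LC)).congr
      (isOpen_univ.inter (isClosed_tsupport χ).isOpen_compl) fun w hw => ?_
    beta_reduce
    rw [image_eq_zero_of_notMem_tsupport hw.2, Complex.ofReal_zero, map_zero, zero_mul]

/-- A based local frame extends, near a given point, to global sections. -/
lemma exists_frameSections {ψ : LocalTriv LC (LV n) A.fib} (hψ : ψ ∈ A.atlas) {x : M}
    (hx : x ∈ ψ.base) :
    ∃ ε : Fin n → A.Sec, ∀ᶠ y in 𝓝 x, ∀ i, ε i y = ψ.frame y (Pi.single i 1) := by
  choose ε hε using fun i : Fin n => exists_sec_frame hψ hx (Pi.single i 1)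
  exact ⟨ε, eventually_all.2 hε⟩

end OVect

namespace CaloronPairing
variable {A : OVect.{u} d n M} {E : FrVect.{u} d n M} (P : CaloronPairing A E)

/-- A covariant derivative on `E` in terms of the coefficients with respect to a based frame. -/
lemma covDeriv_expand {x : M} {z : Circle} {X : TangentSpace (MI d) (x, z)}
    {D : E.Sec → E.fib (x, z)} (hD : IsCovDeriv X D) {ψ : LocalTriv LC (LV n) A.fib}
    (hψ : ψ ∈ A.atlas) (hx : x ∈ ψ.base) {t : A.Sec} {ε : Fin n → A.Sec}
    (hε : ∀ᶠ y in 𝓝 x, ∀ i, ε i y = ψ.frame y (Pi.single i 1)) {C : Fin n → M → LC}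
    (hC : ∀ i, FSmoothM d univ (C i)) (hCt : ∀ᶠ y in 𝓝 x, ∀ i, C i y = ψ.coord y (t y) i) :
    D (P.toSec t) = ∑ i, (C i x z • D (P.toSec (ε i))
      + dFun (MI d) (fun q : M × Circle => C i q.1 q.2) (x, z) X • P.ev x z (ε i x)) := by
  refine hD.expand (f := fun i q => C i q.1 q.2) (e := fun i => P.toSec (ε i))
    (fun i => contMDiff_of_fsmoothM (hC i)) ?_
  have hfst : Tendsto (Prod.fst : M × Circle → M) (𝓝 (x, z)) (𝓝 x) := continuous_fst.tendsto _
  filter_upwards [hfst.eventually hε, hfst.eventually hCt,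
    hfst.eventually ((A.isOpen ψ hψ).mem_nhds hx)] with q h1 h2 h3
  have h4 : t q.1 = ψ.frame q.1 (ψ.coord q.1 (t q.1)) := (ψ.frame_coord h3 _).symm
  have h5 : P.ev q.1 q.2 (t q.1) = ∑ i, ψ.coord q.1 (t q.1) i q.2 •
      P.ev q.1 q.2 (ψ.frame q.1 (Pi.single i 1)) :=
    (congrArg (P.ev q.1 q.2) h4).trans (P.ev_linear (ψ.frame q.1) _ q.2)
  refine h5.trans (Finset.sum_congr rfl fun i _ => ?_)
  rw [← h2 i, ← h1 i]; rfl

variable (D : ModConn A) (φ : Higgs A)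

/-- The formula `Δ + dθ ⊗ φ`. -/
noncomputable def connFun (s : E.Sec) (p : M × Circle) (X : TangentSpace (MI d) p) : E.fib p :=
  P.ev p.1 p.2 (D.toFun (P.ofSec s) p.1 (fstVec X))
    + (angForm p.2 (sndVec X) : ℂ) • P.ev p.1 p.2 (φ.toFun p.1 (P.ofSec s p.1))

omit [T2Space M] in
lemma connFun_add (s t r : E.Sec) (h : ∀ p, r p = s p + t p) (p : M × Circle)
    (X : TangentSpace (MI d) p) :
    P.connFun D φ r p X = P.connFun D φ s p X + P.connFun D φ t p X := by
  have h1 : ∀ x, P.ofSec r x = P.ofSec s x + P.ofSec t x := fun x => P.ev_ext fun z => by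
    rw [P.map_add, P.ev_ofSec, P.ev_ofSec, P.ev_ofSec, h]
  simp only [connFun]
  rw [D.add _ _ _ h1, P.map_add, h1, φ.add, P.map_add, smul_add]
  abel

omit [T2Space M] in
lemma connFun_leibniz (f : M × Circle → ℂ) (hf : ContMDiff (MI d) 𝓘(ℝ, ℂ) ∞ f) (s t : E.Sec)
    (h : ∀ p, t p = f p • s p) (p : M × Circle) (X : TangentSpace (MI d) p) :
    P.connFun D φ t p X = f p • P.connFun D φ s p X + dFun (MI d) f p X • s p := by
  -- Multiplication by `f` on `E` corresponds to multiplication by the loop-valued function `F`.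
  let F : M → LC := fun x => LC.mk (fun z => f (x, z))
    (hf.comp (contMDiff_const.prodMk contMDiff_id))
  have hF : FSmoothM d univ F := by
    rw [fsmoothM_iff isOpen_univ]
    exact hf.contMDiffOn
  have h1 : ∀ x, P.ofSec t x = F x • P.ofSec s x := fun x => P.ev_ext fun z => by
    rw [P.map_smul, P.ev_ofSec, P.ev_ofSec, h]; rfl
  obtain ⟨x, z⟩ := p
  have h2 : dFun (MI d) f (x, z) X = _ :=
    dFun_prod isOpen_univ hF (mem_univ x) (fstVec X) z (sndVec X)
  simp only [connFun]
  rw [D.leibniz F hF _ _ h1, h1, φ.leibniz, P.map_add, P.map_add, P.map_smul, P.map_smul,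
    P.map_smul, P.map_smul, P.ev_ofSec, h2, add_smul, mul_smul, smul_add, smul_add,
    smul_comm (angForm z _ : ℂ) (F x z)]
  exact add_add_add_comm _ _ _ _

omit [T2Space M] in
lemma isCovDeriv_connFun (p : M × Circle) (X : TangentSpace (MI d) p) :
    IsCovDeriv X fun s => P.connFun D φ s p X :=
  ⟨fun s t r h => P.connFun_add D φ s t r h p X,
    fun f hf s t h => P.connFun_leibniz D φ f hf s t h p X⟩

/-- The covariant derivative along a smooth vector field `X` on `M × S¹` is smooth. As the component
of `X` along `M` varies along the circle, it is expanded in vector fields on `M`, with coefficients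
that are functions on `M × S¹`. -/
lemma connFun_smooth (s : E.Sec) (X : ∀ p : M × Circle, TangentSpace (MI d) p)
    (hX : ContMDiff (MI d) (MI d).tangent ∞
      fun p => (⟨p, X p⟩ : TangentBundle (MI d) (M × Circle))) :
    E.IsSmoothSecOn univ fun p => P.connFun D φ s p (X p) := by
  have h1 : E.IsSmoothSecOn univ fun p : M × Circle =>
      (angForm p.2 (sndVec (X p)) : ℂ) • P.ev p.1 p.2 (φ.toFun p.1 (P.ofSec s p.1)) := by
    refine FrVect.IsSmoothSecOn.smul (contMDiff_ofReal (contMDiff_angForm hX)).contMDiffOn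
      (P.isSmoothSecOn_iff (s := fun x => φ.toFun x (P.ofSec s x)) |>.1 fun ψ' hψ' => ?_)
    refine FSmoothM.of_local fun x hx => ?_
    obtain ⟨ψ, hψ, hxψ⟩ := A.cover x
    have hU : IsOpen (univ ∩ ψ'.base ∩ ψ.base) :=
      (isOpen_univ.inter (A.isOpen ψ' hψ')).inter (A.isOpen ψ hψ)
    refine ⟨ψ.base, A.isOpen ψ hψ, hxψ, FSmoothM.congr hU (FSmoothM.comp_map hU
      ((φ.smooth ψ hψ ψ' hψ').mono fun y hy => ⟨hy.2, hy.1.2⟩)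
      (((P.ofSec s).2 ψ hψ).mono fun y hy => ⟨mem_univ _, hy.2⟩)) fun y hy => ?_⟩
    simp only [readMap, ψ.frame_coord hy.2]
  refine FrVect.IsSmoothSecOn.add ?_ h1
  refine FrVect.isSmoothSecOn_of_local fun p _ => ?_
  obtain ⟨W, Y, a, hW, hpW, hY, hsum, ha⟩ := exists_localFields (d := d) p.1
  refine ⟨W ×ˢ univ, hW.prod isOpen_univ, ⟨hpW, mem_univ _⟩, ?_⟩
  rw [univ_inter]
  have h2 : ∀ i, E.IsSmoothSecOn (W ×ˢ univ) fun p : M × Circle =>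
      (a i p.1 (fstVec (X p)) : ℂ) • P.ev p.1 p.2 (D.toFun (P.ofSec s) p.1 (Y i p.1)) :=
    fun i => FrVect.IsSmoothSecOn.smul
      (Complex.ofRealCLM.contDiff.contMDiff.comp_contMDiffOn
        (ha i (fun p => fstVec (X p)) (contMDiff_fstField hX)))
      ((P.isSmoothSecOn_iff.1 (D.smooth (P.ofSec s) (Y i) (hY i))).mono (subset_univ _))
  refine (FrVect.IsSmoothSecOn.sum Finset.univ fun i _ => h2 i).congr fun q hq => ?_
  have hlin : ∀ (S : Finset (Fin d)) (b : Fin d → ℝ),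
      P.ev q.1 q.2 (D.toFun (P.ofSec s) q.1 (∑ i ∈ S, b i • Y i q.1))
      = ∑ i ∈ S, (b i : ℂ) • P.ev q.1 q.2 (D.toFun (P.ofSec s) q.1 (Y i q.1)) := by
    intro S b
    classical
    induction S using Finset.induction_on with
    | empty =>
      have h3 := D.smul_vec (P.ofSec s) q.1 0 0
      rw [zero_smul, _root_.map_zero, zero_smul] at h3
      rw [Finset.sum_empty, Finset.sum_empty, h3, P.ev_zero]
    | insert i S hi ih =>
      rw [Finset.sum_insert hi, Finset.sum_insert hi, D.add_vec, P.map_add, ih, D.smul_vec]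
      exact congrArg (· + _) (P.map_smul _ _ _ _)
  refine (hlin Finset.univ _).symm.trans ?_
  exact congrArg (fun v => P.ev q.1 q.2 (D.toFun (P.ofSec s) q.1 v)) (hsum q.1 hq.1 _).symm

omit [IsManifold (𝓡 d) ∞ M] [T2Space M] in
lemma dFun_pi {f : M → Fin n → ℂ} {x : M} (hf : ∀ i, ContMDiff (𝓡 d) 𝓘(ℝ, ℂ) ∞
    fun y => f y i) (X : TangentSpace (𝓡 d) x) (i : Fin n) :
    dFun (𝓡 d) f x X i = dFun (𝓡 d) (fun y => f y i) x X := by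
  have h1 : MDifferentiableAt (𝓡 d) 𝓘(ℝ, Fin n → ℂ) f x :=
    (contMDiff_pi_space.2 hf).mdifferentiableAt (by simp)
  have h2 := mfderiv_comp x (I' := 𝓘(ℝ, Fin n → ℂ)) (I'' := 𝓘(ℝ, ℂ))
    ((ContinuousLinearMap.proj (R := ℝ) (φ := fun _ : Fin n => ℂ) i).mdifferentiableAt
      (x := f x)) h1
  rw [ContinuousLinearMap.mfderiv_eq] at h2
  exact (congrArg (fun L : Eu d →L[ℝ] ℂ => L X) h2).symm

/-- The connection `Δ + dθ ⊗ φ` is framed: the connection form of `Δ` in a based frame vanishes at the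
base point, which leaves the derivative of the coefficients. -/
lemma connFun_framed (s : E.Sec) (x : M) (X : TangentSpace (𝓡 d) x) :
    (E.framing x).symm (P.connFun D φ s (x, 1) (pairVec X (0 : TangentSpace (𝓡 1) (1 : Circle))))
      = dFun (𝓡 d) (fun y => (E.framing y).symm (s (y, 1))) x X := by
  obtain ⟨ψ, hψ, hx⟩ := A.cover x
  obtain ⟨ε, hε⟩ := OVect.exists_frameSections hψ hx
  obtain ⟨C, hC, hCt⟩ := OVect.exists_expansion hψ hx (P.ofSec s)
  have hframe : ∀ {y : M} (hy : y ∈ ψ.base) (c : LV n),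
      P.ev y 1 (ψ.frame y c) = E.framing y (c.at 1) := fun {y} hy c => by
    rw [← P.framing y _ (OVect.isFrame_equivAt hψ hy), ← P.frameAt_apply, P.frameAt_at,
      ψ.equivAt_apply]
  have hs : P.toSec (P.ofSec s) = s :=
    Subtype.ext (funext fun p => P.ev_ofSec s p.1 p.2)
  have h1 := P.covDeriv_expand (P.isCovDeriv_connFun D φ (x, 1)
    (pairVec X (0 : TangentSpace (𝓡 1) (1 : Circle)))) hψ hx hε hC hCt
  rw [hs] at h1
  have h2 : ∀ i, P.connFun D φ (P.toSec (ε i)) (x, 1)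
      (pairVec X (0 : TangentSpace (𝓡 1) (1 : Circle))) = 0 := fun i => by
    have h3 : P.ofSec (P.toSec (ε i)) = ε i := ((P.corr_toSec (ε i)).eq_ofSec).symm
    have h4 : P.ev x 1 (D.toFun (ε i) x X) = 0 := by
      rw [P.ev_eq_zero, OVect.vanishes_iff hψ hx]
      refine funext fun j => D.based ψ hψ x hx i (ε i) ?_ X j
      filter_upwards [hε, (A.isOpen ψ hψ).mem_nhds hx] with y h5 h6
      rw [h5, ψ.coord_frame h6]
    rw [connFun, h3]
    change P.ev x 1 (D.toFun (ε i) x X) + (angForm 1 0 : ℂ) • _ = _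
    rw [h4, angForm_zero, Complex.ofReal_zero, zero_smul, add_zero]
  have h5 : ∀ i, dFun (MI d) (fun q : M × Circle => C i q.1 q.2) (x, 1)
      (pairVec X (0 : TangentSpace (𝓡 1) (1 : Circle))) = dLoop d (C i) x X 1 := fun i => by
    rw [dFun_prod isOpen_univ (hC i) (mem_univ x), angForm_zero, Complex.ofReal_zero, zero_mul,
      add_zero]
  have h6 : ∀ i, P.ev x 1 (ε i x) = E.framing x (Pi.single i 1) := fun i => by
    rw [hε.self_of_nhds i, hframe hx, ← constLoop_single, LV.at_constLoop]
  simp only [h2, smul_zero, zero_add, h5, h6] at h1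
  rw [h1]
  simp only [map_sum, _root_.map_smul, LinearEquiv.symm_apply_apply]
  have h7 : (fun y => (E.framing y).symm (s (y, 1))) =ᶠ[𝓝 x] fun y i => C i y 1 := by
    filter_upwards [hCt, (A.isOpen ψ hψ).mem_nhds hx] with y hy hyψ
    rw [LinearEquiv.symm_apply_eq, ← P.ev_ofSec]
    have h8 := hframe hyψ (ψ.coord y (P.ofSec s y))
    rw [ψ.frame_coord hyψ] at h8
    rw [h8]
    exact congrArg _ (funext fun i => congrArg (fun f : LC => f 1) (hy i).symm)
  have h8 : dFun (𝓡 d) (fun y => (E.framing y).symm (s (y, 1))) x X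
      = dFun (𝓡 d) (fun y i => C i y 1) x X := congrArg (fun L : Eu d →L[ℝ] (Fin n → ℂ) => L X)
    h7.mfderiv_eq
  rw [h8]
  funext j
  have h9 : ∀ i, ContMDiff (𝓡 d) 𝓘(ℝ, ℂ) ∞ fun y => C i y 1 := fun i =>
    (contMDiff_of_fsmoothM (hC i)).comp (contMDiff_id.prodMk contMDiff_const)
  rw [dFun_pi h9, ← sum_single_complex]
  exact dLoop_apply isOpen_univ (hC j) (mem_univ x) X 1

/-- The connection `∇ = Δ + dθ ⊗ φ`. -/
noncomputable def frConn : FrConn E where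
  toFun := P.connFun D φ
  add_vec s p X Y := by
    have h1 : angForm p.2 ((sndVec X) + (sndVec Y))
      = angForm p.2 (sndVec X) + angForm p.2 (sndVec Y) := angForm_add p.2 _ _
    have h2 := D.add_vec (P.ofSec s) p.1 (fstVec X) (fstVec Y)
    change P.ev p.1 p.2 (D.toFun _ p.1 ((fstVec X) + (fstVec Y)))
      + (angForm p.2 ((sndVec X) + (sndVec Y)) : ℂ) • _ = _
    simp only [connFun]
    rw [h1, Complex.ofReal_add, add_smul]
    refine (congrArg (fun v => P.ev p.1 p.2 v + _) h2).trans ?_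
    rw [P.map_add]
    abel
  smul_vec s p c X := by
    have h1 : angForm p.2 (c • (sndVec X)) = c * angForm p.2 (sndVec X) :=
      angForm_smul p.2 c _
    have h2 := D.smul_vec (P.ofSec s) p.1 c (fstVec X)
    change P.ev p.1 p.2 (D.toFun _ p.1 (c • (fstVec X)))
      + (angForm p.2 (c • (sndVec X)) : ℂ) • _ = _
    simp only [connFun]
    rw [h1, Complex.ofReal_mul, mul_smul, smul_add]
    exact (congrArg (fun v => P.ev p.1 p.2 v + _) h2).trans
      (congrArg (· + _) (P.map_smul _ _ _ _))
  smooth := P.connFun_smooth D φ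
  add s t r h p X := P.connFun_add D φ s t r h p X
  leibniz f hf s t h p X := P.connFun_leibniz D φ f hf s t h p X
  framed := P.connFun_framed D φ

end CaloronPairing
end Caloron

/-! ### From framed connections to module connections and Higgs fields -/

namespace Caloron
variable {d n : ℕ} {M : Type v} [TopologicalSpace M] [ChartedSpace (Eu d) M]
  {A : OVect.{u} d n M} {E : FrVect.{u} d n M} (P : CaloronPairing A E)

namespace CaloronPairing

lemma toSec_ofSec (s : E.Sec) : P.toSec (P.ofSec s) = s :=
  Subtype.ext (funext fun p => P.ev_ofSec s p.1 p.2)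

lemma ofSec_toSec (t : A.Sec) : P.ofSec (P.toSec t) = t := ((P.corr_toSec t).eq_ofSec).symm

variable [IsManifold (𝓡 d) ∞ M]

lemma dLoop_zero {f : M → LC} (hf : FSmoothM d univ f) (x : M) (z : Circle) :
    dLoop d f x (0 : TangentSpace (𝓡 d) x) z = 0 := by
  rw [dLoop_apply isOpen_univ hf (mem_univ x)]
  exact (mfderiv (𝓡 d) 𝓘(ℝ, ℂ) (fun y => f y z) x).map_zero

variable [T2Space M] (D : FrConn E)

/-- The derivatives along `X` at the points of `{x} × S¹` form a smooth loop, since `X` extends to a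
smooth vector field. -/
lemma exists_modConn (t : A.Sec) (x : M) (X : TangentSpace (𝓡 d) x) : ∃ v : A.fib x, ∀ z,
    P.ev x z v = D.toFun (P.toSec t) (x, z) (pairVec X (0 : TangentSpace (𝓡 1) z)) := by
  obtain ⟨Y, hY, rfl⟩ := exists_field_eq x X
  exact (P.loops x _).1 ((D.smooth (P.toSec t) _ (contMDiff_horizontalField hY)).loop x)

/-- The covariant derivative along `M` of a section of the `Ω` vector bundle. -/
noncomputable def modConnFun (t : A.Sec) (x : M) (X : TangentSpace (𝓡 d) x) : A.fib x :=
  (P.exists_modConn D t x X).choose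

lemma ev_modConnFun (t : A.Sec) (x : M) (z : Circle) (X : TangentSpace (𝓡 d) x) :
    P.ev x z (P.modConnFun D t x X)
      = D.toFun (P.toSec t) (x, z) (pairVec X (0 : TangentSpace (𝓡 1) z)) :=
  (P.exists_modConn D t x X).choose_spec z

/-- In a based frame the section with constant coordinates `e_i` restricts to a constant section with
respect to the framing, hence is parallel along `M × {1}`. -/
lemma modConnFun_based {ψ : LocalTriv LC (LV n) A.fib} (hψ : ψ ∈ A.atlas) {x : M} (hx : x ∈ ψ.base)
    (i : Fin n) (t : A.Sec) (ht : ∀ᶠ y in 𝓝 x, ψ.coord y (t y) = Pi.single i 1)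
    (X : TangentSpace (𝓡 d) x) (j : Fin n) : (ψ.coord x (P.modConnFun D t x X) j) 1 = 0 := by
  have h1 := D.framed (P.toSec t) x X
  have h2 : (fun y => (E.framing y).symm (P.toSec t (y, 1)))
      =ᶠ[𝓝 x] fun _ => (Pi.single i 1 : Fin n → ℂ) := by
    filter_upwards [ht, (A.isOpen ψ hψ).mem_nhds hx] with y hy hyψ
    rw [LinearEquiv.symm_apply_eq, ← P.framing y _ (OVect.isFrame_equivAt hψ hyψ),
      constLoop_single, ← hy, ψ.equivAt_apply, ψ.frame_coord hyψ]
    rfl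
  have h3 : dFun (𝓡 d) (fun y => (E.framing y).symm (P.toSec t (y, 1))) x X = 0 := by
    refine (congrArg (fun L : Eu d →L[ℝ] (Fin n → ℂ) => L X) h2.mfderiv_eq).trans ?_
    exact congrArg (fun L : Eu d →L[ℝ] (Fin n → ℂ) => L X) (mfderiv_const (I := 𝓡 d))
  rw [h3, LinearEquiv.symm_apply_eq, _root_.map_zero, ← P.ev_modConnFun D, P.ev_eq_zero,
    OVect.vanishes_iff hψ hx] at h1
  exact congrFun h1 j

/-- The module connection given by `∇` along `M`. -/
noncomputable def modConn : ModConn A where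
  toFun := P.modConnFun D
  add_vec t x X Y := P.ev_ext fun z => by
    rw [P.map_add, P.ev_modConnFun, P.ev_modConnFun, P.ev_modConnFun, ← D.add_vec]
    congr 1
    exact Prod.ext rfl (add_zero (0 : Eu 1)).symm
  smul_vec t x c X := P.ev_ext fun z => by
    rw [P.map_smul, P.ev_modConnFun, P.ev_modConnFun]
    refine Eq.trans ?_ (D.smul_vec (P.toSec t) (x, z) c _)
    congr 1
    exact Prod.ext rfl (smul_zero (A := Eu 1) c).symm
  smooth t Y hY := P.isSmoothSecOn_iff.2
    ((D.smooth (P.toSec t) _ (contMDiff_horizontalField hY)).congr fun p _ =>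
      (P.ev_modConnFun D t p.1 p.2 (Y p.1)).symm)
  add s t r h x X := P.ev_ext fun z => by
    rw [P.map_add, P.ev_modConnFun, P.ev_modConnFun, P.ev_modConnFun]
    refine D.add _ _ _ (fun p => ?_) _ _
    exact (congrArg (P.ev p.1 p.2) (h p.1)).trans (P.map_add _ _ _ _)
  leibniz f hf s t h x X := P.ev_ext fun z => by
    rw [P.map_add, P.map_smul, P.map_smul, P.ev_modConnFun, P.ev_modConnFun]
    have h1 := D.leibniz (fun q => f q.1 q.2) (contMDiff_of_fsmoothM hf) (P.toSec s) (P.toSec t)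
      (fun p => (congrArg (P.ev p.1 p.2) (h p.1)).trans (P.map_smul _ _ _ _)) (x, z)
      (pairVec X (0 : TangentSpace (𝓡 1) z))
    rw [dFun_prod isOpen_univ hf (mem_univ x), angForm_zero, Complex.ofReal_zero, zero_mul,
      add_zero] at h1
    exact h1
  based _ hψ _ hx i s hs X j := P.modConnFun_based D hψ hx i s hs X j

/-- The vertical derivative in terms of the coefficients with respect to a based frame. It depends
on the value of the section at the point `x` only. -/
lemma vertical_expand {ψ : LocalTriv LC (LV n) A.fib} (hψ : ψ ∈ A.atlas) {x : M} (hx : x ∈ ψ.base)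
    {ε : Fin n → A.Sec} (hε : ∀ᶠ y in 𝓝 x, ∀ i, ε i y = ψ.frame y (Pi.single i 1)) (t : A.Sec)
    (z : Circle) :
    D.toFun (P.toSec t) (x, z) (pairVec (0 : TangentSpace (𝓡 d) x) (angVec z))
      = ∑ i, (ψ.coord x (t x) i z •
          D.toFun (P.toSec (ε i)) (x, z) (pairVec (0 : TangentSpace (𝓡 d) x) (angVec z))
        + LC.del (ψ.coord x (t x) i) z • P.ev x z (ε i x)) := by
  obtain ⟨C, hC, hCt⟩ := OVect.exists_expansion hψ hx t
  have h1 := P.covDeriv_expand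
    (D.isCovDeriv (x, z) (pairVec (0 : TangentSpace (𝓡 d) x) (angVec z))) hψ hx hε hC hCt
  refine h1.trans (Finset.sum_congr rfl fun i _ => ?_)
  have h2 : dLoop d (C i) x (0 : TangentSpace (𝓡 d) x) z = 0 :=
    dLoop_zero (hC i) x z
  rw [dFun_prod isOpen_univ (hC i) (mem_univ x), h2, angForm_angVec, Complex.ofReal_one, one_mul,
    zero_add, hCt.self_of_nhds i]

/-- The derivative of a section of `𝖤` along the circle is again a loop, and it is determined by the
value of the section at the point `x`. -/
lemma exists_higgs (x : M) (v : A.fib x) : ∃ w : A.fib x, ∀ t : A.Sec, t x = v → ∀ z,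
    P.ev x z w = D.toFun (P.toSec t) (x, z) (pairVec (0 : TangentSpace (𝓡 d) x) (angVec z)) := by
  obtain ⟨t, ht⟩ := OVect.exists_sec_eq v
  obtain ⟨w, hw⟩ := (P.loops x _).1 ((D.smooth (P.toSec t) _ contMDiff_verticalField).loop x)
  refine ⟨w, fun t' ht' z => (hw z).trans ?_⟩
  obtain ⟨ψ, hψ, hx⟩ := A.cover x
  obtain ⟨ε, hε⟩ := OVect.exists_frameSections hψ hx
  exact (P.vertical_expand D hψ hx hε t z).trans
    (by rw [ht, ← ht']; exact (P.vertical_expand D hψ hx hε t' z).symm)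

/-- The derivative along the circle of a vector of the `Ω` vector bundle. -/
noncomputable def higgsFun (x : M) (v : A.fib x) : A.fib x := (P.exists_higgs D x v).choose

lemma ev_higgsFun (t : A.Sec) (x : M) (z : Circle) : P.ev x z (P.higgsFun D x (t x))
    = D.toFun (P.toSec t) (x, z) (pairVec (0 : TangentSpace (𝓡 d) x) (angVec z)) :=
  (P.exists_higgs D x (t x)).choose_spec t rfl z

lemma higgsFun_add (x : M) (v w : A.fib x) :
    P.higgsFun D x (v + w) = P.higgsFun D x v + P.higgsFun D x w := by
  obtain ⟨s, rfl⟩ := OVect.exists_sec_eq v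
  obtain ⟨t, rfl⟩ := OVect.exists_sec_eq w
  let r : A.Sec := ⟨fun y => s y + t y, s.2.add isOpen_univ t.2⟩
  refine P.ev_ext fun z => (P.ev_higgsFun D r x z).trans ?_
  rw [P.map_add, P.ev_higgsFun, P.ev_higgsFun]
  exact D.add _ _ _ (fun p => P.map_add _ _ _ _) _ _

lemma higgsFun_leibniz (x : M) (f : LC) (v : A.fib x) :
    P.higgsFun D x (f • v) = f • P.higgsFun D x v + LC.del f • v := by
  obtain ⟨s, rfl⟩ := OVect.exists_sec_eq v
  have hf : FSmoothM d univ fun _ : M => f := fsmoothM_const _ _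
  let r : A.Sec := ⟨fun y => f • s y, s.2.smul isOpen_univ hf⟩
  refine P.ev_ext fun z => (P.ev_higgsFun D r x z).trans ?_
  rw [P.map_add, P.map_smul, P.map_smul, P.ev_higgsFun]
  have h1 := D.leibniz (fun q => f q.2) (contMDiff_of_fsmoothM hf) (P.toSec s) (P.toSec r)
    (fun p => P.map_smul _ _ _ _) (x, z) (pairVec (0 : TangentSpace (𝓡 d) x) (angVec z))
  have h2 : dLoop d (fun _ : M => f) x (0 : TangentSpace (𝓡 d) x) z = 0 :=
    dLoop_zero hf x z
  rw [dFun_prod isOpen_univ hf (mem_univ x), h2, angForm_angVec, Complex.ofReal_one, one_mul,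
    zero_add] at h1
  exact h1

lemma isSmoothSecOn_higgsFun (t : A.Sec) :
    A.IsSmoothSecOn univ fun x => P.higgsFun D x (t x) :=
  P.isSmoothSecOn_iff.2 ((D.smooth (P.toSec t) _ contMDiff_verticalField).congr fun p _ =>
    (P.ev_higgsFun D t p.1 p.2).symm)

lemma higgsFun_sum {ι : Type} (S : Finset ι) (x : M) (v : ι → A.fib x) :
    P.higgsFun D x (∑ i ∈ S, v i) = ∑ i ∈ S, P.higgsFun D x (v i) := by
  classical
  induction S using Finset.induction_on with
  | empty =>
    have h := P.higgsFun_add D x 0 0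
    rw [add_zero] at h
    simpa using h
  | insert i S hi ih => rw [Finset.sum_insert hi, Finset.sum_insert hi, higgsFun_add, ih]

/-- In local coordinates the Higgs field is `∂` plus multiplication by a smooth matrix of loops. -/
lemma readMap_higgsFun_smooth {ψ : LocalTriv LC (LV n) A.fib} (hψ : ψ ∈ A.atlas)
    {ψ' : LocalTriv LC (LV n) A.fib} (hψ' : ψ' ∈ A.atlas) :
    FSmoothMF d (ψ.base ∩ ψ'.base) (readMap ψ ψ' (P.higgsFun D)) := by
  have hU := (A.isOpen ψ hψ).inter (A.isOpen ψ' hψ')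
  have h1 : ∀ j, FSmoothM d (ψ.base ∩ ψ'.base)
      fun x => ψ'.coord x (P.higgsFun D x (ψ.frame x (Pi.single j 1))) := fun j => by
    refine FSmoothM.of_local fun x hx => ?_
    obtain ⟨ε, hε⟩ := OVect.exists_sec_frame hψ hx.1 (Pi.single j 1)
    obtain ⟨W, hW, hWo, hxW⟩ := eventually_nhds_iff.1 hε
    refine ⟨W, hWo, hxW, ((P.isSmoothSecOn_higgsFun D ε ψ' hψ').mono
      fun y hy => ⟨mem_univ _, hy.1.2⟩).congr (hU.inter hWo) fun y hy => ?_⟩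
    exact congrArg (fun v => ψ'.coord y (P.higgsFun D y v)) (hW y hy.2)
  have h2 : ∀ j, FSmoothM d (ψ.base ∩ ψ'.base)
      fun x => ψ'.coord x (ψ.frame x (Pi.single j 1)) := fun j =>
    (A.trans_smooth ψ hψ ψ' hψ').apply hU (Pi.single j 1)
  refine ((fsmoothMF_matrix hU (ContinuousLinearMap.id ℝ LC) h1).add hU
    (fsmoothMF_matrix hU LC.delL h2)).congr hU fun x _ c => ?_
  rw [readMap]
  conv_rhs => rw [LV.sum_single c, map_sum, higgsFun_sum, map_sum]
  rw [← Finset.sum_add_distrib]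
  refine Finset.sum_congr rfl fun j _ => ?_
  rw [_root_.map_smul, higgsFun_leibniz, _root_.map_add, _root_.map_smul, _root_.map_smul]
  rfl

/-- The Higgs field given by `∇` along `∂/∂θ`. -/
noncomputable def higgs : Higgs A where
  toFun := P.higgsFun D
  add := P.higgsFun_add D
  leibniz := P.higgsFun_leibniz D
  smooth _ hψ _ hψ' := P.readMap_higgsFun_smooth D hψ hψ'

end CaloronPairing
end Caloron

/-! ### Compatibility of connections, and morphisms -/

namespace Caloron
variable {d n : ℕ} {M : Type v} [TopologicalSpace M] [ChartedSpace (Eu d) M]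
  [IsManifold (𝓡 d) ∞ M]

lemma ModConn.map_zero {A : OVect.{u} d n M} (D : ModConn A) (t : A.Sec) (x : M) :
    D.toFun t x (0 : TangentSpace (𝓡 d) x) = 0 := by
  have h := D.smul_vec t x 0 0
  rwa [zero_smul, _root_.map_zero, zero_smul] at h

namespace CaloronPairing
variable {A A' : OVect.{u} d n M} {E E' : FrVect.{u} d n M} (P : CaloronPairing A E)
  (P' : CaloronPairing A' E')

/-- The relation `∇ = Δ + dθ ⊗ φ`. -/
def ConnCompat (D : ModConn A) (φ : Higgs A) (C : FrConn E) : Prop :=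
  ∀ (t : A.Sec) (x : M) (z : Circle) (X : TangentSpace (𝓡 d) x) (ξ : TangentSpace (𝓡 1) z),
    C.toFun (P.toSec t) (x, z) (pairVec X ξ)
      = P.ev x z (D.toFun t x X) + (angForm z ξ : ℂ) • P.ev x z (φ.toFun x (t x))

variable {P P'} in
lemma ConnCompat.apply {D : ModConn A} {φ : Higgs A} {C : FrConn E} (h : P.ConnCompat D φ C)
    {s : E.Sec} {t : A.Sec} (hst : P.Corr s t) (x : M) (z : Circle) (X : TangentSpace (𝓡 d) x)
    (ξ : TangentSpace (𝓡 1) z) : C.toFun s (x, z) (pairVec X ξ)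
      = P.ev x z (D.toFun t x X) + (angForm z ξ : ℂ) • P.ev x z (φ.toFun x (t x)) := by
  rw [hst.left_unique (P.corr_toSec t)]
  exact h t x z X ξ

variable {P P'} in
lemma ConnCompat.horizontal {D : ModConn A} {φ : Higgs A} {C : FrConn E} (h : P.ConnCompat D φ C)
    (t : A.Sec) (x : M) (z : Circle) (X : TangentSpace (𝓡 d) x) :
    C.toFun (P.toSec t) (x, z) (pairVec X (0 : TangentSpace (𝓡 1) z))
      = P.ev x z (D.toFun t x X) := by
  rw [h, angForm_zero, Complex.ofReal_zero, zero_smul, add_zero]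

variable {P P'} in
lemma ConnCompat.vertical {D : ModConn A} {φ : Higgs A} {C : FrConn E} (h : P.ConnCompat D φ C)
    (t : A.Sec) (x : M) (z : Circle) :
    C.toFun (P.toSec t) (x, z) (pairVec (0 : TangentSpace (𝓡 d) x) (angVec z))
      = P.ev x z (φ.toFun x (t x)) := by
  rw [h, D.map_zero, P.ev_zero, angForm_angVec, Complex.ofReal_one, one_smul, zero_add]

/-- A morphism of `Ω` vector bundles and a morphism of framed bundles that are intertwined by the
evaluation maps. -/
def Natural (f : OVect.Hom A A') (g : FrVect.Hom E E') : Prop :=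
  ∀ x z v, g.toEquiv (x, z) (P.ev x z v) = P'.ev x z (f.toEquiv x v)

variable {P P'} in
omit [IsManifold (𝓡 d) ∞ M] in
lemma Natural.toSec_mapSec {f : OVect.Hom A A'} {g : FrVect.Hom E E'} (h : P.Natural P' f g)
    (t : A.Sec) : P'.toSec (f.mapSec t) = g.mapSec (P.toSec t) :=
  Subtype.ext (funext fun p => (h p.1 p.2 (t p.1)).symm)

variable [T2Space M]

lemma natural_homFr (f : OVect.Hom A A') : P.Natural P' f (P.homFr P' f) := P.homFr_ev P' f

lemma natural_homO (g : FrVect.Hom E E') : P.Natural P' (P.homO P' g) g :=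
  fun x z v => (P.ev_homO P' g x z v).symm

lemma connCompat_frConn (D : ModConn A) (φ : Higgs A) : P.ConnCompat D φ (P.frConn D φ) := by
  intro t x z X ξ
  change P.connFun D φ (P.toSec t) (x, z) (pairVec X ξ) = _
  rw [connFun, P.ofSec_toSec]
  rfl

lemma connCompat_modConn (C : FrConn E) : P.ConnCompat (P.modConn C) (P.higgs C) C := by
  intro t x z X ξ
  change _ = P.ev x z (P.modConnFun C t x X) + (angForm z ξ : ℂ) • P.ev x z (P.higgsFun C x (t x))
  rw [P.ev_modConnFun, P.ev_higgsFun, ← C.smul_vec, ← C.add_vec]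
  congr 1
  exact Prod.ext ((add_zero X).symm.trans (congrArg (X + ·) (smul_zero (A := Eu d) _).symm))
    ((eq_angForm_smul_angVec z ξ).trans (zero_add _).symm)

section
variable {P P'} {D : ModConn A} {φ : Higgs A} {C : FrConn E} {D' : ModConn A'} {φ' : Higgs A'}
  {C' : FrConn E'} (h : P.ConnCompat D φ C) (h' : P'.ConnCompat D' φ' C')
  {f : OVect.Hom A A'} {g : FrVect.Hom E E'} (hfg : P.Natural P' f g)
include h h' hfg

omit [T2Space M] in
lemma Natural.conn_map (hD : ∀ s x X, f.toEquiv x (D.toFun s x X) = D'.toFun (f.mapSec s) x X)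
    (hφ : ∀ x v, f.toEquiv x (φ.toFun x v) = φ'.toFun x (f.toEquiv x v)) (s : E.Sec)
    (p : M × Circle) (X : TangentSpace (MI d) p) :
    g.toEquiv p (C.toFun s p X) = C'.toFun (g.mapSec s) p X := by
  obtain ⟨t, rfl⟩ : ∃ t, P.toSec t = s := ⟨_, P.toSec_ofSec s⟩
  obtain ⟨x, z⟩ := p
  rw [← hfg.toSec_mapSec]
  have h1 := h t x z (fstVec X) (sndVec X)
  have h2 := h' (f.mapSec t) x z (fstVec X) (sndVec X)
  refine (congrArg (g.toEquiv (x, z)) h1).trans (Eq.trans ?_ h2.symm)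
  rw [_root_.map_add, _root_.map_smul, hfg, hfg, hD, hφ]
  rfl

omit [T2Space M] in
lemma Natural.modConn_map
    (hC : ∀ s p X, g.toEquiv p (C.toFun s p X) = C'.toFun (g.mapSec s) p X) (t : A.Sec) (x : M)
    (X : TangentSpace (𝓡 d) x) : f.toEquiv x (D.toFun t x X) = D'.toFun (f.mapSec t) x X := by
  refine P'.ev_ext fun z => ?_
  rw [← hfg, ← h.horizontal, ← h'.horizontal, hC, hfg.toSec_mapSec]

lemma Natural.higgs_map
    (hC : ∀ s p X, g.toEquiv p (C.toFun s p X) = C'.toFun (g.mapSec s) p X) (x : M)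
    (v : A.fib x) : f.toEquiv x (φ.toFun x v) = φ'.toFun x (f.toEquiv x v) := by
  obtain ⟨t, rfl⟩ := OVect.exists_sec_eq v
  refine P'.ev_ext fun z => ?_
  have h1 := h'.vertical (f.mapSec t) x z
  rw [hfg.toSec_mapSec, ← hC, h.vertical, hfg] at h1
  exact h1

end

/-! ### Transfer of Hermitian structures -/

/-- The relation between Hermitian structures on a bundle and its caloron transform. -/
def HermCompat (H : HermO A) (K : HermFr E) : Prop :=
  ∀ x z v w, K.form (x, z) (P.ev x z v) (P.ev x z w) = H.form x v w z

section OToFr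
variable (H : HermO A)

omit [IsManifold (𝓡 d) ∞ M] [T2Space M] in
/-- A Hermitian form evaluated at `z` vanishes on vectors vanishing at `z`. -/
lemma herm_eq_zero {x : M} {z : Circle} {u : A.fib x} (hu : P.ev x z u = 0) (w : A.fib x) :
    H.form x u w z = 0 := by
  obtain ⟨ψ, hψ, hx⟩ := A.cover x
  obtain ⟨c, rfl⟩ := (ψ.equivAt hx).surjective u
  have hc : c.at z = 0 := (P.ev_eq_zero_iff _ z c).1 hu
  let L : A.fib x →ₗ[LC] LC :=
    { toFun := fun v => H.form x v w
      map_add' := fun v v' => H.add_left x v v' w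
      map_smul' := fun f v => H.smul_left x f v w }
  have h1 : L (ψ.equivAt hx c) = ∑ j, c j * L (ψ.equivAt hx (Pi.single j 1)) := by
    conv_lhs => rw [LV.sum_single c, map_sum, map_sum]
    exact Finset.sum_congr rfl fun j _ => by
      rw [_root_.map_smul, _root_.map_smul, smul_eq_mul]
  have h2 : LC.eval z (L (ψ.equivAt hx c)) = 0 := by
    rw [h1, map_sum]
    refine Finset.sum_eq_zero fun j _ => ?_
    rw [_root_.map_mul]
    exact mul_eq_zero_of_left (congrFun hc j) _
  exact h2

omit [IsManifold (𝓡 d) ∞ M] [T2Space M] in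
/-- The value of a Hermitian form at `z` depends on the values at `z` of the vectors only. -/
lemma herm_congr {x : M} {z : Circle} {v v' w w' : A.fib x} (hv : P.ev x z v = P.ev x z v')
    (hw : P.ev x z w = P.ev x z w') : H.form x v w z = H.form x v' w' z := by
  have key : ∀ {v v' : A.fib x} (w : A.fib x), P.ev x z v = P.ev x z v' →
      H.form x v w z = H.form x v' w z := fun {v v'} w hv => by
    have h1 : v = (v - v') + v' := (sub_add_cancel v v').symm
    have h2 := P.herm_eq_zero H (u := v - v') (z := z) (by rw [P.ev_sub, hv, sub_self]) w
    have h3 : H.form x v w z = H.form x (v - v') w z + H.form x v' w z :=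
      congrArg (fun f : LC => f z) ((congrArg (fun u => H.form x u w) h1).trans
        (H.add_left x (v - v') v' w))
    rw [h3, h2, zero_add]
  have hc : ∀ v w, H.form x w v z = (starRingEnd ℂ) (H.form x v w z) := fun v w =>
    congrArg (fun f : LC => f z) (H.conj_symm x v w)
  rw [key w hv, hc w v', key v' hw, ← hc w' v']

/-- The Hermitian structure induced on the caloron transform. -/
noncomputable def hermFr : HermFr E where
  form p e e' := H.form p.1 (P.lift (x := p.1) (z := p.2) e) (P.lift (x := p.1) (z := p.2) e') p.2
  add_left p v v' w := by
    refine (P.herm_congr H (v' := P.lift (x := p.1) (z := p.2) v + P.lift (x := p.1) (z := p.2) v')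
      (by simp [P.map_add]) rfl).trans ?_
    exact congrArg (fun f : LC => f p.2) (H.add_left _ _ _ _)
  smul_left p c v w := by
    refine (P.herm_congr H (v' := algebraMap ℂ LC c • P.lift (x := p.1) (z := p.2) v)
      (by simp [P.ev_algebraMap_smul]) rfl).trans ?_
    exact congrArg (fun f : LC => f p.2) (H.smul_left _ _ _ _)
  conj_symm p v w := congrArg (fun f : LC => f p.2) (H.conj_symm p.1 _ _)
  pos p v hv := H.pos p.1 _ p.2 fun h => hv (by
    rwa [← P.ev_eq_zero, P.ev_lift] at h)
  smooth U s t hU hs ht := by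
    refine contMDiffOn_of_locally_contMDiffOn fun p hp => ?_
    obtain ⟨s', hs'⟩ := FrVect.exists_sec hU hs hp
    obtain ⟨t', ht'⟩ := FrVect.exists_sec hU ht hp
    obtain ⟨W, hW, hWo, hpW⟩ := eventually_nhds_iff.1 (hs'.and ht')
    refine ⟨W, hWo, hpW, ?_⟩
    have h1 := contMDiff_of_fsmoothM
      (H.smooth univ _ _ isOpen_univ (P.ofSec s').2 (P.ofSec t').2)
    refine h1.contMDiffOn.congr fun q hq => P.herm_congr H ?_ ?_
    · exact (P.ev_lift _).trans ((hW q hq.2).1.symm.trans (P.ev_ofSec s' q.1 q.2).symm)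
    · exact (P.ev_lift _).trans ((hW q hq.2).2.symm.trans (P.ev_ofSec t' q.1 q.2).symm)
  framed x i j := by
    obtain ⟨ψ, hψ, hx⟩ := A.cover x
    have hp := OVect.isFrame_equivAt hψ hx
    have h1 : ∀ i, P.ev x 1 (P.lift (E.framing x (Pi.single i 1)))
        = P.ev x 1 (ψ.equivAt hx (Pi.single i 1)) := fun i => by
      rw [P.ev_lift, ← P.framing x _ hp, constLoop_single]
    exact (P.herm_congr H (h1 i) (h1 j)).trans (H.based x _ hp i j)

lemma hermCompat_hermFr : P.HermCompat H (P.hermFr H) := fun _ _ _ _ =>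
  P.herm_congr H (P.ev_lift _) (P.ev_lift _)

end OToFr

section FrToO
variable (K : HermFr E)

lemma contMDiff_herm {x : M} (v w : A.fib x) : ContMDiff (𝓡 1) 𝓘(ℝ, ℂ) ∞
    fun z => K.form (x, z) (P.ev x z v) (P.ev x z w) := by
  obtain ⟨s, rfl⟩ := OVect.exists_sec_eq v
  obtain ⟨t, rfl⟩ := OVect.exists_sec_eq w
  have h := K.smooth univ _ _ isOpen_univ (P.toSec s).2 (P.toSec t).2
  exact (contMDiffOn_univ.1 h).comp (contMDiff_const.prodMk contMDiff_id)

/-- The Hermitian structure induced on the inverse caloron transform. -/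
noncomputable def hermO : HermO A where
  form x v w := LC.mk _ (P.contMDiff_herm K v w)
  add_left x v v' w := LC.ext fun z =>
    (congrArg (fun e => K.form (x, z) e _) (P.map_add x z v v')).trans (K.add_left _ _ _ _)
  smul_left x f v w := LC.ext fun z =>
    (congrArg (fun e => K.form (x, z) e _) (P.map_smul x z f v)).trans (K.smul_left _ _ _ _)
  conj_symm x v w := LC.ext fun z => K.conj_symm (x, z) _ _
  pos x v z hv := K.pos (x, z) _ fun h => hv ((P.ev_eq_zero x z v).1 h)
  smooth U s t hU hs ht := (fsmoothM_iff hU).2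
    (K.smooth _ _ _ (hU.prod isOpen_univ) ((P.sections U s hU).1 hs) ((P.sections U t hU).1 ht))
  based x p hp i j := by
    change K.form (x, 1) (P.ev x 1 _) (P.ev x 1 _) = _
    rw [← constLoop_single, ← constLoop_single, P.framing x p hp, P.framing x p hp]
    exact K.framed x i j

lemma hermCompat_hermO : P.HermCompat (P.hermO K) K := fun _ _ _ _ => rfl

end FrToO

section
variable {P P'} {H : HermO A} {K : HermFr E} {H' : HermO A'} {K' : HermFr E'}
  {f : OVect.Hom A A'} {g : FrVect.Hom E E'}

omit [IsManifold (𝓡 d) ∞ M] [T2Space M] in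
lemma Natural.hermFr_map (h : P.HermCompat H K) (h' : P'.HermCompat H' K')
    (hfg : P.Natural P' f g)
    (hf : ∀ x v w, H'.form x (f.toEquiv x v) (f.toEquiv x w) = H.form x v w) (p : M × Circle)
    (e e' : E.fib p) : K'.form p (g.toEquiv p e) (g.toEquiv p e') = K.form p e e' := by
  obtain ⟨v, rfl⟩ := P.surjective p.1 p.2 e
  obtain ⟨w, rfl⟩ := P.surjective p.1 p.2 e'
  refine (congrArg₂ (K'.form p) (hfg p.1 p.2 v) (hfg p.1 p.2 w)).trans ?_
  refine (h' p.1 p.2 _ _).trans (Eq.trans ?_ (h p.1 p.2 v w).symm)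
  rw [hf]

omit [IsManifold (𝓡 d) ∞ M] [T2Space M] in
lemma Natural.hermO_map (h : P.HermCompat H K) (h' : P'.HermCompat H' K')
    (hfg : P.Natural P' f g)
    (hg : ∀ p e e', K'.form p (g.toEquiv p e) (g.toEquiv p e') = K.form p e e') (x : M)
    (v w : A.fib x) : H'.form x (f.toEquiv x v) (f.toEquiv x w) = H.form x v w := by
  refine LC.ext fun z => ?_
  rw [← h', ← h, ← hfg, ← hfg, hg]

variable {D : ModConn A} {φ : Higgs A} {C : FrConn E}

omit [T2Space M] in
lemma ConnCompat.frConn_herm (hC : P.ConnCompat D φ C) (h : P.HermCompat H K)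
    (hD : ∀ (s t : A.Sec) x X, dLoop d (fun y => H.form y (s y) (t y)) x X
      = H.form x (D.toFun s x X) (t x) + H.form x (s x) (D.toFun t x X))
    (hφ : ∀ x v w, LC.del (H.form x v w) = H.form x (φ.toFun x v) w + H.form x v (φ.toFun x w))
    (s t : E.Sec) (p : M × Circle) (X : TangentSpace (MI d) p) :
    dFun (MI d) (fun q => K.form q (s q) (t q)) p X
      = K.form p (C.toFun s p X) (t p) + K.form p (s p) (C.toFun t p X) := by
  obtain ⟨s, rfl⟩ : ∃ s', P.toSec s' = s := ⟨_, P.toSec_ofSec s⟩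
  obtain ⟨t, rfl⟩ : ∃ t', P.toSec t' = t := ⟨_, P.toSec_ofSec t⟩
  obtain ⟨x, z⟩ := p
  have hsm := H.smooth univ _ _ isOpen_univ s.2 t.2
  have h1 : (fun q => K.form q (P.toSec s q) (P.toSec t q))
      = fun q : M × Circle => H.form q.1 (s q.1) (t q.1) q.2 := funext fun q => h q.1 q.2 _ _
  have h2 : dFun (MI d) (fun q : M × Circle => H.form q.1 (s q.1) (t q.1) q.2) (x, z) X = _ :=
    dFun_prod isOpen_univ hsm (mem_univ x) (fstVec X) z (sndVec X)
  have hadd : ∀ (a : ℝ) (v v' w : A.fib x),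
      K.form (x, z) (P.ev x z v + (a : ℂ) • P.ev x z v') (P.ev x z w)
        = H.form x v w z + a * H.form x v' w z := fun a v v' w => by
    rw [K.add_left, K.smul_left, h, h]
  have hadd' : ∀ (a : ℝ) (v v' w : A.fib x),
      K.form (x, z) (P.ev x z w) (P.ev x z v + (a : ℂ) • P.ev x z v')
        = H.form x w v z + a * H.form x w v' z := fun a v v' w => by
    rw [K.conj_symm, hadd, _root_.map_add, _root_.map_mul, Complex.conj_ofReal, ← h, ← h,
      ← K.conj_symm, ← K.conj_symm, h, h]
  have h3 : C.toFun (P.toSec s) (x, z) X = _ := hC s x z (fstVec X) (sndVec X)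
  have h4 : C.toFun (P.toSec t) (x, z) X = _ := hC t x z (fstVec X) (sndVec X)
  have h5 := congrArg (fun f : LC => f z) (hD s t x (fstVec X))
  have h6 := congrArg (fun f : LC => f z) (hφ x (s x) (t x))
  rw [h1, h2, h3, h4]
  refine Eq.trans ?_ (congrArg₂ (· + ·) (hadd (angForm z (sndVec X)) (D.toFun s x (fstVec X))
    (φ.toFun x (s x)) (t x)) (hadd' (angForm z (sndVec X)) (D.toFun t x (fstVec X))
    (φ.toFun x (t x)) (s x))).symm
  refine (congrArg₂ (fun a b : ℂ => a + (angForm z (sndVec X) : ℂ) * b) h5 h6).trans ?_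
  simp only [LC.add_apply]
  ring

omit [T2Space M] in
lemma ConnCompat.modConn_herm (hC : P.ConnCompat D φ C) (h : P.HermCompat H K)
    (hK : ∀ (s t : E.Sec) p X, dFun (MI d) (fun q => K.form q (s q) (t q)) p X
      = K.form p (C.toFun s p X) (t p) + K.form p (s p) (C.toFun t p X))
    (s t : A.Sec) (x : M) (X : TangentSpace (𝓡 d) x) :
    dLoop d (fun y => H.form y (s y) (t y)) x X
      = H.form x (D.toFun s x X) (t x) + H.form x (s x) (D.toFun t x X) := by
  refine LC.ext fun z => ?_
  have hsm := H.smooth univ _ _ isOpen_univ s.2 t.2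
  have h1 : (fun q => K.form q (P.toSec s q) (P.toSec t q))
      = fun q : M × Circle => H.form q.1 (s q.1) (t q.1) q.2 := funext fun q => h q.1 q.2 _ _
  have h2 := hK (P.toSec s) (P.toSec t) (x, z) (pairVec X (0 : TangentSpace (𝓡 1) z))
  rw [h1, dFun_prod isOpen_univ hsm (mem_univ x), angForm_zero, Complex.ofReal_zero, zero_mul,
    add_zero, hC.horizontal, hC.horizontal] at h2
  exact h2.trans (congrArg₂ (· + ·) (h x z _ _) (h x z _ _))

lemma ConnCompat.higgs_herm (hC : P.ConnCompat D φ C) (h : P.HermCompat H K)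
    (hK : ∀ (s t : E.Sec) p X, dFun (MI d) (fun q => K.form q (s q) (t q)) p X
      = K.form p (C.toFun s p X) (t p) + K.form p (s p) (C.toFun t p X))
    (x : M) (v w : A.fib x) :
    LC.del (H.form x v w) = H.form x (φ.toFun x v) w + H.form x v (φ.toFun x w) := by
  obtain ⟨s, rfl⟩ := OVect.exists_sec_eq v
  obtain ⟨t, rfl⟩ := OVect.exists_sec_eq w
  refine LC.ext fun z => ?_
  have hsm := H.smooth univ _ _ isOpen_univ s.2 t.2
  have h1 : (fun q => K.form q (P.toSec s q) (P.toSec t q))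
      = fun q : M × Circle => H.form q.1 (s q.1) (t q.1) q.2 := funext fun q => h q.1 q.2 _ _
  have h2 := hK (P.toSec s) (P.toSec t) (x, z)
    (pairVec (0 : TangentSpace (𝓡 d) x) (angVec z))
  rw [h1, dFun_prod isOpen_univ hsm (mem_univ x), dLoop_zero hsm, angForm_angVec,
    Complex.ofReal_one, one_mul, zero_add, hC.vertical, hC.vertical] at h2
  exact h2.trans (congrArg₂ (· + ·) (h x z _ _) (h x z _ _))

end

end CaloronPairing
end Caloron

/-! ### The equivalences of groupoids -/

namespace Caloron
variable {d n : ℕ} {M : Type v} [TopologicalSpace M] [T2Space M] [ChartedSpace (Eu d) M]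
  [IsManifold (𝓡 d) ∞ M]

section Bundles

/-- The caloron transform `𝒱` as a functor. -/
noncomputable def caloronFunctor : OVect.{u} d n M ⥤ FrVect.{u} d n M where
  obj A := A.caloron
  map {A A'} f := A.caloronPairing.homFr A'.caloronPairing f
  map_id A := A.caloronPairing.ev_hom_ext fun x z v => A.caloronPairing.homFr_ev _ _ x z v
  map_comp {A A' A''} f g := A.caloronPairing.ev_hom_ext fun x z v =>
    (A.caloronPairing.homFr_ev A''.caloronPairing (f ≫ g) x z v).trans <|
      ((congrArg (FrVect.fibMap (A'.caloronPairing.homFr A''.caloronPairing g) (x, z))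
        (A.caloronPairing.homFr_ev A'.caloronPairing f x z v)).trans
        (A'.caloronPairing.homFr_ev A''.caloronPairing g x z _)).symm

/-- The inverse caloron transform `𝒱⁻¹` as a functor. -/
noncomputable def invCaloronFunctor : FrVect.{u} d n M ⥤ OVect.{u} d n M where
  obj E := E.invCaloron
  map {E E'} g := E.invCaloronPairing.homO E'.invCaloronPairing g
  map_id E := E.invCaloronPairing.hom_ev_ext fun x z v => E.invCaloronPairing.ev_homO _ _ x z v
  map_comp {E E' E''} f g := E''.invCaloronPairing.hom_ev_ext fun x z v =>
    (E.invCaloronPairing.ev_homO E''.invCaloronPairing (f ≫ g) x z v).trans <|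
      ((E'.invCaloronPairing.ev_homO E''.invCaloronPairing g x z _).trans
        (congrArg (FrVect.fibMap g (x, z))
          (E.invCaloronPairing.ev_homO E'.invCaloronPairing f x z v))).symm

/-- The isomorphism `𝖤 ≅ 𝒱⁻¹(𝒱(𝖤))` that regards both sides as spaces of sections of `𝒱(𝖤)`. -/
noncomputable def caloronUnit (A : OVect.{u} d n M) : A ⟶ A.caloron.invCaloron :=
  A.caloronPairing.homO A.caloron.invCaloronPairing (FrVect.Hom.id A.caloron)

lemma natural_caloronUnit (A : OVect.{u} d n M) : A.caloronPairing.Natural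
    A.caloron.invCaloronPairing (caloronUnit A) (FrVect.Hom.id A.caloron) :=
  A.caloronPairing.natural_homO _ _

/-- The isomorphism `𝒱(𝒱⁻¹(E)) ≅ E` induced by evaluation of loops. -/
noncomputable def caloronCounit (E : FrVect.{u} d n M) : E.invCaloron.caloron ⟶ E :=
  E.invCaloron.caloronPairing.homFr E.invCaloronPairing (OVect.Hom.id E.invCaloron)

lemma natural_caloronCounit (E : FrVect.{u} d n M) : E.invCaloron.caloronPairing.Natural
    E.invCaloronPairing (OVect.Hom.id E.invCaloron) (caloronCounit E) :=
  E.invCaloron.caloronPairing.natural_homFr _ _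

lemma caloronUnit_naturality {A A' : OVect.{u} d n M} (f : A ⟶ A') :
    f ≫ caloronUnit A' = caloronUnit A ≫ invCaloronFunctor.map (caloronFunctor.map f) :=
  A'.caloron.invCaloronPairing.hom_ev_ext fun x z v => by
    refine ((natural_caloronUnit A' x z (OVect.fibMap f x v)).symm).trans (Eq.trans ?_
      (A.caloron.invCaloronPairing.ev_homO A'.caloron.invCaloronPairing
        (caloronFunctor.map f) x z (OVect.fibMap (caloronUnit A) x v)).symm)
    exact ((congrArg (FrVect.fibMap (caloronFunctor.map f) (x, z))
      (natural_caloronUnit A x z v).symm).trans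
      (A.caloronPairing.homFr_ev A'.caloronPairing f x z v)).symm

lemma caloronCounit_naturality {E E' : FrVect.{u} d n M} (g : E ⟶ E') :
    caloronFunctor.map (invCaloronFunctor.map g) ≫ caloronCounit E' = caloronCounit E ≫ g :=
  E.invCaloron.caloronPairing.ev_hom_ext fun x z v => by
    refine (congrArg (FrVect.fibMap (caloronCounit E') (x, z))
      (E.invCaloron.caloronPairing.homFr_ev E'.invCaloron.caloronPairing
        (invCaloronFunctor.map g) x z v)).trans ?_
    refine (natural_caloronCounit E' x z _).trans ?_
    refine (E.invCaloronPairing.ev_homO E'.invCaloronPairing g x z v).trans ?_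
    exact (congrArg (FrVect.fibMap g (x, z)) (natural_caloronCounit E x z v)).symm

lemma caloron_triangle (A : OVect.{u} d n M) :
    caloronFunctor.map (caloronUnit A) ≫ caloronCounit A.caloron = 𝟙 A.caloron :=
  A.caloronPairing.ev_hom_ext fun x z v =>
    ((congrArg (FrVect.fibMap (caloronCounit A.caloron) (x, z))
      (A.caloronPairing.homFr_ev A.caloron.invCaloron.caloronPairing (caloronUnit A) x z v)).trans
      (natural_caloronCounit A.caloron x z _)).trans (natural_caloronUnit A x z v).symm

/-- The equivalence `𝒱 : ΩVect(M) ⇄ FrVect(M) : 𝒱⁻¹`. -/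
noncomputable def caloronEquiv : OVect.{u} d n M ≌ FrVect.{u} d n M where
  functor := caloronFunctor
  inverse := invCaloronFunctor
  unitIso := NatIso.ofComponents (fun A => (Groupoid.isoEquivHom _ _).symm (caloronUnit A))
    fun f => caloronUnit_naturality f
  counitIso := NatIso.ofComponents (fun E => (Groupoid.isoEquivHom _ _).symm (caloronCounit E))
    fun g => caloronCounit_naturality g
  functor_unitIso_comp A := caloron_triangle A

variable (d n M) in
/-- The caloron correspondence for bundles without connections. -/
noncomputable def caloronCorrespondence :
    CaloronCorrespondence (𝟭 (OVect.{u} d n M)) (𝟭 (FrVect.{u} d n M)) where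
  equiv := caloronEquiv
  pairV A := A.caloronPairing
  assocV A := A.caloronPairing.isAssociated
  pairW E := E.invCaloronPairing
  assocW E := E.invCaloronPairing.isLoopAssociated
  mapV A A' f := A.caloronPairing.homFr_ev A'.caloronPairing f
  mapW E E' g := E.invCaloronPairing.natural_homO E'.invCaloronPairing g
  unit_ev A x z v := (natural_caloronUnit A x z v).symm
  counit_ev E := natural_caloronCounit E

end Bundles

section Connections

namespace OVectC
variable (A : OVectC.{u} d n M)

/-- The caloron transform of a bundle with connection and Higgs field. -/
noncomputable def caloron : FrVectC.{u} d n M :=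
  ⟨A.bdl.caloron, A.bdl.caloronPairing.frConn A.conn A.higgs⟩

lemma connCompat : A.bdl.caloronPairing.ConnCompat A.conn A.higgs A.caloron.conn :=
  A.bdl.caloronPairing.connCompat_frConn _ _

end OVectC

namespace FrVectC
variable (B : FrVectC.{u} d n M)

/-- The inverse caloron transform of a bundle with connection. -/
noncomputable def invCaloron : OVectC.{u} d n M :=
  ⟨B.bdl.invCaloron, B.bdl.invCaloronPairing.modConn B.conn, B.bdl.invCaloronPairing.higgs B.conn⟩

lemma connCompat : B.bdl.invCaloronPairing.ConnCompat B.invCaloron.conn B.invCaloron.higgs B.conn :=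
  B.bdl.invCaloronPairing.connCompat_modConn _

end FrVectC

/-- The caloron transform of bundles with connection as a functor. -/
noncomputable def caloronFunctorC : OVectC.{u} d n M ⥤ FrVectC.{u} d n M where
  obj A := A.caloron
  map {A A'} f := ⟨caloronFunctor.map f.iso,
    (A.bdl.caloronPairing.natural_homFr A'.bdl.caloronPairing f.iso).conn_map A.connCompat
      A'.connCompat f.conn_map f.higgs_map⟩
  map_id A := FrVectC.Hom.ext (caloronFunctor.map_id A.bdl)
  map_comp f g := FrVectC.Hom.ext (caloronFunctor.map_comp f.iso g.iso)

/-- The inverse caloron transform of bundles with connection as a functor. -/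
noncomputable def invCaloronFunctorC : FrVectC.{u} d n M ⥤ OVectC.{u} d n M where
  obj B := B.invCaloron
  map {B B'} g := ⟨invCaloronFunctor.map g.iso,
    (B.bdl.invCaloronPairing.natural_homO B'.bdl.invCaloronPairing g.iso).modConn_map B.connCompat
      B'.connCompat g.conn_map,
    (B.bdl.invCaloronPairing.natural_homO B'.bdl.invCaloronPairing g.iso).higgs_map B.connCompat
      B'.connCompat g.conn_map⟩
  map_id B := OVectC.Hom.ext (invCaloronFunctor.map_id B.bdl)
  map_comp f g := OVectC.Hom.ext (invCaloronFunctor.map_comp f.iso g.iso)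

/-- The unit preserves the connection and the Higgs field, as both sides induce the same connection
on `𝒱(𝖤)`. -/
noncomputable def caloronUnitC (A : OVectC.{u} d n M) : A ⟶ A.caloron.invCaloron :=
  ⟨caloronUnit A.bdl,
    (natural_caloronUnit A.bdl).modConn_map A.connCompat A.caloron.connCompat fun _ _ _ => rfl,
    (natural_caloronUnit A.bdl).higgs_map A.connCompat A.caloron.connCompat fun _ _ _ => rfl⟩

/-- The counit preserves the connection. -/
noncomputable def caloronCounitC (B : FrVectC.{u} d n M) : B.invCaloron.caloron ⟶ B :=
  ⟨caloronCounit B.bdl, (natural_caloronCounit B.bdl).conn_map B.invCaloron.connCompat B.connCompat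
    (fun _ _ _ => rfl) fun _ _ => rfl⟩

/-- The equivalence `𝒱 : ΩVectᶜ(M) ⇄ FrVectᶜ(M) : 𝒱⁻¹`. -/
noncomputable def caloronEquivC : OVectC.{u} d n M ≌ FrVectC.{u} d n M where
  functor := caloronFunctorC
  inverse := invCaloronFunctorC
  unitIso := NatIso.ofComponents (fun A => (Groupoid.isoEquivHom _ _).symm (caloronUnitC A))
    fun f => OVectC.Hom.ext (caloronUnit_naturality f.iso)
  counitIso := NatIso.ofComponents (fun E => (Groupoid.isoEquivHom _ _).symm (caloronCounitC E))
    fun g => FrVectC.Hom.ext (caloronCounit_naturality g.iso)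
  functor_unitIso_comp A := FrVectC.Hom.ext (caloron_triangle A.bdl)

variable (d n M) in
/-- The caloron correspondence for bundles with connections. -/
noncomputable def caloronCorrespondenceC :
    GeometricCaloronCorrespondence (𝟭 (OVectC.{u} d n M)) (𝟭 (FrVectC.{u} d n M)) where
  equiv := caloronEquivC
  pairV A := A.bdl.caloronPairing
  assocV A := A.bdl.caloronPairing.isAssociated
  pairW B := B.bdl.invCaloronPairing
  assocW B := B.bdl.invCaloronPairing.isLoopAssociated
  mapV A A' f := A.bdl.caloronPairing.homFr_ev A'.bdl.caloronPairing f.iso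
  mapW B B' g := B.bdl.invCaloronPairing.natural_homO B'.bdl.invCaloronPairing g.iso
  unit_ev A x z v := (natural_caloronUnit A.bdl x z v).symm
  counit_ev B := natural_caloronCounit B.bdl
  connV A _ _ hst := A.connCompat.apply hst
  connW B s t hst x z X := by
    rw [hst.left_unique (B.bdl.invCaloronPairing.corr_toSec t)]
    exact (B.connCompat.horizontal t x z X).symm
  higgsW B s t hst x z := by
    rw [hst.left_unique (B.bdl.invCaloronPairing.corr_toSec t)]
    exact (B.connCompat.vertical t x z).symm

end Connections

section Hermitian

namespace OVectHC
variable (A : OVectHC.{u} d n M)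

/-- The caloron transform of a Hermitian bundle with connection and Higgs field. -/
noncomputable def caloron : FrVectHC.{u} d n M where
  base := A.base.caloron
  herm := A.base.bdl.caloronPairing.hermFr A.herm
  conn_compat := A.base.connCompat.frConn_herm (A.base.bdl.caloronPairing.hermCompat_hermFr A.herm)
    A.conn_compat A.higgs_compat

lemma hermCompat : A.base.bdl.caloronPairing.HermCompat A.herm A.caloron.herm :=
  A.base.bdl.caloronPairing.hermCompat_hermFr A.herm

end OVectHC

namespace FrVectHC
variable (B : FrVectHC.{u} d n M)

/-- The inverse caloron transform of a Hermitian bundle with connection. -/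
noncomputable def invCaloron : OVectHC.{u} d n M where
  base := B.base.invCaloron
  herm := B.base.bdl.invCaloronPairing.hermO B.herm
  conn_compat := B.base.connCompat.modConn_herm
    (B.base.bdl.invCaloronPairing.hermCompat_hermO B.herm) B.conn_compat
  higgs_compat := B.base.connCompat.higgs_herm
    (B.base.bdl.invCaloronPairing.hermCompat_hermO B.herm) B.conn_compat

lemma hermCompat : B.base.bdl.invCaloronPairing.HermCompat B.invCaloron.herm B.herm :=
  B.base.bdl.invCaloronPairing.hermCompat_hermO B.herm

end FrVectHC

/-- The caloron transform of Hermitian bundles with connection as a functor. -/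
noncomputable def caloronFunctorHC : OVectHC.{u} d n M ⥤ FrVectHC.{u} d n M where
  obj A := A.caloron
  map {A A'} f := ⟨caloronFunctorC.map f.iso, CaloronPairing.Natural.hermFr_map A.hermCompat
    A'.hermCompat (A.base.bdl.caloronPairing.natural_homFr A'.base.bdl.caloronPairing f.iso.iso)
    f.herm_map⟩
  map_id A := FrVectHC.Hom.ext (caloronFunctorC.map_id A.base)
  map_comp f g := FrVectHC.Hom.ext (caloronFunctorC.map_comp f.iso g.iso)

/-- The inverse caloron transform of Hermitian bundles with connection as a functor. -/
noncomputable def invCaloronFunctorHC : FrVectHC.{u} d n M ⥤ OVectHC.{u} d n M where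
  obj B := B.invCaloron
  map {B B'} g := ⟨invCaloronFunctorC.map g.iso, CaloronPairing.Natural.hermO_map B.hermCompat
    B'.hermCompat
    (B.base.bdl.invCaloronPairing.natural_homO B'.base.bdl.invCaloronPairing g.iso.iso)
    g.herm_map⟩
  map_id B := OVectHC.Hom.ext (invCaloronFunctorC.map_id B.base)
  map_comp f g := OVectHC.Hom.ext (invCaloronFunctorC.map_comp f.iso g.iso)

/-- The unit is isometric. -/
noncomputable def caloronUnitHC (A : OVectHC.{u} d n M) : A ⟶ A.caloron.invCaloron :=
  ⟨caloronUnitC A.base, CaloronPairing.Natural.hermO_map A.hermCompat A.caloron.hermCompat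
    (natural_caloronUnit A.base.bdl) fun _ _ _ => rfl⟩

/-- The counit is isometric. -/
noncomputable def caloronCounitHC (B : FrVectHC.{u} d n M) : B.invCaloron.caloron ⟶ B :=
  ⟨caloronCounitC B.base, CaloronPairing.Natural.hermFr_map B.invCaloron.hermCompat B.hermCompat
    (natural_caloronCounit B.base.bdl) fun _ _ _ => rfl⟩

/-- The equivalence `𝒱 : ΩVectᶜ_H(M) ⇄ FrVectᶜ_H(M) : 𝒱⁻¹`. -/
noncomputable def caloronEquivHC : OVectHC.{u} d n M ≌ FrVectHC.{u} d n M where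
  functor := caloronFunctorHC
  inverse := invCaloronFunctorHC
  unitIso := NatIso.ofComponents (fun A => (Groupoid.isoEquivHom _ _).symm (caloronUnitHC A))
    fun f => OVectHC.Hom.ext (OVectC.Hom.ext (caloronUnit_naturality f.iso.iso))
  counitIso := NatIso.ofComponents (fun E => (Groupoid.isoEquivHom _ _).symm (caloronCounitHC E))
    fun g => FrVectHC.Hom.ext (FrVectC.Hom.ext (caloronCounit_naturality g.iso.iso))
  functor_unitIso_comp A := FrVectHC.Hom.ext (FrVectC.Hom.ext (caloron_triangle A.base.bdl))

variable (d n M) in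
/-- The caloron correspondence for Hermitian bundles with connections. -/
noncomputable def caloronCorrespondenceHC : GeometricCaloronCorrespondence
    (forgetHermO.{u} (d := d) (n := n) (M := M)) (forgetHermFr.{u} (d := d) (n := n) (M := M)) where
  equiv := caloronEquivHC
  pairV A := A.base.bdl.caloronPairing
  assocV A := A.base.bdl.caloronPairing.isAssociated
  pairW B := B.base.bdl.invCaloronPairing
  assocW B := B.base.bdl.invCaloronPairing.isLoopAssociated
  mapV A A' f := A.base.bdl.caloronPairing.homFr_ev A'.base.bdl.caloronPairing f.iso.iso
  mapW B B' g := B.base.bdl.invCaloronPairing.natural_homO B'.base.bdl.invCaloronPairing g.iso.iso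
  unit_ev A x z v := (natural_caloronUnit A.base.bdl x z v).symm
  counit_ev B := natural_caloronCounit B.base.bdl
  connV A := (caloronCorrespondenceC d n M).connV A.base
  connW B := (caloronCorrespondenceC d n M).connW B.base
  higgsW B := (caloronCorrespondenceC d n M).higgsW B.base

end Hermitian
end Caloron

theorem mainTheorem10 (d n : ℕ) (M : Type v) [TopologicalSpace M] [T2Space M]
    [ParacompactSpace M] [ChartedSpace (Caloron.Eu d) M] [IsManifold (𝓡 d) ∞ M] :
    ∃ (K₀ : Caloron.CaloronCorrespondence
        (𝟭 (Caloron.OVect.{u} d n M)) (𝟭 (Caloron.FrVect.{u} d n M)))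
      (K : Caloron.GeometricCaloronCorrespondence
        (𝟭 (Caloron.OVectC.{u} d n M)) (𝟭 (Caloron.FrVectC.{u} d n M)))
      (KH : Caloron.GeometricCaloronCorrespondence
        (Caloron.forgetHermO.{u} (d := d) (n := n) (M := M))
        (Caloron.forgetHermFr.{u} (d := d) (n := n) (M := M))),
      (K.equiv.functor ⋙ Caloron.forgetConnFr = Caloron.forgetConnO ⋙ K₀.equiv.functor ∧
        K.equiv.inverse ⋙ Caloron.forgetConnO = Caloron.forgetConnFr ⋙ K₀.equiv.inverse) ∧
      (KH.equiv.functor ⋙ Caloron.forgetHermFr = Caloron.forgetHermO ⋙ K.equiv.functor ∧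
        KH.equiv.inverse ⋙ Caloron.forgetHermO = Caloron.forgetHermFr ⋙ K.equiv.inverse) ∧
      (∀ (A : Caloron.OVectHC.{u} d n M) x z v w,
        (KH.equiv.functor.obj A).herm.form (x, z) ((KH.pairV A).ev x z v) ((KH.pairV A).ev x z w)
          = A.herm.form x v w z) ∧
      ∀ (B : Caloron.FrVectHC.{u} d n M) x z v w,
        (KH.equiv.inverse.obj B).herm.form x v w z
          = B.herm.form (x, z) ((KH.pairW B).ev x z v) ((KH.pairW B).ev x z w) :=
  ⟨Caloron.caloronCorrespondence d n M, Caloron.caloronCorrespondenceC d n M,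
    Caloron.caloronCorrespondenceHC d n M, ⟨rfl, rfl⟩, ⟨rfl, rfl⟩, fun A => A.hermCompat,
    fun _ _ _ _ _ => rfl⟩
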